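/- Let $(V,Q)$ be a finite-dimensional complex vector space with a nondegenerate quadratic form, and let $\mathcal O\subset\mathfrak{so}(V)$ be a nilpotent $SO(V)$-orbit. Let $c_0\ge c_1\ge c_2\ge\cdots$ (extended by zeros) be the column lengths of its Young diagram, whose rows are the sizes of the Jordan blocks. Assume that for every $j\ge 0$ either $c_{2j}=c_{2j+1}$ or $c_{2j}=c_{2j+1}+1$, and that the second case occurs for exactly $2k+1$ values of $j$, where $k\ge 0$. (Equivalently, each odd row size occurs at most once, and there are $2k+1$ odd rows; then $\dim V$ is odd. This includes the case where the odd rows are $1,3,5,\dots,4k+1$, each occurring once, and the even rows have sizes at most $4k+2$.) For $e\in\mathcal O$ let $A(\mathcal O)$ and $A_{Spin}(\mathcal O)$ be the component groups of the centralizers of $e$ in $SO(V)$ and in the complex group $Spin(V)$. Then $A(\mathcal O)\cong\mathbb Z_2^{2k}$, and the covering $Spin(V)\to SO(V)$ induces a central extension $$1\longrightarrow\mathbb Z_2\longrightarrow A_{Spin}(\mathcal O)\longrightarrow A(\mathcal O)\longrightarrow 1,$$ in which the generator of $\mathbb Z_2$ maps to the class of $-1\in Spin(V)$. This extension is nontrivial,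 i.e. does not split, if $k\ge 1$. Consequently, $A_{Spin}(\mathcal O)$ has exactly $2^{2k}$ characters lifted from $A(\mathcal O)$, and, up to isomorphism, exactly one genuine irreducible complex representation (one in which the class of $-1$ acts by $-1$). The degree of the latter is $2^k$, and every irreducible complex representation of $A_{Spin}(\mathcal O)$ is either one of these lifted characters or genuine. -/

import Mathlib

noncomputable section

namespace SpinOrbit

/-! ### Component groups -/

section Component

variable (G : Type*) [Group G] [TopologicalSpace G] [SeparatelyContinuousMul G]

/-- The identity component of a group with a topology for which left and right translations are
continuous. -/
def identityComponent : Subgroup G where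
  carrier := connectedComponent (1 : G)
  one_mem' := mem_connectedComponent
  mul_mem' := by
    intro a b ha hb
    have h := Continuous.image_connectedComponent_subset
      (f := fun x : G => a * x) SeparatelyContinuousMul.continuous_const_mul 1 ⟨b, hb, rfl⟩
    have h2 : connectedComponent (a * 1) = connectedComponent (1 : G) := by
      rw [mul_one]; exact (connectedComponent_eq ha).symm
    rw [← h2]; exact h
  inv_mem' := by
    intro a ha
    have h := Continuous.image_connectedComponent_subset
      (f := fun x : G => a⁻¹ * x) SeparatelyContinuousMul.continuous_const_mul a
      ⟨1, by rw [← connectedComponent_eq ha]; exact mem_connectedComponent, rfl⟩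
    simpa using h

instance identityComponent_normal : (identityComponent G).Normal where
  conj_mem := by
    intro a ha g
    have hc : Continuous (fun x : G => g * x * g⁻¹) :=
      (SeparatelyContinuousMul.continuous_mul_const (a := g⁻¹)).comp
        (SeparatelyContinuousMul.continuous_const_mul (a := g))
    have h := Continuous.image_connectedComponent_subset hc 1 ⟨a, ha, rfl⟩
    change g * a * g⁻¹ ∈ connectedComponent (1 : G)
    simpa using h

/-- The component group `G / G⁰`. -/
abbrev ComponentGroup : Type _ := G ⧸ identityComponent G

end Component

instance subgroup_separatelyContinuousMul {G : Type*} [Group G] [TopologicalSpace G]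
    [SeparatelyContinuousMul G] (H : Subgroup G) : SeparatelyContinuousMul H where
  continuous_const_mul := by
    intro a
    exact Continuous.subtype_mk
      ((SeparatelyContinuousMul.continuous_const_mul (a := (a : G))).comp continuous_subtype_val) _
  continuous_mul_const := by
    intro a
    exact Continuous.subtype_mk
      ((SeparatelyContinuousMul.continuous_mul_const (a := (a : G))).comp continuous_subtype_val) _

/-! ### The complex special orthogonal and spin groups with their usual topologies -/

section Groups

variable {V : Type*} [AddCommGroup V] [Module ℂ V] (Q : QuadraticForm ℂ V)

/-- The Lie algebra `so(V, Q)`: the endomorphisms of `V` that are skew for the bilinear form. -/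
abbrev so : Submodule ℂ (Module.End ℂ V) :=
  LinearMap.skewAdjointSubmodule (QuadraticMap.polarBilin Q)

/-- The complex special orthogonal group `SO(V, Q)`. -/
def SO : Subgroup (V ≃ₗ[ℂ] V) where
  carrier := {g | (∀ v, Q (g v) = Q v) ∧ LinearEquiv.det g = 1}
  one_mem' := ⟨fun _ => rfl, map_one _⟩
  mul_mem' := by
    rintro a b ⟨ha, ha'⟩ ⟨hb, hb'⟩
    exact ⟨fun v => by rw [LinearEquiv.mul_apply, ha, hb], by rw [map_mul, ha', hb', one_mul]⟩
  inv_mem' := by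
    rintro a ⟨ha, ha'⟩
    refine ⟨fun v => ?_, by rw [map_inv, ha', inv_one]⟩
    rw [← ha (a⁻¹ v), ← LinearEquiv.mul_apply, mul_inv_cancel]
    rfl

/-- The topology on `SO(V, Q)` as a subset of the complex vector space `End V`
(for finite-dimensional `V`, `moduleTopology ℂ` is the usual topology of a complex vector space). -/
instance : TopologicalSpace (SO Q) :=
  TopologicalSpace.induced (fun g => ((g : V ≃ₗ[ℂ] V) : Module.End ℂ V))
    (moduleTopology ℂ (Module.End ℂ V))

instance : SeparatelyContinuousMul (SO Q) where
  continuous_const_mul := by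
    intro a
    let _ : TopologicalSpace (Module.End ℂ V) := moduleTopology ℂ _
    have : IsModuleTopology ℂ (Module.End ℂ V) := ⟨rfl⟩
    have : ContinuousAdd (Module.End ℂ V) := IsModuleTopology.toContinuousAdd ℂ _
    refine continuous_induced_rng.2 ?_
    exact (IsModuleTopology.continuous_of_linearMap
      (LinearMap.mulLeft ℂ (((a : V ≃ₗ[ℂ] V) : Module.End ℂ V)))).comp continuous_induced_dom
  continuous_mul_const := by
    intro a
    let _ : TopologicalSpace (Module.End ℂ V) := moduleTopology ℂ _
    have : IsModuleTopology ℂ (Module.End ℂ V) := ⟨rfl⟩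
    have : ContinuousAdd (Module.End ℂ V) := IsModuleTopology.toContinuousAdd ℂ _
    refine continuous_induced_rng.2 ?_
    exact (IsModuleTopology.continuous_of_linearMap
      (LinearMap.mulRight ℂ (((a : V ≃ₗ[ℂ] V) : Module.End ℂ V)))).comp continuous_induced_dom

/-- The topology on the complex spin group as a subset of the complex vector space `C(V)`. -/
instance : TopologicalSpace (spinGroup Q) :=
  TopologicalSpace.induced Subtype.val (moduleTopology ℂ (CliffordAlgebra Q))

instance : SeparatelyContinuousMul (spinGroup Q) where
  continuous_const_mul := by
    intro a
    let _ : TopologicalSpace (CliffordAlgebra Q) := moduleTopology ℂ _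
    have : IsModuleTopology ℂ (CliffordAlgebra Q) := ⟨rfl⟩
    have : ContinuousAdd (CliffordAlgebra Q) := IsModuleTopology.toContinuousAdd ℂ _
    refine continuous_induced_rng.2 ?_
    exact (IsModuleTopology.continuous_of_linearMap
      (LinearMap.mulLeft ℂ (a : CliffordAlgebra Q))).comp continuous_induced_dom
  continuous_mul_const := by
    intro a
    let _ : TopologicalSpace (CliffordAlgebra Q) := moduleTopology ℂ _
    have : IsModuleTopology ℂ (CliffordAlgebra Q) := ⟨rfl⟩
    have : ContinuousAdd (CliffordAlgebra Q) := IsModuleTopology.toContinuousAdd ℂ _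
    refine continuous_induced_rng.2 ?_
    exact (IsModuleTopology.continuous_of_linearMap
      (LinearMap.mulRight ℂ (a : CliffordAlgebra Q))).comp continuous_induced_dom

/-! ### The covering `Spin(V, Q) → SO(V, Q)` -/

theorem ι_injective : Function.Injective (CliffordAlgebra.ι Q) := by
  let _ : Invertible (2 : ℂ) := invertibleOfNonzero two_ne_zero
  intro v w h
  have h' := congrArg (CliffordAlgebra.equivExterior Q) h
  unfold CliffordAlgebra.equivExterior at h'
  simp only [CliffordAlgebra.changeFormEquiv_apply, CliffordAlgebra.changeForm_ι] at h'
  exact ExteriorAlgebra.ι_leftInverse.injective h'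

theorem clifford_nontrivial : Nontrivial (CliffordAlgebra Q) := by
  let _ : Invertible (2 : ℂ) := invertibleOfNonzero two_ne_zero
  have : Nontrivial (ExteriorAlgebra ℂ V) :=
    (ExteriorAlgebra.algebraMap_leftInverse (R := ℂ) V).injective.nontrivial
  exact (CliffordAlgebra.equivExterior Q).toEquiv.nontrivial

open CliffordAlgebra in
/-- An element of the Lipschitz group acts on `V` by a linear automorphism `g` whose determinant
is the parity of the element. -/
theorem lipschitz_exists [FiniteDimensional ℂ V] {u : (CliffordAlgebra Q)ˣ}
    (hu : u ∈ lipschitzGroup Q) :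
    ∃ g : V ≃ₗ[ℂ] V, involute (u : CliffordAlgebra Q) =
        ((LinearEquiv.det g : ℂˣ) : ℂ) • (u : CliffordAlgebra Q) ∧
      ∀ v, involute (u : CliffordAlgebra Q) * ι Q v = ι Q (g v) * (u : CliffordAlgebra Q) := by
  unfold lipschitzGroup at hu
  induction hu using Subgroup.closure_induction with
  | one => exact ⟨1, by simp, by simp⟩
  | mem x hx =>
    obtain ⟨a, ha⟩ := hx
    let _ : Invertible (2 : ℂ) := invertibleOfNonzero two_ne_zero
    have hq : IsUnit (Q a) := isUnit_of_isUnit_ι Q (m := a) (by rw [ha]; exact x.isUnit)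
    have hq0 : Q a ≠ 0 := hq.ne_zero
    have hf : (-(Q a)⁻¹ • QuadraticMap.polarBilin Q a) a = -2 := by
      simp only [LinearMap.smul_apply, QuadraticMap.polarBilin_apply_apply,
        QuadraticMap.polar_self, smul_eq_mul, two_smul]
      field_simp
      ring
    have hdet : LinearMap.det (LinearMap.transvection
        (-(Q a)⁻¹ • QuadraticMap.polarBilin Q a) a) = -1 := by
      rw [LinearMap.transvection.det, hf]; norm_num
    let g : V ≃ₗ[ℂ] V := LinearEquiv.ofIsUnitDet (f := LinearMap.transvection
        (-(Q a)⁻¹ • QuadraticMap.polarBilin Q a) a)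
        (v := Module.finBasis ℂ V) (v' := Module.finBasis ℂ V)
        (by rw [LinearMap.det_toMatrix, hdet]; exact isUnit_one.neg)
    have hg : ∀ v, g v = v - ((Q a)⁻¹ * QuadraticMap.polar Q a v) • a := by
      intro v
      change LinearMap.transvection _ _ v = _
      rw [LinearMap.transvection.apply]
      simp [sub_eq_add_neg]
    have hgd : ((LinearEquiv.det g : ℂˣ) : ℂ) = -1 := by
      rw [LinearEquiv.coe_det, ← hdet]; rfl
    refine ⟨g, ?_, ?_⟩
    · rw [hgd, ← ha, involute_ι]; simp
    · intro v
      have key : ι Q a * ι Q v + ι Q v * ι Q a = algebraMap ℂ _ (QuadraticMap.polar Q a v) :=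
        ι_mul_ι_add_swap a v
      rw [← ha, involute_ι, hg, map_sub, map_smul, sub_mul, smul_mul_assoc, ι_sq_scalar,
        Algebra.smul_def, ← (algebraMap ℂ (CliffordAlgebra Q)).map_mul,
        show (Q a)⁻¹ * QuadraticMap.polar Q a v * Q a = QuadraticMap.polar Q a v by field_simp,
        ← key]
      noncomm_ring
  | mul x y _ _ hx hy =>
    obtain ⟨g, hg, hg'⟩ := hx
    obtain ⟨h, hh, hh'⟩ := hy
    refine ⟨g * h, ?_, fun v => ?_⟩
    · rw [Units.val_mul, map_mul, hg, hh, map_mul, Units.val_mul]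
      simp [smul_smul, mul_comm]
    · rw [Units.val_mul, map_mul, mul_assoc, hh', ← mul_assoc, hg', mul_assoc]; rfl
  | inv x _ hx =>
    obtain ⟨g, hg, hg'⟩ := hx
    have hi : involute (x : CliffordAlgebra Q) * involute ((x⁻¹ : (CliffordAlgebra Q)ˣ) :
        CliffordAlgebra Q) = 1 := by rw [← map_mul, Units.mul_inv, map_one]
    have hi' : involute ((x⁻¹ : (CliffordAlgebra Q)ˣ) : CliffordAlgebra Q) *
        involute (x : CliffordAlgebra Q) = 1 := by rw [← map_mul, Units.inv_mul, map_one]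
    refine ⟨g⁻¹, ?_, fun v => ?_⟩
    · have h1 : (((LinearEquiv.det g : ℂˣ) : ℂ) • (x : CliffordAlgebra Q)) *
          involute ((x⁻¹ : (CliffordAlgebra Q)ˣ) : CliffordAlgebra Q) = 1 := by rw [← hg, hi]
      rw [smul_mul_assoc] at h1
      have h2 := congrArg (fun z => ((x⁻¹ : (CliffordAlgebra Q)ˣ) : CliffordAlgebra Q) *
        ((((LinearEquiv.det g)⁻¹ : ℂˣ) : ℂ) • z)) h1
      simp only [smul_smul, Units.inv_mul, one_smul, Units.inv_mul_cancel_left,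
        mul_smul_comm, mul_one] at h2
      rw [h2, map_inv]
    · have h1 := hg' (g⁻¹ v)
      have h2 : g (g⁻¹ v) = v := by rw [← LinearEquiv.mul_apply, mul_inv_cancel]; rfl
      rw [h2] at h1
      calc involute ((x⁻¹ : (CliffordAlgebra Q)ˣ) : CliffordAlgebra Q) * ι Q v
          = involute ((x⁻¹ : (CliffordAlgebra Q)ˣ) : CliffordAlgebra Q) *
            (ι Q v * x) * ((x⁻¹ : (CliffordAlgebra Q)ˣ) : CliffordAlgebra Q) := by
            rw [mul_assoc, mul_assoc, Units.mul_inv, mul_one]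
        _ = _ := by rw [← h1, ← mul_assoc, hi', one_mul]

open CliffordAlgebra in
theorem spin_exists [FiniteDimensional ℂ V] (x : spinGroup Q) :
    ∃ g : SO Q, ∀ v, (x : CliffordAlgebra Q) * ι Q v =
      ι Q ((g : V ≃ₗ[ℂ] V) v) * (x : CliffordAlgebra Q) := by
  have := clifford_nontrivial Q
  obtain ⟨u, hu, hux⟩ := x.2.1.1
  replace hux : (u : CliffordAlgebra Q) = x := hux
  obtain ⟨g, hg, hg'⟩ := lipschitz_exists Q hu
  have hinv : involute (u : CliffordAlgebra Q) = u := by rw [hux]; exact spinGroup.involute_eq x.2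
  rw [hinv] at hg
  have hd : (1 - ((LinearEquiv.det g : ℂˣ) : ℂ)) • (u : CliffordAlgebra Q) = 0 := by
    rw [sub_smul, one_smul, ← hg, sub_self]
  have hd' : LinearEquiv.det g = 1 := by
    rcases smul_eq_zero.1 hd with h | h
    · exact Units.ext (sub_eq_zero.1 h).symm
    · exact absurd h u.ne_zero
  simp only [hinv] at hg'
  refine ⟨⟨g, fun v => ?_, hd'⟩, fun v => by rw [← hux]; exact hg' v⟩
  have h1 : ι Q (g v) = u * ι Q v * ((u⁻¹ : (CliffordAlgebra Q)ˣ) : CliffordAlgebra Q) := by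
    rw [hg', mul_assoc, Units.mul_inv, mul_one]
  have h2 : ι Q (g v) * ι Q (g v) = algebraMap ℂ _ (Q v) := by
    rw [h1]
    calc _ = u * (ι Q v * ι Q v) * ((u⁻¹ : (CliffordAlgebra Q)ˣ) : CliffordAlgebra Q) := by
          simp only [mul_assoc, Units.inv_mul_cancel_left]
      _ = _ := by rw [ι_sq_scalar, ← Algebra.commutes (Q v) (u : CliffordAlgebra Q), mul_assoc,
                    Units.mul_inv, mul_one]
  rw [ι_sq_scalar] at h2
  exact (algebraMap ℂ (CliffordAlgebra Q)).injective h2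

open CliffordAlgebra in
theorem spin_unique (x : spinGroup Q) (g h : SO Q)
    (hg : ∀ v, (x : CliffordAlgebra Q) * ι Q v = ι Q ((g : V ≃ₗ[ℂ] V) v) * (x : CliffordAlgebra Q))
    (hh : ∀ v, (x : CliffordAlgebra Q) * ι Q v = ι Q ((h : V ≃ₗ[ℂ] V) v) * (x : CliffordAlgebra Q)) :
    g = h := by
  refine Subtype.ext (LinearEquiv.ext fun v => ι_injective Q ?_)
  have h1 := (hg v).symm.trans (hh v)
  have h2 := congrArg (fun z => z * star (x : CliffordAlgebra Q)) h1
  simpa [mul_assoc, spinGroup.mul_star_self_of_mem x.2] using h2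

/-- The covering homomorphism `Spin(V, Q) → SO(V, Q)`: the image `g` of `x` is determined by
`x v x⁻¹ = g v` for all `v ∈ V`. -/
def cover [FiniteDimensional ℂ V] : spinGroup Q →* SO Q where
  toFun x := (spin_exists Q x).choose
  map_one' := spin_unique Q 1 _ _ (spin_exists Q 1).choose_spec (by intro v; simp)
  map_mul' := by
    intro x y
    refine spin_unique Q (x * y) _ _ (spin_exists Q (x * y)).choose_spec (fun v => ?_)
    have hx := (spin_exists Q x).choose_spec
    have hy := (spin_exists Q y).choose_spec
    change (x : CliffordAlgebra Q) * y * _ = _ * ((x : CliffordAlgebra Q) * y)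
    rw [mul_assoc, hy, ← mul_assoc, hx, mul_assoc]
    rfl

theorem cover_spec [FiniteDimensional ℂ V] (x : spinGroup Q) (v : V) :
    (x : CliffordAlgebra Q) * CliffordAlgebra.ι Q v =
      CliffordAlgebra.ι Q ((cover Q x : V ≃ₗ[ℂ] V) v) * (x : CliffordAlgebra Q) :=
  (spin_exists Q x).choose_spec v

/-! ### Centralizers and their component groups -/

/-- The centralizer of `e ∈ so(V, Q)` in `SO(V, Q)` for the adjoint action `g · e = g e g⁻¹`. -/
def centralizerSO (e : so Q) : Subgroup (SO Q) where
  carrier := {g | (g : V ≃ₗ[ℂ] V).conj (e : Module.End ℂ V) = e}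
  one_mem' := by ext v; rfl
  mul_mem' := by
    intro a b ha hb
    calc (((a * b : SO Q) : V ≃ₗ[ℂ] V)).conj (e : Module.End ℂ V)
        = (a : V ≃ₗ[ℂ] V).conj ((b : V ≃ₗ[ℂ] V).conj (e : Module.End ℂ V)) := by ext v; rfl
      _ = e := by rw [hb, ha]
  inv_mem' := by
    intro a ha
    have h : ((a⁻¹ : SO Q) : V ≃ₗ[ℂ] V).conj ((a : V ≃ₗ[ℂ] V).conj (e : Module.End ℂ V))
        = e := (a : V ≃ₗ[ℂ] V).conj.symm_apply_apply _
    rwa [ha] at h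

/-- The centralizer of `e ∈ so(V, Q)` in `Spin(V, Q)`, which acts on `so(V, Q)` through the
covering of `SO(V, Q)`. -/
def centralizerSpin [FiniteDimensional ℂ V] (e : so Q) : Subgroup (spinGroup Q) :=
  (centralizerSO Q e).comap (cover Q)

/-- `A(O)`, for the adjoint orbit `O` of `e` under `SO(V, Q)`. -/
abbrev ASO (e : so Q) : Type _ := ComponentGroup (centralizerSO Q e)

/-- `A_Spin(O)`, for the adjoint orbit `O` of `e`. -/
abbrev ASpin [FiniteDimensional ℂ V] (e : so Q) : Type _ := ComponentGroup (centralizerSpin Q e)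

/-- The class in `A(O)` of an element of the centralizer. -/
def toASO (e : so Q) : centralizerSO Q e →* ASO Q e := QuotientGroup.mk' _

/-- The class in `A_Spin(O)` of an element of the centralizer. -/
def toASpin [FiniteDimensional ℂ V] (e : so Q) : centralizerSpin Q e →* ASpin Q e :=
  QuotientGroup.mk' _

/-- The covering, restricted to the centralizers of `e`. -/
def coverCentralizer [FiniteDimensional ℂ V] (e : so Q) :
    centralizerSpin Q e →* centralizerSO Q e :=
  (cover Q).subgroupComap (centralizerSO Q e)

/-- A representation of `A_Spin(O)` is genuine if the class of `-1 ∈ Spin(V, Q)`, the nontrivial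
element of the kernel of the covering, acts by `-1`. -/
def IsGenuine [FiniteDimensional ℂ V] (e : so Q) {W : Type*} [AddCommGroup W] [Module ℂ W]
    (σ : Representation ℂ (ASpin Q e) W) : Prop :=
  ∀ z : centralizerSpin Q e, ((z : spinGroup Q) : CliffordAlgebra Q) = -1 →
    σ (toASpin Q e z) = -1

end Groups

/-! ### Jordan types -/

/-- `e` is nilpotent and its Jordan blocks (the rows of its Young diagram) have the sizes
`rows i > 0`: some basis of `V` is a disjoint union of strings
`b i 0 → b i 1 → ⋯ → b i (rows i - 1) → 0`. -/
def HasJordanBlocks {V : Type*} [AddCommGroup V] [Module ℂ V] (e : Module.End ℂ V) {s : ℕ}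
    (rows : Fin s → ℕ) : Prop :=
  (∀ i, 0 < rows i) ∧ ∃ b : Module.Basis (Σ i, Fin (rows i)) ℂ V,
    ∀ (i : Fin s) (j : Fin (rows i)),
      e (b ⟨i, j⟩) = if h : (j : ℕ) + 1 < rows i then b ⟨i, ⟨j + 1, h⟩⟩ else 0

/-- The length of column number `j = 0, 1, 2, …` of the diagram with the given rows. -/
def column {s : ℕ} (rows : Fin s → ℕ) (j : ℕ) : ℕ :=
  (Finset.univ.filter fun i => j < rows i).card

/-- The condition on the columns `c₀ ≥ c₁ ≥ ⋯` (followed by zeros): each pair `c₂ⱼ, c₂ⱼ₊₁` either is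
removed because `c₂ⱼ = c₂ⱼ₊₁` or satisfies `c₂ⱼ = c₂ⱼ₊₁ + 1`, and the second case occurs
`2 k + 1` times. -/
structure GenuineColumns (c : ℕ → ℕ) (k : ℕ) : Prop where
  pair : ∀ j, c (2 * j) = c (2 * j + 1) ∨ c (2 * j) = c (2 * j + 1) + 1
  count : {j | c (2 * j) = c (2 * j + 1) + 1}.ncard = 2 * k + 1

end SpinOrbit

end

/-! The column condition says that the odd Jordan blocks have distinct sizes and that there are 2k+1
of them. An endomorphism commuting with `e` acts on the multiplicity spaces of the blocks; this
action (`lead`) is multiplicative, and whatever it kills is nilpotent. The quadratic form induces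
nondegenerate forms there, symmetric for odd sizes and skew for even sizes (`form_swap`,
`isUnit_form`). So an isometry in the centralizer acts by a sign on each odd row and symplectically
on the even ones.

The signs separate the components (`mem_identityComponent_iff`). If all are 1,
`exists_cayley_factors` writes the isometry as a product of two elements (1 + n)(1 + n*)⁻¹, each
joined to 1 by (1 + tn)(1 + tn*)⁻¹ with t in the complement of a finite subset of ℂ. The obstacle to
a single transform is the eigenvalue -1; its generalised eigenspace involves only even rows, where
the skew forms supply an invertible skew endomorphism. Reflections in odd-dimensional orthogonal
summands attached to the odd rows (`exists_projections`) realise exactly the sign vectors of product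
1, which form ℤ₂^{2k}.

For Spin the question is whether -1 lies in the identity component. The right halves of the Jordan
strings span an isotropic subspace L, stable under the centralizer, and L^⊥/L comes from the middle
vectors of the odd rows. If the signs of g are trivial, g is trivial on L^⊥/L, and a lift of g
multiplies the Clifford product of a basis of L (`isoProd`) by a scalar c with c² = det(g|L). This
determinant is ±1 (`isoDet_sq`), hence 1 on the identity component. So c = ±1 tells a lift from its
negative, and the lifts with c = 1 form a continuous section (`exists_continuous_lift`). Hence -1
survives in the component group, which has order 2^{2k+1}.

A lift of the product of the reflections for rows i and j is proportional to a product of orthogonal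
bases of two odd-dimensional spaces. It commutes or anticommutes with a lift of the sign set S
according to the parity of |S ∩ {i, j}|. A nonempty sign set is even while 2k+1 is odd, so some i
lies in S and some j outside: every class except 1 and z = [-1] is conjugate to z times itself
(`exists_conj_eq_negOneClass_mul`). This forbids a splitting and makes genuine characters vanish off
{1, z}. Averaging rank-one maps then gives uniqueness of the genuine irreducible and 2d² = 2^{2k+1}.
The other irreducibles factor through an elementary abelian group. -/

namespace Representation

/-! ### Irreducibility through invariant subspaces, and Schur's lemma -/

section Criterion

variable {k G W : Type*} [Field k] [Monoid G] [AddCommGroup W] [Module k W]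
  {σ : Representation k G W}

theorem IsIrreducible.submodule_eq_bot_or_eq_top (h : σ.IsIrreducible) (N : Submodule k W)
    (hN : ∀ g, ∀ v ∈ N, σ g v ∈ N) : N = ⊥ ∨ N = ⊤ := by
  let S : Subrepresentation σ := ⟨N, fun g v hv => hN g v hv⟩
  rcases IsSimpleOrder.eq_bot_or_eq_top S with h | h
  · exact Or.inl (congrArg Subrepresentation.toSubmodule h)
  · exact Or.inr (congrArg Subrepresentation.toSubmodule h)

theorem IsIrreducible.nontrivial_space (h : σ.IsIrreducible) : Nontrivial W := by
  by_contra hW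
  rw [not_nontrivial_iff_subsingleton] at hW
  refine h.toNontrivial.exists_pair_ne.elim fun S hS => hS.elim fun T hST => hST ?_
  exact Subrepresentation.toSubmodule_injective (Subsingleton.elim _ _)

theorem isIrreducible_of_forall [Nontrivial W]
    (h : ∀ N : Submodule k W, (∀ g, ∀ v ∈ N, σ g v ∈ N) → N = ⊥ ∨ N = ⊤) :
    σ.IsIrreducible where
  exists_pair_ne := ⟨⊥, ⊤, fun e => bot_ne_top (α := Submodule k W)
    (congrArg Subrepresentation.toSubmodule e)⟩
  eq_bot_or_eq_top S := by
    rcases h S.toSubmodule (fun g v hv => S.apply_mem_toSubmodule g hv) with h | h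
    · exact Or.inl (Subrepresentation.toSubmodule_injective h)
    · exact Or.inr (Subrepresentation.toSubmodule_injective h)

theorem IsIrreducible.of_linearEquiv {W' : Type*} [AddCommGroup W'] [Module k W']
    {σ' : Representation k G W'} (h : σ.IsIrreducible) (φ : W ≃ₗ[k] W')
    (hφ : ∀ g v, φ (σ g v) = σ' g (φ v)) : σ'.IsIrreducible := by
  have := h.nontrivial_space
  have : Nontrivial W' := φ.symm.toEquiv.nontrivial
  refine isIrreducible_of_forall fun N hN => ?_
  have h1 := h.submodule_eq_bot_or_eq_top (N.comap φ.toLinearMap) fun g v hv => by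
    simpa [hφ] using hN g _ hv
  have h2 : N = (N.comap φ.toLinearMap).map φ.toLinearMap :=
    (Submodule.map_comap_eq_of_surjective φ.surjective N).symm
  rcases h1 with h1 | h1
  · left; rw [h2, h1, Submodule.map_bot]
  · right; rw [h2, h1, Submodule.map_top, LinearMap.range_eq_top]; exact φ.surjective

/-- Every nonzero finite-dimensional representation has an irreducible invariant subspace. -/
theorem exists_irreducible_subrepresentation [FiniteDimensional k W] [Nontrivial W]
    (σ : Representation k G W) :
    ∃ S : Subrepresentation σ, S.toRepresentation.IsIrreducible := by
  classical
  -- An invariant subspace of least dimension among the nonzero ones is irreducible.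
  have hne : ∃ n, ∃ S : Subrepresentation σ, S.toSubmodule ≠ ⊥ ∧
      Module.finrank k S.toSubmodule = n := ⟨_, ⊤, top_ne_bot (α := Submodule k W), rfl⟩
  obtain ⟨S, hS, hn⟩ := Nat.find_spec hne
  have : Nontrivial S.toSubmodule := Submodule.nontrivial_iff_ne_bot.2 hS
  refine ⟨S, isIrreducible_of_forall fun N hN => ?_⟩
  by_cases hb : N = ⊥
  · exact Or.inl hb
  right
  let T : Subrepresentation σ := ⟨N.map S.toSubmodule.subtype, by
    rintro g _ ⟨v, hv, rfl⟩
    exact ⟨_, hN g v hv, rfl⟩⟩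
  have hT : T.toSubmodule ≠ ⊥ := fun h => hb <| by
    have : N.map S.toSubmodule.subtype = ⊥ := h
    rw [← Submodule.map_bot S.toSubmodule.subtype] at this
    exact Submodule.map_injective_of_injective S.toSubmodule.injective_subtype this
  have h1 := Nat.find_min' hne ⟨T, hT, rfl⟩
  rw [← hn] at h1
  have h2 : Module.finrank k T.toSubmodule = Module.finrank k N :=
    (Submodule.equivMapOfInjective _ S.toSubmodule.injective_subtype N).finrank_eq.symm
  rw [h2] at h1
  exact Submodule.eq_top_of_finrank_eq (le_antisymm N.finrank_le h1)

/-- Schur's lemma: an eigenspace of `f` is invariant and nonzero, hence everything. -/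
theorem IsIrreducible.exists_eq_smul {k G W : Type*} [Field k] [IsAlgClosed k] [Monoid G]
    [AddCommGroup W] [Module k W] [FiniteDimensional k W] {σ : Representation k G W}
    (h : σ.IsIrreducible) (f : W →ₗ[k] W) (hf : ∀ g v, f (σ g v) = σ g (f v)) :
    ∃ c : k, ∀ v, f v = c • v := by
  have := h.nontrivial_space
  obtain ⟨c, hc⟩ := Module.End.exists_eigenvalue f
  refine ⟨c, fun v => ?_⟩
  rcases h.submodule_eq_bot_or_eq_top (Module.End.eigenspace f c) (fun g v hv => by
    rw [Module.End.mem_eigenspace_iff] at hv ⊢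
    rw [hf, hv, map_smul]) with h | h
  · exact absurd h hc
  · exact Module.End.mem_eigenspace_iff.1 (h ▸ Submodule.mem_top)

end Criterion

/-! ### Averages of rank-one maps over a finite group -/

section Average

variable {G W W' : Type*} [Group G] [Fintype G] [AddCommGroup W] [Module ℂ W]
  [AddCommGroup W'] [Module ℂ W']

/-- The average of the rank one map `w ↦ φ w • w'` over the group. -/
def averageRankOne (ρ : Representation ℂ G W) (σ : Representation ℂ G W')
    (φ : Module.Dual ℂ W) (w' : W') : W →ₗ[ℂ] W' :=
  ∑ a, (σ a) ∘ₗ (φ.smulRight w') ∘ₗ (ρ a⁻¹)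

theorem averageRankOne_apply (ρ : Representation ℂ G W) (σ : Representation ℂ G W')
    (φ : Module.Dual ℂ W) (w' : W') (w : W) :
    averageRankOne ρ σ φ w' w = ∑ a, φ (ρ a⁻¹ w) • σ a w' := by
  simp [averageRankOne, LinearMap.sum_apply]

theorem averageRankOne_comm (ρ : Representation ℂ G W) (σ : Representation ℂ G W')
    (φ : Module.Dual ℂ W) (w' : W') (g : G) (w : W) :
    averageRankOne ρ σ φ w' (ρ g w) = σ g (averageRankOne ρ σ φ w' w) := by
  rw [averageRankOne_apply, averageRankOne_apply, map_sum]
  refine Fintype.sum_equiv (Equiv.mulLeft g⁻¹) _ _ fun a => ?_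
  simp [map_smul, ← Module.End.mul_apply, ← map_mul]

/-- Pairing each basis vector with its own coordinate brings in the character of `ρ`, so that the
vanishing of characters can be exploited. -/
theorem sum_averageRankOne_basis {ι : Type*} [Fintype ι] [DecidableEq ι]
    (ρ : Representation ℂ G W)
    (σ : Representation ℂ G W') (b : Module.Basis ι ℂ W) (w' : W') :
    ∑ i, averageRankOne ρ σ (b.coord i) w' (b i) =
      ∑ a, LinearMap.trace ℂ W (ρ a⁻¹) • σ a w' := by
  simp only [averageRankOne_apply]
  rw [Finset.sum_comm]
  refine Finset.sum_congr rfl fun a _ => ?_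
  rw [← Finset.sum_smul, LinearMap.trace_eq_matrix_trace ℂ b, Matrix.trace]
  simp [LinearMap.toMatrix_apply]

end Average

/-! ### Genuine representations of groups of Heisenberg type -/

section Heisenberg

variable {G : Type*} [Group G] {z : G} (hz : ∀ g, z * g = g * z) (hz1 : z ≠ 1)
  (hz2 : z * z = 1) (hcomm : ∀ a : G, a ≠ 1 → a ≠ z → ∃ b, b * a * b⁻¹ = z * a)

include hcomm in
-- The trace is invariant under conjugation, while `z * a` acts by the negative of `a`; the trace
-- equals its own negative.
theorem trace_eq_zero_of_commutator {W : Type*} [AddCommGroup W] [Module ℂ W]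
    (ρ : Representation ℂ G W) (hρ : ρ z = -1) (a : G) (h1 : a ≠ 1) (h2 : a ≠ z) :
    LinearMap.trace ℂ W (ρ a) = 0 := by
  obtain ⟨b, hb⟩ := hcomm a h1 h2
  have h : LinearMap.trace ℂ W (ρ (b * a * b⁻¹)) = LinearMap.trace ℂ W (ρ a) := by
    rw [map_mul, LinearMap.trace_mul_comm, ← map_mul]
    congr 2; group
  rw [hb, map_mul, hρ, neg_one_mul, map_neg] at h
  exact self_eq_neg.1 h.symm

include hcomm hz1 hz2 in
-- Only `1` and `z` have nonzero trace. Their contributions agree, because the two signs at `z`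
-- cancel.
theorem sum_trace_smul_of_genuine [Fintype G] {W W' : Type*} [AddCommGroup W] [Module ℂ W]
    [FiniteDimensional ℂ W] [AddCommGroup W'] [Module ℂ W'] (ρ : Representation ℂ G W)
    (hρ : ρ z = -1) (σ : Representation ℂ G W') (hσ : σ z = -1) (w : W') :
    ∑ a, LinearMap.trace ℂ W (ρ a⁻¹) • σ a w = (2 * Module.finrank ℂ W : ℂ) • w := by
  classical
  have hzi : z⁻¹ = z := inv_eq_of_mul_eq_one_left hz2
  rw [← Finset.sum_subset (Finset.subset_univ {1, z})]
  · rw [Finset.sum_pair hz1.symm, hzi, hρ, hσ]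
    simp [two_mul, add_smul]
  · intro a _ ha
    simp only [Finset.mem_insert, Finset.mem_singleton, not_or] at ha
    rw [trace_eq_zero_of_commutator hcomm ρ hρ a⁻¹ (by simpa using ha.1)
      (by intro h; apply ha.2; rw [← hzi, ← h, inv_inv]), zero_smul]

include hcomm hz1 hz2 in
/-- A genuine irreducible representation maps isomorphically to every other one. -/
theorem nonempty_equiv_of_genuine [Finite G] {W W' : Type*} [AddCommGroup W] [Module ℂ W]
    [FiniteDimensional ℂ W] [AddCommGroup W'] [Module ℂ W'] (ρ : Representation ℂ G W)
    (hρ : ρ z = -1) (hρi : ρ.IsIrreducible) (σ : Representation ℂ G W') (hσ : σ z = -1)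
    (hσi : σ.IsIrreducible) : Nonempty (σ.Equiv ρ) := by
  classical
  have := Fintype.ofFinite G
  have := hρi.nontrivial_space
  have := hσi.nontrivial_space
  obtain ⟨w', hw'⟩ := exists_ne (0 : W')
  -- If all averages vanished, the sum over a basis would give `2 * dim W • w' = 0`.
  have hex : ∃ φ, averageRankOne ρ σ φ w' ≠ 0 := by
    by_contra! h
    have h1 := sum_averageRankOne_basis ρ σ (Module.finBasis ℂ W) w'
    rw [sum_trace_smul_of_genuine hz1 hz2 hcomm ρ hρ σ hσ] at h1
    simp only [h, LinearMap.zero_apply, Finset.sum_const_zero] at h1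
    rcases smul_eq_zero.1 h1.symm with h2 | h2
    · have : Module.finrank ℂ W ≠ 0 := Module.finrank_pos.ne'
      exact absurd h2 (mul_ne_zero two_ne_zero (Nat.cast_ne_zero.2 this))
    · exact hw' h2
  obtain ⟨φ, hφ⟩ := hex
  set f := averageRankOne ρ σ φ w' with hf
  have hfc : ∀ g w, f (ρ g w) = σ g (f w) := averageRankOne_comm ρ σ φ w'
  have hinj : Function.Injective f := by
    rw [← LinearMap.ker_eq_bot]
    rcases hρi.submodule_eq_bot_or_eq_top (LinearMap.ker f) (fun g v hv => by
      rw [LinearMap.mem_ker] at hv ⊢; rw [hfc, hv, map_zero]) with h | h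
    · exact h
    · exact absurd (LinearMap.ker_eq_top.1 h) hφ
  have hsurj : Function.Surjective f := by
    rw [← LinearMap.range_eq_top]
    rcases hσi.submodule_eq_bot_or_eq_top (LinearMap.range f) (fun g v hv => by
      obtain ⟨u, rfl⟩ := hv
      exact ⟨ρ g u, hfc g u⟩) with h | h
    · exact absurd (LinearMap.range_eq_bot.1 h) hφ
    · exact h
  exact ⟨(Representation.Equiv.mk (LinearEquiv.ofBijective f ⟨hinj, hsurj⟩)
    (fun g => LinearMap.ext fun w => hfc g w)).symm⟩

include hcomm hz1 hz2 in
-- By Schur each averaged rank-one map is a scalar, and its trace |G| φ(w) determines which. Summing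
-- over a dual basis gives |G|/d · w, to be compared with the value 2d · w obtained from the
-- character.
theorem two_mul_finrank_sq_of_genuine [Finite G] {W : Type*} [AddCommGroup W] [Module ℂ W]
    [FiniteDimensional ℂ W] (ρ : Representation ℂ G W) (hρ : ρ z = -1)
    (hρi : ρ.IsIrreducible) : 2 * Module.finrank ℂ W ^ 2 = Nat.card G := by
  classical
  have := Fintype.ofFinite G
  have := hρi.nontrivial_space
  obtain ⟨w, hw⟩ := exists_ne (0 : W)
  let b := Module.finBasis ℂ W
  have key : ∀ φ : Module.Dual ℂ W, ∀ u,
      (Module.finrank ℂ W : ℂ) • averageRankOne ρ ρ φ w u = (Nat.card G * φ w : ℂ) • u := by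
    intro φ u
    obtain ⟨c, hc⟩ := hρi.exists_eq_smul (averageRankOne ρ ρ φ w) (averageRankOne_comm ρ ρ φ w)
    have h1 : averageRankOne ρ ρ φ w = c • LinearMap.id := LinearMap.ext hc
    have h2 : LinearMap.trace ℂ W (averageRankOne ρ ρ φ w) = Nat.card G * φ w := by
      rw [averageRankOne, map_sum]
      have : ∀ a, LinearMap.trace ℂ W (ρ a ∘ₗ φ.smulRight w ∘ₗ ρ a⁻¹) = φ w := by
        intro a
        rw [← LinearMap.comp_assoc, ← Module.End.mul_eq_comp, LinearMap.trace_mul_comm,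
          Module.End.mul_eq_comp, ← LinearMap.comp_assoc, ← Module.End.mul_eq_comp (ρ a⁻¹),
          ← map_mul, inv_mul_cancel, map_one, Module.End.one_eq_id, LinearMap.id_comp,
          LinearMap.trace_smulRight]
      simp [this]
    rw [h1, map_smul, LinearMap.trace_id, smul_eq_mul] at h2
    rw [hc, smul_smul, ← h2, mul_comm]
  have h1 := sum_averageRankOne_basis ρ ρ b w
  rw [sum_trace_smul_of_genuine hz1 hz2 hcomm ρ hρ ρ hρ] at h1
  have h2 := congrArg (fun v => (Module.finrank ℂ W : ℂ) • v) h1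
  simp only [Finset.smul_sum, key, mul_smul] at h2
  rw [← Finset.smul_sum] at h2
  simp only [Module.Basis.coord_apply, b.sum_repr] at h2
  simp only [smul_smul] at h2
  have h3 := smul_left_injective ℂ hw h2
  have h4 : ((2 * Module.finrank ℂ W ^ 2 : ℕ) : ℂ) = (Nat.card G : ℂ) := by
    push_cast; rw [h3]; ring
  exact_mod_cast h4

include hz hz1 hz2 in
-- In the representation by right translations, the functions that change sign under `z` form a
-- nonzero invariant subspace, and any irreducible piece of it is genuine.
theorem exists_genuine_irreducible [Finite G] :
    ∃ (N : Submodule ℂ (G → ℂ)) (ρ : Representation ℂ G N), ρ.IsIrreducible ∧ ρ z = -1 := by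
  classical
  have := Fintype.ofFinite G
  let ρ₀ : Representation ℂ G (G → ℂ) :=
    { toFun g := LinearMap.funLeft ℂ ℂ (fun a => a * g)
      map_one' := by ext; simp [LinearMap.funLeft]
      map_mul' a b := by
        refine LinearMap.ext fun f => funext fun x => ?_
        simp [LinearMap.funLeft, mul_assoc] }
  have hρ₀ : ∀ g f a, ρ₀ g f a = f (a * g) := fun _ _ _ => rfl
  let F : Subrepresentation ρ₀ :=
    { toSubmodule :=
        { carrier := {f | ∀ a, f (z * a) = - f a}
          add_mem' := by
            intro f g hf hg a; simp only [Set.mem_ofPred_eq, Pi.add_apply] at *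
            rw [hf, hg]; ring
          zero_mem' := by intro a; simp
          smul_mem' := by
            intro c f hf a; simp only [Set.mem_ofPred_eq, Pi.smul_apply, smul_eq_mul] at *
            rw [hf]; ring }
      apply_mem_toSubmodule := by
        intro g f hf a
        rw [hρ₀, hρ₀, mul_assoc]; exact hf _ }
  have hF : ∀ f : F.toSubmodule, ∀ a, (f : G → ℂ) (z * a) = - (f : G → ℂ) a := fun f => f.2
  have : Nontrivial F.toSubmodule := by
    refine ⟨⟨⟨Pi.single 1 1 - Pi.single z 1, ?_⟩, 0, ?_⟩⟩
    · intro a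
      have e1 : z * a = 1 ↔ a = z := by
        constructor
        · intro h; rw [← one_mul a, ← hz2, mul_assoc, h, mul_one]
        · rintro rfl; exact hz2
      simp [Pi.single_apply, e1]
    · intro h
      have := congrFun (congrArg Subtype.val h) 1
      simp [hz1.symm] at this
  obtain ⟨S, hS⟩ := exists_irreducible_subrepresentation F.toRepresentation
  let φ : S.toSubmodule ≃ₗ[ℂ] S.toSubmodule.map F.toSubmodule.subtype :=
    Submodule.equivMapOfInjective _ F.toSubmodule.injective_subtype _
  let ρ : Representation ℂ G (S.toSubmodule.map F.toSubmodule.subtype) :=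
    { toFun g := φ.toLinearMap ∘ₗ S.toRepresentation g ∘ₗ φ.symm.toLinearMap
      map_one' := by ext; simp
      map_mul' a b := by ext; simp }
  refine ⟨_, ρ, hS.of_linearEquiv φ fun g v => by simp [ρ], ?_⟩
  refine LinearMap.ext fun v => ?_
  obtain ⟨v, rfl⟩ := φ.surjective v
  have h1 : S.toRepresentation z v = -v := by
    refine Subtype.ext (Subtype.ext (funext fun a => ?_))
    change ρ₀ z ((v : F.toSubmodule) : G → ℂ) a = _
    rw [hρ₀, ← hz, hF]; rfl
  simp only [ρ, MonoidHom.coe_mk, OneHom.coe_mk, LinearMap.comp_apply, LinearEquiv.coe_coe,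
    LinearEquiv.symm_apply_apply, h1]
  exact map_neg φ v

include hz hz1 hz2 hcomm in
/-- The irreducible representation of a Heisenberg group in which `z` acts by `-1`. -/
theorem exists_fin_genuine {k : ℕ} (hcard : Nat.card G = 2 ^ (2 * k + 1)) :
    ∃ ρ : Representation ℂ G (Fin (2 ^ k) → ℂ), ρ.IsIrreducible ∧ ρ z = -1 := by
  have : Finite G := Nat.finite_of_card_ne_zero (by rw [hcard]; positivity)
  obtain ⟨N, ρ, hρ, hρz⟩ := exists_genuine_irreducible hz hz1 hz2
  have h1 := two_mul_finrank_sq_of_genuine hz1 hz2 hcomm ρ hρz hρ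
  rw [hcard] at h1
  have h2 : Module.finrank ℂ N = 2 ^ k := by
    have h3 : Module.finrank ℂ N ^ 2 = (2 ^ k) ^ 2 := by
      rw [← pow_mul, mul_comm k 2]; rw [pow_succ (2 : ℕ) (2 * k)] at h1; omega
    exact (Nat.pow_left_injective two_ne_zero) h3
  let φ : N ≃ₗ[ℂ] (Fin (2 ^ k) → ℂ) := LinearEquiv.ofFinrankEq _ _ (by simp [h2])
  let ρ' : Representation ℂ G (Fin (2 ^ k) → ℂ) :=
    { toFun g := φ.toLinearMap ∘ₗ ρ g ∘ₗ φ.symm.toLinearMap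
      map_one' := by ext; simp
      map_mul' a b := LinearMap.ext fun v => by simp }
  refine ⟨ρ', hρ.of_linearEquiv φ fun g v => by simp [ρ'], ?_⟩
  refine LinearMap.ext fun v => ?_
  simp [ρ', hρz]

include hz hz2 in
-- The fixed space of the central `z` is invariant. If it is zero, the fixed vector `σ z v + v`
-- vanishes for every `v`. No finiteness of `W` is involved.
theorem IsIrreducible.central_involution {W : Type*} [AddCommGroup W] [Module ℂ W]
    {σ : Representation ℂ G W} (hσ : σ.IsIrreducible) : σ z = -1 ∨ σ z = 1 := by
  have hsq : ∀ v, σ z (σ z v) = v := fun v => by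
    rw [← Module.End.mul_apply, ← map_mul, hz2, map_one]; rfl
  have hc : ∀ g v, σ z (σ g v) = σ g (σ z v) := fun g v => by
    rw [← Module.End.mul_apply, ← map_mul, hz, map_mul]; rfl
  rcases hσ.submodule_eq_bot_or_eq_top (LinearMap.ker (σ z - 1)) (fun g v hv => by
    simp only [LinearMap.mem_ker, LinearMap.sub_apply, Module.End.one_apply, sub_eq_zero] at hv ⊢
    rw [hc, hv]) with h | h
  · left
    refine LinearMap.ext fun v => ?_
    have : σ z v + v ∈ LinearMap.ker (σ z - 1) := by
      simp [hsq, add_comm]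
    rw [h, Submodule.mem_bot] at this
    simpa using eq_neg_of_add_eq_zero_left this
  · right
    rw [← sub_eq_zero]; exact LinearMap.ker_eq_top.1 h

end Heisenberg

/-- An irreducible representation by commuting involutions is a sign character. -/
theorem IsIrreducible.exists_character {G W : Type*} [Group G] [AddCommGroup W] [Module ℂ W]
    {σ : Representation ℂ G W} (hσ : σ.IsIrreducible) (hsq : ∀ g, σ (g * g) = 1)
    (hc : ∀ g h, σ (g * h) = σ (h * g)) :
    Module.finrank ℂ W = 1 ∧ ∃ χ : G →* ℂˣ, ∀ g w, σ g w = (χ g : ℂ) • w := by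
  have hscal : ∀ g, ∃ c : ℂˣ, ∀ w, σ g w = (c : ℂ) • w := by
    intro g
    have hc' : ∀ h v, σ g (σ h v) = σ h (σ g v) := fun h v => by
      rw [← Module.End.mul_apply, ← map_mul, hc, map_mul]; rfl
    have hs : ∀ v, σ g (σ g v) = v := fun v => by
      rw [← Module.End.mul_apply, ← map_mul, hsq]; rfl
    rcases hσ.submodule_eq_bot_or_eq_top (LinearMap.ker (σ g - 1)) (fun h v hv => by
      simp only [LinearMap.mem_ker, LinearMap.sub_apply, Module.End.one_apply,
        sub_eq_zero] at hv ⊢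
      rw [hc', hv]) with h | h
    · refine ⟨-1, fun v => ?_⟩
      have : σ g v + v ∈ LinearMap.ker (σ g - 1) := by simp [hs, add_comm]
      rw [h, Submodule.mem_bot] at this
      simpa using eq_neg_of_add_eq_zero_left this
    · refine ⟨1, fun v => ?_⟩
      have : σ g - 1 = 0 := LinearMap.ker_eq_top.1 h
      rw [sub_eq_zero.1 this]; simp
  choose χ hχ using hscal
  have := hσ.nontrivial_space
  obtain ⟨w, hw⟩ := exists_ne (0 : W)
  have hinj : ∀ c d : ℂˣ, (c : ℂ) • w = (d : ℂ) • w → c = d := fun c d h =>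
    Units.ext (smul_left_injective ℂ hw h)
  refine ⟨finrank_eq_one w hw fun v => ?_, ⟨⟨χ, hinj _ _ ?_⟩, fun a b => hinj _ _ ?_⟩, hχ⟩
  · have := hσ.submodule_eq_bot_or_eq_top (Submodule.span ℂ {w}) (fun g v hv => by
      rw [hχ]; exact Submodule.smul_mem _ _ hv)
    rcases this with h | h
    · exact absurd (Submodule.span_singleton_eq_bot.1 h) hw
    · have : v ∈ Submodule.span ℂ {w} := h ▸ Submodule.mem_top
      exact Submodule.mem_span_singleton.1 this
  · rw [← hχ]; simp
  · simp only
    rw [← hχ, map_mul, Module.End.mul_apply, hχ, hχ, smul_smul, Units.val_mul, mul_comm]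

end Representation

/-! ### Contractions, and which Clifford elements are scalars -/

namespace CliffordAlgebra

open QuadraticMap

section Contraction

variable {V : Type*} [AddCommGroup V] [Module ℂ V] {Q : QuadraticForm ℂ V}

/-- The operator multiplying the homogeneous elements of the exterior algebra by their degree. -/
noncomputable def eulerOperator {ι' : Type*} [Fintype ι'] (b : Module.Basis ι' ℂ V) :
    ExteriorAlgebra ℂ V →ₗ[ℂ] ExteriorAlgebra ℂ V :=
  ∑ i, LinearMap.mulLeft ℂ (ExteriorAlgebra.ι ℂ (b i)) ∘ₗ
    contractLeft (Q := (0 : QuadraticForm ℂ V)) (b.coord i)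

theorem eulerOperator_apply {ι' : Type*} [Fintype ι'] (b : Module.Basis ι' ℂ V)
    (x : ExteriorAlgebra ℂ V) :
    eulerOperator b x = ∑ i, ExteriorAlgebra.ι ℂ (b i) *
      contractLeft (Q := (0 : QuadraticForm ℂ V)) (b.coord i) x := by
  simp [eulerOperator, LinearMap.sum_apply]

/-- Left multiplication by a vector thus raises an eigenvalue by one, which produces the
eigenvectors of positive degree. -/
theorem eulerOperator_ι_mul {ι' : Type*} [Fintype ι'] (b : Module.Basis ι' ℂ V) (v : V)
    (x : ExteriorAlgebra ℂ V) :
    eulerOperator b (ExteriorAlgebra.ι ℂ v * x) =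
      ExteriorAlgebra.ι ℂ v * x + ExteriorAlgebra.ι ℂ v * eulerOperator b x := by
  rw [eulerOperator_apply, eulerOperator_apply, Finset.mul_sum]
  have h : ∀ i, ExteriorAlgebra.ι ℂ (b i) * contractLeft (Q := (0 : QuadraticForm ℂ V))
      (b.coord i) (ExteriorAlgebra.ι ℂ v * x) =
      b.coord i v • (ExteriorAlgebra.ι ℂ (b i)) * x + ExteriorAlgebra.ι ℂ v *
        (ExteriorAlgebra.ι ℂ (b i) *
          contractLeft (Q := (0 : QuadraticForm ℂ V)) (b.coord i) x) := by
    intro i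
    have h1 : contractLeft (Q := (0 : QuadraticForm ℂ V)) (b.coord i)
        (ExteriorAlgebra.ι ℂ v * x) = b.coord i v • x - ExteriorAlgebra.ι ℂ v *
          contractLeft (Q := (0 : QuadraticForm ℂ V)) (b.coord i) x := contractLeft_ι_mul _ _ _
    have h2 : ExteriorAlgebra.ι ℂ (b i) * ExteriorAlgebra.ι ℂ v =
        -(ExteriorAlgebra.ι ℂ v * ExteriorAlgebra.ι ℂ (b i)) :=
      eq_neg_of_add_eq_zero_left (ExteriorAlgebra.ι_add_mul_swap _ _)
    rw [h1, mul_sub, ← mul_assoc, h2, mul_smul_comm, smul_mul_assoc, neg_mul, sub_neg_eq_add,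
      mul_assoc]
  rw [Finset.sum_congr rfl fun i _ => h i, Finset.sum_add_distrib, ← Finset.sum_mul]
  congr 2
  have h3 := congrArg (ExteriorAlgebra.ι ℂ) (b.sum_repr v)
  rw [map_sum] at h3
  simpa only [map_smul, Module.Basis.coord_apply] using h3

/-- The Euler operator kills `x`. The exterior algebra is the sum of the scalars and of eigenspaces
for positive integers, and the latter are independent of the kernel. -/
theorem exteriorAlgebra_eq_algebraMap_of_contractLeft [FiniteDimensional ℂ V]
    (x : ExteriorAlgebra ℂ V)
    (hx : ∀ f, contractLeft (Q := (0 : QuadraticForm ℂ V)) f x = 0) :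
    ∃ c, x = algebraMap ℂ _ c := by
  let b := Module.finBasis ℂ V
  let E : Module.End ℂ (ExteriorAlgebra ℂ V) := eulerOperator b
  let U : Submodule ℂ (ExteriorAlgebra ℂ V) :=
    ⨆ (μ : ℂ) (_ : μ ≠ 0), Module.End.eigenspace E μ
  let U' : Submodule ℂ (ExteriorAlgebra ℂ V) :=
    ⨆ n : ℕ, Module.End.eigenspace E (n + 1 : ℂ)
  have hUU : U' ≤ U := iSup_le fun n =>
    le_iSup₂_of_le (n + 1 : ℂ) (Nat.cast_add_one_ne_zero n) le_rfl
  have hι : ∀ v, ∀ u ∈ U', ExteriorAlgebra.ι ℂ v * u ∈ U' := by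
    intro v u hu
    have : U' ≤ U'.comap (LinearMap.mulLeft ℂ (ExteriorAlgebra.ι ℂ v)) := by
      refine iSup_le fun n w hw => ?_
      refine Submodule.mem_iSup_of_mem (n + 1) ?_
      rw [Module.End.mem_eigenspace_iff] at hw ⊢
      change eulerOperator b _ = _ at hw
      change eulerOperator b (ExteriorAlgebra.ι ℂ v * w) = _ • (ExteriorAlgebra.ι ℂ v * w)
      rw [eulerOperator_ι_mul, hw]
      push_cast
      rw [mul_smul_comm]; module
    exact this hu
  have hc : ∀ c : ℂ, E (algebraMap ℂ _ c) = 0 := by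
    intro c
    change eulerOperator b _ = _
    rw [eulerOperator_apply]
    refine Finset.sum_eq_zero fun i _ => ?_
    rw [contractLeft_algebraMap (Q := (0 : QuadraticForm ℂ V)), mul_zero]
  have key : ∀ y : CliffordAlgebra (0 : QuadraticForm ℂ V),
      ∃ c : ℂ, ∃ u ∈ U', y = algebraMap ℂ (ExteriorAlgebra ℂ V) c + u := by
    intro y
    induction y using CliffordAlgebra.left_induction with
    | algebraMap r => exact ⟨r, 0, U'.zero_mem, by rw [add_zero]⟩
    | add x y hx hy =>
      obtain ⟨c, u, hu, rfl⟩ := hx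
      obtain ⟨d, w, hw, rfl⟩ := hy
      exact ⟨c + d, u + w, U'.add_mem hu hw, by rw [map_add]; abel⟩
    | ι_mul x m hx =>
      obtain ⟨c, u, hu, rfl⟩ := hx
      refine ⟨0, ExteriorAlgebra.ι ℂ m * algebraMap ℂ _ c + ExteriorAlgebra.ι ℂ m * u,
        U'.add_mem ?_ (hι m u hu), ?_⟩
      · refine Submodule.mem_iSup_of_mem 0 ?_
        rw [Module.End.mem_eigenspace_iff]
        change eulerOperator b _ = _
        rw [eulerOperator_ι_mul]
        have := hc c
        change eulerOperator b _ = _ at this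
        rw [this]; simp
      · rw [map_zero, zero_add, ← mul_add]
  obtain ⟨c, u, hu, hxu⟩ := key x
  have h1 : E x = 0 := by
    change eulerOperator b x = 0
    rw [eulerOperator_apply]
    exact Finset.sum_eq_zero fun i _ => by rw [hx, mul_zero]
  have h2 : E u = 0 := by rw [hxu, map_add, hc, zero_add] at h1; exact h1
  have h3 := (Module.End.eigenspaces_iSupIndep E) 0
  have h4 : u = 0 := by
    have := Submodule.disjoint_def.1 h3 u (by
      rw [Module.End.mem_eigenspace_iff, h2, zero_smul]) (hUU hu)
    exact this
  exact ⟨c, by rw [hxu, h4, add_zero]⟩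

/-- The linear identification with the exterior algebra commutes with contractions and preserves
scalars. -/
theorem eq_algebraMap_of_contractLeft [FiniteDimensional ℂ V] (x : CliffordAlgebra Q)
    (hx : ∀ f, contractLeft f x = 0) : ∃ c, x = algebraMap ℂ _ c := by
  let _ : Invertible (2 : ℂ) := invertibleOfNonzero two_ne_zero
  obtain ⟨c, hc⟩ := exteriorAlgebra_eq_algebraMap_of_contractLeft (equivExterior Q x) (fun f => by
    unfold equivExterior
    rw [changeFormEquiv_apply]
    exact (changeForm_contractLeft changeForm.associated_neg_proof f x).symm.trans
      (by rw [hx, map_zero]))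
  refine ⟨c, (equivExterior Q).injective (hc.trans ?_)⟩
  unfold equivExterior
  rw [changeFormEquiv_apply]
  exact (changeForm_algebraMap changeForm.associated_neg_proof c).symm

/-- The twisted commutator with a vector is a contraction; this converts commutation relations into
the vanishing of contractions. -/
theorem contractLeft_polar (v : V) (x : CliffordAlgebra Q) :
    contractLeft (polarBilin Q v) x = ι Q v * x - involute x * ι Q v := by
  induction x using CliffordAlgebra.left_induction with
  | algebraMap r => rw [contractLeft_algebraMap, AlgHom.commutes, Algebra.commutes, sub_self]
  | add x y hx hy => rw [map_add, map_add, hx, hy]; noncomm_ring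
  | ι_mul x m hx =>
    rw [contractLeft_ι_mul, hx, map_mul, involute_ι, polarBilin_apply_apply,
      Algebra.smul_def, ← ι_mul_ι_add_swap]
    noncomm_ring

/-- By nondegeneracy every functional is the pairing with some vector, so all contractions vanish.
Evenness matters: in odd dimension the product of an orthogonal basis is central as well. -/
theorem eq_algebraMap_of_commute [FiniteDimensional ℂ V] (hQ : (polarBilin Q).Nondegenerate)
    (x : CliffordAlgebra Q) (hx : involute x = x) (h : ∀ v, x * ι Q v = ι Q v * x) :
    ∃ c, x = algebraMap ℂ _ c := by
  refine eq_algebraMap_of_contractLeft x fun f => ?_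
  obtain ⟨v, rfl⟩ := (LinearMap.BilinForm.toDual (polarBilin Q) hQ).surjective f
  have : LinearMap.BilinForm.toDual (polarBilin Q) hQ v = polarBilin Q v := rfl
  rw [this, contractLeft_polar, hx, h, sub_self]

theorem mem_even_of_involute_eq (x : CliffordAlgebra Q) (hx : involute x = x) :
    x ∈ even Q := by
  obtain ⟨a, ha, b, hb, rfl⟩ := Submodule.mem_sup.1
    ((evenOdd_isCompl Q).sup_eq_top ▸ Submodule.mem_top (x := x))
  rw [map_add, involute_eq_of_mem_even ha, involute_eq_of_mem_odd hb] at hx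
  have : b = 0 := by
    have h2 := add_left_cancel hx
    have h3 : (2 : ℂ) • b = 0 := by
      rw [two_smul]; nth_rewrite 1 [← h2]; exact neg_add_cancel b
    exact (smul_eq_zero.1 h3).resolve_left two_ne_zero
  rw [this, add_zero]; exact ha

end Contraction

end CliffordAlgebra

/-! ### Orthogonal bases and products of reflections -/

namespace QuadraticMap

open LinearMap

variable {V : Type*} [AddCommGroup V] [Module ℂ V] [FiniteDimensional ℂ V]
  {Q : QuadraticForm ℂ V}

theorem exists_anisotropic_orthogonal_basis (hQ : (polarBilin Q).Nondegenerate) :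
    ∃ b : Module.Basis (Fin (Module.finrank ℂ V)) ℂ V,
      (∀ i j, i ≠ j → polar Q (b i) (b j) = 0) ∧ ∀ i, Q (b i) ≠ 0 := by
  let _ : Invertible (2 : ℂ) := invertibleOfNonzero two_ne_zero
  obtain ⟨b, hb⟩ := LinearMap.BilinForm.exists_orthogonal_basis (B := polarBilin Q)
    ⟨fun x y => by simp [polar_comm]⟩
  refine ⟨b, fun i j hij => hb hij, fun i h => ?_⟩
  refine hb.not_isOrtho_basis_self_of_separatingLeft hQ.1 i ?_
  rw [polarBilin_apply_apply, polar_self, h, smul_zero]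

end QuadraticMap

namespace CliffordAlgebra

open QuadraticMap

variable {V : Type*} [AddCommGroup V] [Module ℂ V] {Q : QuadraticForm ℂ V}

/-- An anisotropic vector as a unit of the Clifford algebra. -/
noncomputable def vectorUnit (a : V) (ha : Q a ≠ 0) : (CliffordAlgebra Q)ˣ where
  val := ι Q a
  inv := (Q a)⁻¹ • ι Q a
  val_inv := by
    rw [mul_smul_comm, ι_sq_scalar, Algebra.smul_def, ← map_mul, inv_mul_cancel₀ ha, map_one]
  inv_val := by
    rw [smul_mul_assoc, ι_sq_scalar, Algebra.smul_def, ← map_mul, inv_mul_cancel₀ ha, map_one]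

theorem vectorUnit_mem (a : V) (ha : Q a ≠ 0) : vectorUnit a ha ∈ lipschitzGroup Q :=
  Subgroup.subset_closure ⟨a, rfl⟩

variable (Q) in
/-- The reflection in the hyperplane orthogonal to `a`. -/
noncomputable def reflectionMap (a : V) : V →ₗ[ℂ] V :=
  LinearMap.id - (Q a)⁻¹ • (polarBilin Q a).smulRight a

theorem reflectionMap_apply (a v : V) :
    reflectionMap Q a v = v - ((Q a)⁻¹ * polar Q a v) • a := by
  simp [reflectionMap, mul_smul]

theorem map_sub_smul (a v : V) (c : ℂ) :
    Q (v - c • a) = Q v - c * polar Q a v + c * c * Q a := by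
  have h : Q (v + -(c • a)) = Q v + Q (-(c • a)) + polar Q v (-(c • a)) := by
    simp [polar]
  rw [sub_eq_add_neg, h, QuadraticMap.map_neg, QuadraticMap.map_smul, polar_neg_right,
    polar_smul_right, polar_comm]
  simp only [smul_eq_mul]; ring

theorem map_reflectionMap (a v : V) (ha : Q a ≠ 0) : Q (reflectionMap Q a v) = Q v := by
  rw [reflectionMap_apply, map_sub_smul]
  field_simp
  ring

theorem involute_vectorUnit_mul (a : V) (ha : Q a ≠ 0) (v : V) :
    involute (vectorUnit a ha : CliffordAlgebra Q) * ι Q v =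
      ι Q (reflectionMap Q a v) * (vectorUnit a ha : CliffordAlgebra Q) := by
  change involute (ι Q a) * ι Q v = ι Q (reflectionMap Q a v) * ι Q a
  have key : ι Q a * ι Q v + ι Q v * ι Q a = algebraMap ℂ _ (polar Q a v) :=
    ι_mul_ι_add_swap a v
  rw [involute_ι, reflectionMap_apply, map_sub, map_smul, sub_mul, smul_mul_assoc, ι_sq_scalar,
    Algebra.smul_def, ← (algebraMap ℂ (CliffordAlgebra Q)).map_mul,
    show (Q a)⁻¹ * polar Q a v * Q a = polar Q a v by field_simp, ← key]
  noncomm_ring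

theorem reflectionMap_eq_self (a v : V) (h : polar Q a v = 0) : reflectionMap Q a v = v := by
  rw [reflectionMap_apply, h]; simp

/-- The linear map `g` is induced by the unit `u` through the twisted conjugation. -/
def TwistedLift (u : (CliffordAlgebra Q)ˣ) (g : V →ₗ[ℂ] V) : Prop :=
  ∀ v, involute (u : CliffordAlgebra Q) * ι Q v = ι Q (g v) * (u : CliffordAlgebra Q)

theorem TwistedLift.of_comp {u w : (CliffordAlgebra Q)ˣ} {r g : V →ₗ[ℂ] V}
    (hw : TwistedLift w r) (hu : TwistedLift u (r ∘ₗ g)) : TwistedLift (w⁻¹ * u) g := by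
  intro v
  have h1 : involute (w : CliffordAlgebra Q) * ι Q (g v) = ι Q (r (g v)) * w := hw (g v)
  have h2 : involute (u : CliffordAlgebra Q) * ι Q v = ι Q (r (g v)) * u := hu v
  have h3 : involute ((w⁻¹ : (CliffordAlgebra Q)ˣ) : CliffordAlgebra Q) *
      involute (w : CliffordAlgebra Q) = 1 := by rw [← map_mul, Units.inv_mul, map_one]
  have h4 : ι Q (r (g v)) =
      involute (w : CliffordAlgebra Q) * ι Q (g v) *
        ((w⁻¹ : (CliffordAlgebra Q)ˣ) : CliffordAlgebra Q) := by
    rw [h1, mul_assoc, Units.mul_inv, mul_one]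
  rw [Units.val_mul, map_mul, mul_assoc, h2, h4, ← mul_assoc, ← mul_assoc, ← mul_assoc, h3,
    one_mul, mul_assoc]

/-- The Cartan–Dieudonné argument, by induction on the number `m` of basis vectors that may still be
moved. One or two reflections bring `g (b k)` back to `b k`; they do not disturb the vectors already
fixed, since these are orthogonal to both. -/
theorem exists_reflections [FiniteDimensional ℂ V] {n : ℕ} (b : Module.Basis (Fin n) ℂ V)
    (hb : ∀ i j, i ≠ j → polar Q (b i) (b j) = 0) (hb0 : ∀ i, Q (b i) ≠ 0) (m : ℕ)
    (g : V →ₗ[ℂ] V) (hg : ∀ v, Q (g v) = Q v) (hm : ∀ i : Fin n, m ≤ i → g (b i) = b i) :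
    ∃ u ∈ lipschitzGroup Q, TwistedLift u g := by
  induction m generalizing g with
  | zero =>
    refine ⟨1, one_mem _, fun v => ?_⟩
    have : g = LinearMap.id := b.ext fun i => hm i (Nat.zero_le _)
    rw [this]; simp
  | succ m ih =>
    by_cases hmn : m < n
    swap
    · exact ih g hg fun i hi => hm i (by omega)
    let k : Fin n := ⟨m, hmn⟩
    have hpolar : ∀ v w, polar Q (g v) (g w) = polar Q v w := fun v w => by
      simp only [polar, ← map_add, hg]
    have hfix : ∀ i : Fin n, m + 1 ≤ i → polar Q (g (b k)) (b i) = 0 := fun i hi => by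
      rw [← hm i hi, hpolar]
      exact hb _ _ (by intro h; rw [← h] at hi; simp [k] at hi)
    have hfix' : ∀ i : Fin n, m + 1 ≤ i → polar Q (b k) (b i) = 0 := fun i hi =>
      hb _ _ (by intro h; rw [← h] at hi; simp [k] at hi)
    have hstep : ∀ (r : V →ₗ[ℂ] V) (w : (CliffordAlgebra Q)ˣ), w ∈ lipschitzGroup Q →
        TwistedLift w r → (∀ v, Q (r v) = Q v) → r (g (b k)) = b k →
        (∀ i : Fin n, m + 1 ≤ i → r (b i) = b i) → ∃ u ∈ lipschitzGroup Q, TwistedLift u g := by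
      intro r w hw hwr hr hrk hri
      obtain ⟨u, hu, hug⟩ := ih (r ∘ₗ g) (fun v => by simp [hr, hg]) fun i hi => by
        rcases hi.eq_or_lt with h | h
        · have : i = k := Fin.ext h.symm
          rw [this]; exact hrk
        · rw [LinearMap.comp_apply, hm i h, hri i h]
      exact ⟨w⁻¹ * u, mul_mem (inv_mem hw) hu, hwr.of_comp hug⟩
    -- If the difference is isotropic, the parallelogram identity gives the sum the value `4 * Q (b
    -- k)`. Reflecting in the sum sends `g (b k)` to `-b k`, and the reflection in `b k` corrects
    -- the sign.
    by_cases h1 : Q (b k - g (b k)) = 0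
    · have hsum : Q (b k + g (b k)) = 4 * Q (b k) := by
        have e1 := map_sub_smul (Q := Q) (g (b k)) (b k) 1
        have e2 := map_sub_smul (Q := Q) (g (b k)) (b k) (-1)
        simp only [one_smul, neg_smul, sub_neg_eq_add, h1, hg] at e1 e2
        rw [e2]; linear_combination e1
      have h2 : Q (b k + g (b k)) ≠ 0 := by
        rw [hsum]; exact mul_ne_zero (by norm_num) (hb0 k)
      have h3 : reflectionMap Q (b k + g (b k)) (g (b k)) = - b k := by
        rw [reflectionMap_apply]
        have : polar Q (b k + g (b k)) (g (b k)) = Q (b k + g (b k)) := by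
          rw [polar_add_left, polar_self, hg, hsum]
          have : Q (b k + g (b k)) = Q (b k) + Q (g (b k)) + polar Q (b k) (g (b k)) := by
            simp [polar]
          rw [hsum, hg] at this
          simp only [two_nsmul]; linear_combination -this
        rw [this, inv_mul_cancel₀ h2, one_smul]; abel
      refine hstep (reflectionMap Q (b k) ∘ₗ reflectionMap Q (b k + g (b k)))
        (vectorUnit _ (hb0 k) * vectorUnit _ h2)
        (mul_mem (vectorUnit_mem _ _) (vectorUnit_mem _ _)) ?_ ?_ ?_ ?_
      · intro v
        rw [Units.val_mul, map_mul, mul_assoc, involute_vectorUnit_mul, ← mul_assoc,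
          involute_vectorUnit_mul, mul_assoc]
        rfl
      · intro v
        rw [LinearMap.comp_apply, map_reflectionMap _ _ (hb0 k), map_reflectionMap _ _ h2]
      · rw [LinearMap.comp_apply, h3, map_neg, reflectionMap_apply, polar_self, two_nsmul,
          mul_add, inv_mul_cancel₀ (hb0 k), add_smul, one_smul]
        abel
      · intro i hi
        rw [LinearMap.comp_apply, reflectionMap_eq_self _ (b i)
          (by rw [polar_add_left, hfix i hi, hfix' i hi, add_zero]),
          reflectionMap_eq_self _ _ (hfix' i hi)]
    · refine hstep (reflectionMap Q (b k - g (b k))) (vectorUnit _ h1) (vectorUnit_mem _ _)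
        (involute_vectorUnit_mul _ h1) (fun v => map_reflectionMap _ _ h1) ?_ ?_
      · rw [reflectionMap_apply]
        have : polar Q (b k - g (b k)) (g (b k)) = - Q (b k - g (b k)) := by
          have e1 := map_sub_smul (Q := Q) (g (b k)) (b k) 1
          rw [one_smul, hg, polar_comm] at e1
          rw [e1, sub_eq_add_neg, polar_add_left, polar_neg_left, polar_self, hg]
          simp only [two_nsmul]; ring
        rw [this, mul_neg, inv_mul_cancel₀ h1, neg_smul, one_smul]; abel
      · intro i hi
        exact reflectionMap_eq_self _ _ (by
          rw [sub_eq_add_neg, polar_add_left, polar_neg_left, hfix i hi, hfix' i hi]; simp)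

end CliffordAlgebra

/-! ### The covering Spin → SO: surjectivity and kernel -/

namespace SpinOrbit

open CliffordAlgebra QuadraticMap

variable {V : Type*} [AddCommGroup V] [Module ℂ V] [FiniteDimensional ℂ V]
  {Q : QuadraticForm ℂ V}

/-- The scalar is the quotient of the two anisotropic vectors `c • a` and `a`. -/
theorem algebraMap_mem_lipschitzGroup [Nontrivial V] (hQ : (polarBilin Q).Nondegenerate)
    {c : ℂ} (hc : c ≠ 0) :
    ∃ u ∈ lipschitzGroup Q, (u : CliffordAlgebra Q) = algebraMap ℂ _ c := by
  obtain ⟨b, -, hb⟩ := exists_anisotropic_orthogonal_basis hQ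
  let a := b ⟨0, Module.finrank_pos⟩
  have ha : Q a ≠ 0 := hb _
  have hca : Q (c • a) ≠ 0 := by
    rw [QuadraticMap.map_smul]
    exact smul_ne_zero (mul_ne_zero hc hc) ha
  refine ⟨vectorUnit _ hca * (vectorUnit _ ha)⁻¹,
    mul_mem (vectorUnit_mem _ _) (inv_mem (vectorUnit_mem _ _)), ?_⟩
  have h1 : (vectorUnit _ hca : CliffordAlgebra Q) = c • (vectorUnit _ ha : CliffordAlgebra Q) :=
    map_smul (ι Q) c a
  rw [Units.val_mul, h1, smul_mul_assoc, Units.mul_inv, Algebra.smul_def, mul_one]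

omit [FiniteDimensional ℂ V] in
theorem star_eq_of_mul_ι_eq {x : CliffordAlgebra Q} {v w : V}
    (h : x * ι Q v = ι Q w * x) : ι Q v * star x = star x * ι Q w := by
  have := congrArg star h
  rw [star_mul, star_mul, star_ι, star_ι, neg_mul, mul_neg, neg_inj] at this
  exact this

/-- The element `star u * u` is even and commutes with all vectors, so it is a scalar; dividing `u`
by a square root of it makes `u` unitary. -/
theorem exists_smul_mem_spinGroup [Nontrivial V] (hQ : (polarBilin Q).Nondegenerate)
    (u : (CliffordAlgebra Q)ˣ) (hu : u ∈ lipschitzGroup Q)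
    (hinv : involute (u : CliffordAlgebra Q) = u) (g : V → V)
    (hg : ∀ v, (u : CliffordAlgebra Q) * ι Q v = ι Q (g v) * (u : CliffordAlgebra Q)) :
    ∃ c : ℂ, c • (u : CliffordAlgebra Q) ∈ spinGroup Q := by
  have := clifford_nontrivial Q
  obtain ⟨c, hc⟩ := eq_algebraMap_of_commute hQ (star (u : CliffordAlgebra Q) * u)
    (by rw [map_mul, hinv, star_def, ← reverse_involute, hinv, hinv]) (fun v => by
      rw [mul_assoc, hg, ← mul_assoc, ← star_eq_of_mul_ι_eq (hg v), mul_assoc])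
  have hstar : star (u : CliffordAlgebra Q) = algebraMap ℂ _ c *
      ((u⁻¹ : (CliffordAlgebra Q)ˣ) : CliffordAlgebra Q) := by
    rw [← hc, mul_assoc, Units.mul_inv, mul_one]
  have hc0 : c ≠ 0 := by
    rintro rfl
    rw [map_zero, zero_mul, star_eq_zero] at hstar
    exact u.ne_zero hstar
  obtain ⟨d, hd⟩ := IsAlgClosed.exists_pow_nat_eq c (n := 2) two_pos
  have hd0 : d ≠ 0 := by rintro rfl; exact hc0 (by rw [← hd]; simp)
  obtain ⟨w, hw, hwd⟩ := algebraMap_mem_lipschitzGroup hQ (inv_ne_zero hd0)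
  have hwu : ((w * u : (CliffordAlgebra Q)ˣ) : CliffordAlgebra Q) =
      d⁻¹ • (u : CliffordAlgebra Q) := by
    rw [Units.val_mul, hwd, Algebra.smul_def]
  refine ⟨d⁻¹, ⟨⟨⟨w * u, mul_mem hw hu, hwu⟩, ?_, ?_⟩, ?_⟩⟩
  · rw [CliffordAlgebra.star_smul, smul_mul_smul_comm, hc, Algebra.smul_def, ← map_mul, ← hd,
      show d⁻¹ * d⁻¹ * d ^ 2 = 1 by field_simp, map_one]
  · rw [CliffordAlgebra.star_smul, smul_mul_smul_comm, hstar, ← mul_assoc, ← Algebra.commutes c, mul_assoc,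
      Units.mul_inv, mul_one, Algebra.smul_def, ← map_mul, ← hd,
      show d⁻¹ * d⁻¹ * d ^ 2 = 1 by field_simp, map_one]
  · refine Subalgebra.smul_mem _ ?_ _
    exact mem_even_of_involute_eq _ hinv

theorem cover_eq_iff (x : spinGroup Q) (g : SO Q) :
    cover Q x = g ↔ ∀ v, (x : CliffordAlgebra Q) * ι Q v =
      ι Q ((g : V ≃ₗ[ℂ] V) v) * (x : CliffordAlgebra Q) :=
  ⟨fun h => h ▸ cover_spec Q x, spin_unique Q x _ _ (cover_spec Q x)⟩

/-- The product of reflections realising `g` is even because its parity is the determinant of `g`;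
it remains to rescale it. -/
theorem cover_surjective [Nontrivial V] (hQ : (polarBilin Q).Nondegenerate) :
    Function.Surjective (cover Q) := by
  intro g
  have := clifford_nontrivial Q
  obtain ⟨b, hb, hb0⟩ := exists_anisotropic_orthogonal_basis hQ
  obtain ⟨u, hu, hug⟩ := exists_reflections b hb hb0 (Module.finrank ℂ V)
    ((g : V ≃ₗ[ℂ] V) : V →ₗ[ℂ] V) g.2.1 (fun i hi => absurd i.2 (not_lt.2 hi))
  obtain ⟨g', hg', hg''⟩ := lipschitz_exists Q hu
  have hgg : g' = (g : V ≃ₗ[ℂ] V) := by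
    refine LinearEquiv.ext fun v => ι_injective Q ?_
    have := (hg'' v).symm.trans (hug v)
    exact (Units.mul_left_inj u).1 this
  have hinv : involute (u : CliffordAlgebra Q) = u := by
    rw [hg', hgg, g.2.2, Units.val_one, one_smul]
  have hug' : ∀ v, (u : CliffordAlgebra Q) * ι Q v =
      ι Q ((g : V ≃ₗ[ℂ] V) v) * (u : CliffordAlgebra Q) := fun v => by
    have := hug v
    rwa [hinv] at this
  obtain ⟨c, hc⟩ := exists_smul_mem_spinGroup hQ u hu hinv _ hug'
  refine ⟨⟨_, hc⟩, (cover_eq_iff _ _).2 fun v => ?_⟩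
  change c • (u : CliffordAlgebra Q) * _ = _ * c • (u : CliffordAlgebra Q)
  rw [smul_mul_assoc, hug', mul_smul_comm]

/-- The element `star x * y` is even and commutes with every vector. This is how explicit Clifford
elements are compared with lifts that are only known to exist. -/
theorem eq_smul_of_cover [Nontrivial V] (hQ : (polarBilin Q).Nondegenerate) (x : spinGroup Q)
    (y : CliffordAlgebra Q) (hy : involute y = y)
    (h : ∀ v, y * ι Q v = ι Q ((cover Q x : V ≃ₗ[ℂ] V) v) * y) :
    ∃ c : ℂ, y = c • (x : CliffordAlgebra Q) := by
  have hx := cover_spec Q x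
  have hxs : star (x : CliffordAlgebra Q) * x = 1 := spinGroup.star_mul_self_of_mem x.2
  have hsx : (x : CliffordAlgebra Q) * star (x : CliffordAlgebra Q) = 1 :=
    spinGroup.mul_star_self_of_mem x.2
  obtain ⟨c, hc⟩ := eq_algebraMap_of_commute hQ (star (x : CliffordAlgebra Q) * y)
    (by rw [map_mul, hy, star_def, ← reverse_involute, spinGroup.involute_eq x.2,
      spinGroup.involute_eq x.2]) (fun v => by
      rw [mul_assoc, h, ← mul_assoc, ← star_eq_of_mul_ι_eq (hx v), mul_assoc])
  refine ⟨c, ?_⟩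
  calc y = x * (star (x : CliffordAlgebra Q) * y) := by rw [← mul_assoc, hsx, one_mul]
    _ = _ := by rw [hc, Algebra.smul_def, Algebra.commutes]

theorem neg_one_mem_spinGroup [Nontrivial V] (hQ : (polarBilin Q).Nondegenerate) :
    (-1 : CliffordAlgebra Q) ∈ spinGroup Q := by
  obtain ⟨u, hu, hu1⟩ := algebraMap_mem_lipschitzGroup hQ (neg_ne_zero.2 (one_ne_zero (α := ℂ)))
  rw [map_neg, map_one] at hu1
  refine ⟨⟨⟨u, hu, hu1⟩, ?_, ?_⟩, ?_⟩
  · simp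
  · simp
  · exact (even Q).neg_mem (one_mem (even Q))

theorem cover_eq_one_iff [Nontrivial V] (hQ : (polarBilin Q).Nondegenerate) (x : spinGroup Q) :
    cover Q x = 1 ↔ (x : CliffordAlgebra Q) = 1 ∨ (x : CliffordAlgebra Q) = -1 := by
  have := clifford_nontrivial Q
  constructor
  · intro h
    obtain ⟨c, hc⟩ := eq_smul_of_cover hQ 1 (x : CliffordAlgebra Q) (spinGroup.involute_eq x.2)
      (by rw [map_one, ← h]; exact cover_spec Q x)
    rw [Algebra.smul_def] at hc
    have hc' : (x : CliffordAlgebra Q) = algebraMap ℂ _ c := hc.trans (mul_one _)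
    have h1 := spinGroup.star_mul_self_of_mem x.2
    rw [hc', star_algebraMap, ← map_mul, ← map_one (algebraMap ℂ (CliffordAlgebra Q))] at h1
    rcases mul_self_eq_one_iff.1 ((algebraMap ℂ (CliffordAlgebra Q)).injective h1) with h | h
    · left; rw [hc', h, map_one]
    · right; rw [hc', h, map_neg, map_one]
  · rintro (h | h) <;> refine (cover_eq_iff _ _).2 fun v => ?_ <;> rw [h] <;> simp

end SpinOrbit

/-! ### Clifford products of bases of isotropic subspaces -/

namespace CliffordAlgebra

open QuadraticMap

variable {V : Type*} [AddCommGroup V] [Module ℂ V]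

/-- The product in the Clifford algebra of a list of vectors. -/
noncomputable def vectorProd (Q : QuadraticForm ℂ V) (l : List V) : CliffordAlgebra Q :=
  (l.map (ι Q)).prod

variable {Q : QuadraticForm ℂ V}

theorem vectorProd_nil : vectorProd Q [] = 1 := rfl

theorem vectorProd_cons (v : V) (l : List V) :
    vectorProd Q (v :: l) = ι Q v * vectorProd Q l := by
  simp [vectorProd]

theorem involute_vectorProd (l : List V) :
    involute (vectorProd Q l) = (-1 : ℂ) ^ l.length • vectorProd Q l := by
  induction l with
  | nil => simp [vectorProd_nil]
  | cons v l ih =>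
    rw [vectorProd_cons, map_mul, ih, involute_ι, List.length_cons, pow_succ]
    simp

theorem ι_mul_ι_eq_neg {v w : V} (h : polar Q v w = 0) : ι Q v * ι Q w = -(ι Q w * ι Q v) :=
  eq_neg_of_add_eq_zero_left (by rw [ι_mul_ι_add_swap, h, map_zero])

theorem vectorProd_mul_ι {l : List V} {v : V} (h : ∀ w ∈ l, polar Q w v = 0) :
    vectorProd Q l * ι Q v = (-1 : ℂ) ^ l.length • (ι Q v * vectorProd Q l) := by
  induction l with
  | nil => simp [vectorProd_nil]
  | cons w l ih =>
    rw [vectorProd_cons, mul_assoc, ih fun u hu => h u (List.mem_cons_of_mem _ hu),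
      mul_smul_comm, ← mul_assoc, ι_mul_ι_eq_neg (h w List.mem_cons_self), List.length_cons,
      pow_succ, mul_smul, neg_one_smul, neg_mul, mul_assoc]

theorem ι_mul_vectorProd_eq_zero {l : List V} {v : V} (hv : v ∈ l) (hQ : Q v = 0)
    (h : ∀ w ∈ l, polar Q v w = 0) : ι Q v * vectorProd Q l = 0 := by
  induction l with
  | nil => simp at hv
  | cons w l ih =>
    rw [vectorProd_cons]
    by_cases hvw : v = w
    · rw [← hvw, ← mul_assoc, ι_sq_scalar, hQ, map_zero, zero_mul]
    · rw [← mul_assoc, ι_mul_ι_eq_neg (h w List.mem_cons_self), neg_mul, mul_assoc,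
        ih ((List.mem_cons.1 hv).resolve_left hvw) fun u hu => h u (List.mem_cons_of_mem _ hu),
        mul_zero, neg_zero]

theorem exists_reverse_vectorProd {l : List V} (h : l.Pairwise fun v w => polar Q v w = 0) :
    ∃ ε : ℂ, ε ≠ 0 ∧ reverse (vectorProd Q l) = ε • vectorProd Q l := by
  induction l with
  | nil => exact ⟨1, one_ne_zero, by simp [vectorProd_nil]⟩
  | cons w l ih =>
    rw [List.pairwise_cons] at h
    obtain ⟨ε, hε, h'⟩ := ih h.2
    refine ⟨ε * (-1) ^ l.length, mul_ne_zero hε (by simp), ?_⟩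
    rw [vectorProd_cons, reverse.map_mul, h', reverse_ι, smul_mul_assoc,
      vectorProd_mul_ι fun u hu => by rw [polar_comm]; exact h.1 u hu, smul_smul]

theorem contractLeft_vectorProd {l : List V} {f : Module.Dual ℂ V} (h : ∀ v ∈ l, f v = 0) :
    contractLeft f (vectorProd Q l) = 0 := by
  induction l with
  | nil => rw [vectorProd_nil, contractLeft_one]
  | cons w l ih =>
    rw [vectorProd_cons, contractLeft_ι_mul, h w List.mem_cons_self,
      ih fun u hu => h u (List.mem_cons_of_mem _ hu), zero_smul, mul_zero, sub_zero]

section Basis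

variable {κ : Type*} (b : Module.Basis κ ℂ V)

/-- Contraction with the dual coordinate strips off the first factor. -/
theorem vectorProd_basis_ne_zero {S : List κ} (hS : S.Nodup) :
    vectorProd Q (S.map b) ≠ 0 := by
  have := SpinOrbit.clifford_nontrivial Q
  induction S with
  | nil => simp [vectorProd_nil]
  | cons i S ih =>
    rw [List.nodup_cons] at hS
    intro h
    refine ih hS.2 ?_
    have h1 := congrArg (contractLeft (b.coord i)) h
    rw [List.map_cons, vectorProd_cons, contractLeft_ι_mul, contractLeft_vectorProd, map_zero,
      mul_zero, sub_zero] at h1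
    · simpa using h1
    · intro v hv
      obtain ⟨j, hj, rfl⟩ := List.mem_map.1 hv
      have : i ≠ j := fun h => hS.1 (h ▸ hj)
      simp [Finsupp.single_eq_of_ne this]

/-- An element annihilated by the vectors of a list and by the contractions with the
functionals vanishing on it is a multiple of their product. -/
theorem exists_eq_smul_vectorProd [FiniteDimensional ℂ V] {S : List κ} (hS : S.Nodup)
    (y : CliffordAlgebra Q) (h1 : ∀ i ∈ S, ι Q (b i) * y = 0)
    (h2 : ∀ f : Module.Dual ℂ V, (∀ i ∈ S, f (b i) = 0) → contractLeft f y = 0) :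
    ∃ c : ℂ, y = c • vectorProd Q (S.map b) := by
  classical
  induction S generalizing y with
  | nil =>
    obtain ⟨c, hc⟩ := eq_algebraMap_of_contractLeft y fun f => h2 f (by simp)
    exact ⟨c, by rw [hc, Algebra.algebraMap_eq_smul_one]; rfl⟩
  | cons i S ih =>
    rw [List.nodup_cons] at hS
    have hcoord : ∀ j ∈ S, b.coord i (b j) = 0 := fun j hj => by
      have : i ≠ j := fun h => hS.1 (h ▸ hj)
      simp [Finsupp.single_eq_of_ne this]
    have hself : b.coord i (b i) = 1 := by simp
    -- Contracting `b i * y = 0` with the dual coordinate shows that `y` is divisible by `b i`;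
    -- induction applies to the quotient.
    have hy : y = ι Q (b i) * contractLeft (b.coord i) y := by
      have := contractLeft_ι_mul (Q := Q) (b.coord i) (b i) y
      rw [h1 i List.mem_cons_self, map_zero, hself, one_smul] at this
      exact sub_eq_zero.1 this.symm
    obtain ⟨c, hc⟩ := ih hS.2 (contractLeft (b.coord i) y) (fun j hj => by
      have := contractLeft_ι_mul (Q := Q) (b.coord i) (b j) y
      rw [h1 j (List.mem_cons_of_mem _ hj), map_zero, hcoord j hj, zero_smul, zero_sub] at this
      exact neg_eq_zero.1 this.symm) (fun f hf => by
      -- The functional is corrected to vanish on `b i`; the discarded multiple of `b.coord i` does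
      -- no harm, since contracting twice with it gives zero.
      have hd : f = (f - f (b i) • b.coord i) + f (b i) • b.coord i := by abel
      rw [hd, map_add, LinearMap.add_apply, map_smul, LinearMap.smul_apply,
        contractLeft_contractLeft, smul_zero, add_zero, contractLeft_comm, h2, map_zero, neg_zero]
      intro j hj
      rcases List.mem_cons.1 hj with rfl | hj
      · rw [LinearMap.sub_apply, LinearMap.smul_apply, hself]; simp
      · rw [LinearMap.sub_apply, LinearMap.smul_apply, hcoord j hj, hf j hj]; simp)
    exact ⟨c, by rw [List.map_cons, vectorProd_cons, ← mul_smul_comm, ← hc]; exact hy⟩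

/-- The span of the vectors of a basis with index in a list. -/
abbrev listSpan (S : List κ) : Submodule ℂ V :=
  Submodule.span ℂ (Set.range fun k : Fin S.length => b (S.get k))

theorem mem_listSpan {S : List κ} {i : κ} (hi : i ∈ S) : b i ∈ listSpan b S := by
  obtain ⟨k, rfl⟩ := List.mem_iff_get.1 hi
  exact Submodule.subset_span ⟨k, rfl⟩

theorem listSpan_le {S : List κ} {N : Submodule ℂ V} (h : ∀ i ∈ S, b i ∈ N) :
    listSpan b S ≤ N :=
  Submodule.span_le.2 (by rintro _ ⟨k, rfl⟩; exact h _ (List.get_mem _ _))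

theorem ι_mul_vectorProd_of_mem {S : List κ} (hiso : ∀ i ∈ S, Q (b i) = 0)
    (horth : ∀ i ∈ S, ∀ j ∈ S, polar Q (b i) (b j) = 0) {v : V} (hv : v ∈ listSpan b S) :
    ι Q v * vectorProd Q (S.map b) = 0 := by
  have : listSpan b S ≤ LinearMap.ker
      ((LinearMap.mulRight ℂ (vectorProd Q (S.map b))) ∘ₗ ι Q) := by
    refine listSpan_le b fun i hi => ?_
    rw [LinearMap.mem_ker]
    refine ι_mul_vectorProd_eq_zero (List.mem_map_of_mem hi) (hiso i hi) fun w hw => ?_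
    obtain ⟨j, hj, rfl⟩ := List.mem_map.1 hw
    exact horth i hi j hj
  exact this hv

/-- The line of the product of a basis of L is characterised by being killed by L and by
contractions with L^⊥. Both conditions survive multiplication by `x`: the first because `g`
preserves L, the second because the contraction with `v` produces the factor `g v - v`, which lies
in L. Here `g` is the inverse of the isometry induced by `x`. -/
theorem exists_mul_vectorProd_eq_smul [FiniteDimensional ℂ V]
    (hQ : (polarBilin Q).Nondegenerate) {S : List κ} (hS : S.Nodup)
    (hiso : ∀ i ∈ S, Q (b i) = 0) (horth : ∀ i ∈ S, ∀ j ∈ S, polar Q (b i) (b j) = 0)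
    {x : CliffordAlgebra Q} (hx : involute x = x) {g : V → V}
    (hg : ∀ v, ι Q v * x = x * ι Q (g v)) (hgL : ∀ v ∈ listSpan b S, g v ∈ listSpan b S)
    (hgL' : ∀ v, (∀ i ∈ S, polar Q v (b i) = 0) → g v - v ∈ listSpan b S) :
    ∃ c : ℂ, x * vectorProd Q (S.map b) = c • vectorProd Q (S.map b) := by
  refine exists_eq_smul_vectorProd b hS _ (fun i hi => ?_) fun f hf => ?_
  · rw [← mul_assoc, hg, mul_assoc,
      ι_mul_vectorProd_of_mem b hiso horth (hgL _ (mem_listSpan b hi)), mul_zero]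
  · obtain ⟨v, rfl⟩ := (LinearMap.BilinForm.toDual (polarBilin Q) hQ).surjective f
    have hv : LinearMap.BilinForm.toDual (polarBilin Q) hQ v = polarBilin Q v := rfl
    rw [hv] at hf ⊢
    simp only [polarBilin_apply_apply] at hf
    rw [contractLeft_polar, map_mul, hx, involute_vectorProd, ← mul_assoc, hg, mul_smul_comm,
      smul_mul_assoc, mul_assoc x _ (ι Q v), vectorProd_mul_ι, mul_smul_comm, smul_smul,
      ← pow_add, Even.neg_one_pow ⟨_, rfl⟩, one_smul, mul_assoc, ← mul_sub, ← sub_mul, ← map_sub,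
      ι_mul_vectorProd_of_mem b hiso horth (hgL' v hf), mul_zero]
    intro w hw
    obtain ⟨j, hj, rfl⟩ := List.mem_map.1 hw
    rw [polar_comm]; exact hf j hj

/-- On a totally isotropic subspace the Clifford product is the image of the exterior product, hence
alternating, and in top degree an alternating map scales by the determinant. -/
theorem vectorProd_map_eq_det_smul {S : List κ} (hS : S.Nodup)
    (hiso : ∀ v ∈ listSpan b S, Q v = 0) (g : V →ₗ[ℂ] V)
    (hgL : ∀ v ∈ listSpan b S, g v ∈ listSpan b S) :
    vectorProd Q (S.map fun i => g (b i)) =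
      LinearMap.det (g.restrict hgL) • vectorProd Q (S.map b) := by
  let j : (0 : QuadraticForm ℂ (listSpan b S)) →qᵢ Q :=
    { toLinearMap := (listSpan b S).subtype
      map_app' := fun v => hiso _ v.2 }
  let F : (listSpan b S) [⋀^Fin S.length]→ₗ[ℂ] CliffordAlgebra Q :=
    ((map j).toLinearMap).compAlternatingMap (ExteriorAlgebra.ιMulti ℂ S.length)
  have hF : ∀ v : Fin S.length → listSpan b S,
      F v = (List.ofFn fun k => ι Q (v k : V)).prod := by
    intro v
    change map j (ExteriorAlgebra.ιMulti ℂ S.length v) = _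
    rw [ExteriorAlgebra.ιMulti_apply]
    refine (map_list_prod (map j) _).trans ?_
    rw [List.map_ofFn]
    congr 2
    funext k
    exact map_apply_ι j (v k)
  have hli : LinearIndependent ℂ fun k : Fin S.length => b (S.get k) :=
    b.linearIndependent.comp _ (List.nodup_iff_injective_get.1 hS)
  let e : Module.Basis (Fin S.length) ℂ (listSpan b S) := Module.Basis.span hli
  have he : ∀ k, ((e k : listSpan b S) : V) = b (S.get k) := fun k => by
    simp only [e, Module.Basis.span_apply]
  have h1 : F e = vectorProd Q (S.map b) := by
    rw [hF, vectorProd, List.map_map]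
    conv_rhs => rw [← List.ofFn_get S, List.map_ofFn]
    simp only [he]; rfl
  have h2 : F (g.restrict hgL ∘ e) = vectorProd Q (S.map fun i => g (b i)) := by
    rw [hF, vectorProd, List.map_map]
    conv_rhs => rw [← List.ofFn_get S, List.map_ofFn]
    simp only [Function.comp_apply, LinearMap.coe_restrict_apply, he]; rfl
  rw [← h1, ← h2, ← sub_eq_zero]
  -- Functionals reduce the claim to scalar-valued alternating maps, which are multiples of the
  -- determinant of the basis.
  rw [← Module.forall_dual_apply_eq_zero_iff ℂ]
  intro φ
  have h3 := AlternatingMap.eq_smul_basis_det e (φ.compAlternatingMap F)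
  have h4 := congrArg (fun f => f (g.restrict hgL ∘ e)) h3
  simp only [AlternatingMap.smul_apply, Module.Basis.det_comp, Module.Basis.det_self,
    LinearMap.compAlternatingMap_apply, smul_eq_mul, mul_one] at h4
  rw [map_sub, map_smul, h4, smul_eq_mul, mul_comm, sub_self]

theorem mul_vectorProd {x : CliffordAlgebra Q} {g : V → V}
    (hg : ∀ v, x * ι Q v = ι Q (g v) * x) (l : List V) :
    x * vectorProd Q l = vectorProd Q (l.map g) * x := by
  induction l with
  | nil => simp [vectorProd_nil]
  | cons v l ih =>
    rw [vectorProd_cons, ← mul_assoc, hg, mul_assoc, ih, List.map_cons, vectorProd_cons, mul_assoc]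

/-- The square of the scalar by which an element of the spin group acts on the product of a basis
of an isotropic subspace. -/
theorem sq_eq_det_of_mul_vectorProd {S : List κ} (hS : S.Nodup)
    (hiso : ∀ v ∈ listSpan b S, Q v = 0) {x : CliffordAlgebra Q} (hx : involute x = x)
    (hxs : star x * x = 1) (g : V →ₗ[ℂ] V) (hg : ∀ v, x * ι Q v = ι Q (g v) * x)
    (hgL : ∀ v ∈ listSpan b S, g v ∈ listSpan b S) {c : ℂ}
    (hc : x * vectorProd Q (S.map b) = c • vectorProd Q (S.map b)) :
    c ^ 2 = LinearMap.det (g.restrict hgL) := by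
  set lam := vectorProd Q (S.map b) with hlam
  have hpair : (S.map b).Pairwise fun v w => polar Q v w = 0 := by
    refine List.pairwise_map.2 (List.pairwise_of_forall_mem_list ?_)
    intro i hi j hj
    have hi' := mem_listSpan b hi
    have hj' := mem_listSpan b hj
    rw [polar, hiso _ (add_mem hi' hj'), hiso _ hi', hiso _ hj']; simp
  obtain ⟨ε, hε, hrev⟩ := exists_reverse_vectorProd hpair
  -- Reversing the eigenvector equation moves `x` to the right; the reversal factor `ε` cancels.
  -- Moving `x` past the product instead yields the determinant, and the two relations combine to `c
  -- ^ 2`.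
  have h1 : lam * star x = c • lam := by
    have := congrArg reverse hc
    rw [reverse.map_mul, map_smul, hrev, smul_mul_assoc, smul_comm c ε] at this
    have h2 := smul_right_injective _ hε this
    rw [star_def, hx]; exact h2
  have h2 : c • lam * x = lam := by rw [← h1, mul_assoc, hxs, mul_one]
  have h3 : c • lam = LinearMap.det (g.restrict hgL) • (lam * x) := by
    rw [← hc, mul_vectorProd hg, List.map_map]
    have := vectorProd_map_eq_det_smul b hS hiso g hgL
    change vectorProd Q (S.map fun i => g (b i)) * x = _
    rw [this, smul_mul_assoc]
  have h4 : (c ^ 2) • lam = LinearMap.det (g.restrict hgL) • lam := by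
    rw [pow_two, mul_smul, h3, smul_comm, ← smul_mul_assoc c, h2]
  exact smul_left_injective ℂ (vectorProd_basis_ne_zero b hS) h4

end Basis

/-- A product of an odd number of orthogonal vectors commutes with each of them. -/
theorem vectorProd_mul_ι_of_mem {l : List V} (hl : l.Pairwise fun v w => polar Q v w = 0)
    {v : V} (hv : v ∈ l) :
    vectorProd Q l * ι Q v = -((-1 : ℂ) ^ l.length • (ι Q v * vectorProd Q l)) := by
  induction l with
  | nil => simp at hv
  | cons w l ih =>
    rw [List.pairwise_cons] at hl
    rw [vectorProd_cons, List.length_cons, pow_succ, mul_neg_one, neg_smul, neg_neg]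
    rcases List.mem_cons.1 hv with rfl | hv'
    · rw [mul_assoc, vectorProd_mul_ι fun u hu => by rw [polar_comm]; exact hl.1 u hu,
        mul_smul_comm]
    · rw [mul_assoc, ih hl.2 hv', mul_neg, mul_smul_comm, ← mul_assoc,
        ι_mul_ι_eq_neg (hl.1 v hv'), ← mul_assoc]
      simp

end CliffordAlgebra

/-! ### Intertwiners depending polynomially on the isometry, and odd orthogonal products -/

namespace CliffordAlgebra

open QuadraticMap

section Transfer

variable {V : Type*} [AddCommGroup V] [Module ℂ V] {Q : QuadraticForm ℂ V}

variable (Q) in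
/-- An element of the Clifford algebra which intertwines the vectors `e` of an orthogonal list with
the vectors `g e`, and depends polynomially on `g`. -/
noncomputable def intertwiner (g : V → V) : List V → CliffordAlgebra Q
  | [] => 1
  | e :: l => intertwiner g l + (Q e)⁻¹ • (ι Q (g e) * intertwiner g l * ι Q e)

theorem involute_intertwiner (g : V → V) (l : List V) :
    involute (intertwiner Q g l) = intertwiner Q g l := by
  induction l with
  | nil => simp [intertwiner]
  | cons e l ih =>
    rw [intertwiner, map_add, map_smul, map_mul, map_mul, ih, involute_ι, involute_ι]
    simp

/-- For the head of the list, the two summands of the recursion are exchanged. For a later vector,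
the signs from passing `g e` and `e` cancel. -/
theorem ι_mul_intertwiner {g : V → V} (hg : ∀ v, Q (g v) = Q v)
    (hg' : ∀ v w, polar Q (g v) (g w) = polar Q v w) {l : List V}
    (hl : l.Pairwise fun v w => polar Q v w = 0) (hl0 : ∀ e ∈ l, Q e ≠ 0) {v : V} (hv : v ∈ l) :
    ι Q (g v) * intertwiner Q g l = intertwiner Q g l * ι Q v := by
  induction l with
  | nil => simp at hv
  | cons e l ih =>
    have he : Q e ≠ 0 := hl0 e List.mem_cons_self
    rw [List.pairwise_cons] at hl
    rw [intertwiner, mul_add, add_mul]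
    rcases List.mem_cons.1 hv with rfl | hv'
    · rw [mul_smul_comm, ← mul_assoc, ← mul_assoc, ι_sq_scalar, hg, smul_mul_assoc,
        mul_assoc (ι Q (g v) * _), ι_sq_scalar, ← Algebra.commutes (Q v) (ι Q (g v) * _),
        mul_assoc (algebraMap ℂ _ (Q v)), ← Algebra.smul_def, ← Algebra.smul_def, smul_smul,
        smul_smul, inv_mul_cancel₀ he, one_smul, one_smul, add_comm]
    · have ih' := ih hl.2 (fun u hu => hl0 u (List.mem_cons_of_mem _ hu)) hv'
      have h1 : ι Q (g v) * ι Q (g e) = -(ι Q (g e) * ι Q (g v)) :=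
        ι_mul_ι_eq_neg (by rw [hg', polar_comm]; exact hl.1 v hv')
      have h2 : ι Q v * ι Q e = -(ι Q e * ι Q v) :=
        ι_mul_ι_eq_neg (by rw [polar_comm]; exact hl.1 v hv')
      rw [ih', mul_smul_comm, smul_mul_assoc, ← mul_assoc, ← mul_assoc, h1, neg_mul,
        mul_assoc (ι Q (g e)), ih', neg_mul, mul_assoc (ι Q (g e)), mul_assoc _ (ι Q v), h2]
      simp only [mul_neg, neg_neg, mul_assoc]

/-- The nonzero value at the identity allows the intertwiner to be normalised to a spin lift for
nearby isometries. -/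
theorem intertwiner_id {l : List V} (hl0 : ∀ e ∈ l, Q e ≠ 0) :
    intertwiner Q id l = algebraMap ℂ _ (2 ^ l.length) := by
  induction l with
  | nil => simp [intertwiner]
  | cons e l ih =>
    rw [intertwiner, ih fun u hu => hl0 u (List.mem_cons_of_mem _ hu), id, mul_assoc,
      Algebra.commutes, ← mul_assoc, ι_sq_scalar, Algebra.smul_def, ← map_mul, ← map_mul,
      ← mul_assoc, inv_mul_cancel₀ (hl0 e List.mem_cons_self), one_mul, ← map_add,
      List.length_cons]
    congr 1; ring

end Transfer

section Odd

variable {V : Type*} [AddCommGroup V] [Module ℂ V] [FiniteDimensional ℂ V]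
  {Q : QuadraticForm ℂ V}

omit [FiniteDimensional ℂ V] in
theorem isUnit_vectorProd {l : List V} (hl : ∀ v ∈ l, Q v ≠ 0) : IsUnit (vectorProd Q l) := by
  induction l with
  | nil => exact isUnit_one
  | cons v l ih =>
    rw [vectorProd_cons]
    exact (vectorUnit v (hl v List.mem_cons_self)).isUnit.mul
      (ih fun u hu => hl u (List.mem_cons_of_mem _ hu))

omit [FiniteDimensional ℂ V] in
theorem vectorProd_map_smul (l : List V) (c : ℂ) :
    vectorProd Q (l.map fun v => c • v) = c ^ l.length • vectorProd Q l := by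
  induction l with
  | nil => simp [vectorProd_nil]
  | cons v l ih =>
    rw [List.map_cons, vectorProd_cons, vectorProd_cons, ih, map_smul, smul_mul_smul_comm,
      List.length_cons, pow_succ']

/-- The product of an orthogonal basis of an odd-dimensional nondegenerate subspace. -/
theorem exists_odd_unit (hQ : (polarBilin Q).Nondegenerate) {p : Module.End ℂ V}
    (hp : p * p = p) (hadj : ∀ v w, polar Q (p v) w = polar Q v (p w))
    (hodd : Odd (Module.finrank ℂ (LinearMap.range p))) :
    ∃ u : CliffordAlgebra Q, IsUnit u ∧ involute u = -u ∧
      (∀ v, u * ι Q v = -(ι Q ((1 - (2 : ℂ) • p) v) * u)) ∧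
      ∀ (x : CliffordAlgebra Q) (g : V → V) (ε : ℂ), ε ^ 2 = 1 →
        (∀ v, x * ι Q v = ι Q (g v) * x) → (∀ v, g (p v) = ε • p v) → x * u = ε • (u * x) := by
  have hpp : ∀ v, p (p v) = p v := fun v => by rw [← Module.End.mul_apply, hp]
  let W := LinearMap.range p
  have hW : ∀ w : W, p w = w := by rintro ⟨_, v, rfl⟩; exact hpp v
  -- The range of a self-adjoint idempotent is nondegenerate: an element of it pairs with `v` as it
  -- pairs with `p v`.
  have hnd : (polarBilin (Q.comp W.subtype)).Nondegenerate := by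
    have hsep : ∀ w : W, (∀ w' : W, polar Q w w' = 0) → w = 0 := by
      intro w hw
      refine Subtype.ext (hQ.1 w fun v => ?_)
      rw [polarBilin_apply_apply, ← hW w, hadj]
      exact hw ⟨p v, v, rfl⟩
    refine ⟨fun w hw => hsep w fun w' => ?_, fun w hw => hsep w fun w' => ?_⟩
    · exact hw w'
    · rw [polar_comm]; exact hw w'
  obtain ⟨b, hb, hb0⟩ := exists_anisotropic_orthogonal_basis hnd
  let l : List V := List.ofFn fun i => ((b i : W) : V)
  have hlen : l.length = Module.finrank ℂ W := List.length_ofFn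
  -- Oddness of the dimension enters here: scaling every factor by a sign scales the product by that
  -- same sign.
  have hlodd : ∀ ε : ℂ, ε ^ 2 = 1 → ε ^ l.length = ε := by
    intro ε hε
    obtain ⟨m, hm⟩ := hodd
    rw [hlen, hm, pow_succ, pow_mul, hε, one_pow, one_mul]
  have hmem : ∀ v ∈ l, p v = v := by
    intro v hv
    obtain ⟨i, rfl⟩ := (List.mem_ofFn' _ _).1 hv
    exact hW _
  have hl0 : ∀ v ∈ l, Q v ≠ 0 := by
    intro v hv
    obtain ⟨i, rfl⟩ := (List.mem_ofFn' _ _).1 hv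
    exact hb0 i
  have hpair : l.Pairwise fun v w => polar Q v w = 0 := by
    rw [List.pairwise_ofFn]
    exact fun i j hij => hb i j hij.ne
  refine ⟨vectorProd Q l, isUnit_vectorProd hl0, ?_, fun v => ?_, fun x g ε hε hx hg => ?_⟩
  · rw [involute_vectorProd, hlodd _ (by norm_num), neg_one_smul]
  · have h1 : ∀ w : W, vectorProd Q l * ι Q w = ι Q w * vectorProd Q l := by
      intro w
      have key : LinearMap.mulLeft ℂ (vectorProd Q l) ∘ₗ ι Q ∘ₗ W.subtype =
          LinearMap.mulRight ℂ (vectorProd Q l) ∘ₗ ι Q ∘ₗ W.subtype := by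
        refine b.ext fun i => ?_
        have := vectorProd_mul_ι_of_mem hpair
          (v := ((b i : W) : V)) ((List.mem_ofFn' _ _).2 ⟨i, rfl⟩)
        rw [hlodd _ (by norm_num), neg_one_smul, neg_neg] at this
        exact this
      exact LinearMap.congr_fun key w
    have h2 : vectorProd Q l * ι Q (v - p v) = -(ι Q (v - p v) * vectorProd Q l) := by
      rw [vectorProd_mul_ι, hlodd _ (by norm_num), neg_one_smul]
      intro w hw
      rw [← hmem w hw, hadj, map_sub, hpp, sub_self]; simp
    have h3 := h1 ⟨p v, v, rfl⟩
    simp only at h3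
    have h4 : v = p v + (v - p v) := by abel
    conv_lhs => rw [h4, map_add, mul_add, h2, h3]
    have h5 : (1 - (2 : ℂ) • p) v = (v - p v) - p v := by
      rw [LinearMap.sub_apply, LinearMap.smul_apply, two_smul, Module.End.one_apply]
      abel
    rw [h5, map_sub _ (v - p v)]
    noncomm_ring
  · rw [mul_vectorProd hx]
    have : l.map g = l.map fun v => ε • v := List.map_congr_left fun v hv => by
      conv_lhs => rw [← hmem v hv]
      rw [hg, hmem v hv]
    rw [this, vectorProd_map_smul, hlodd ε hε, smul_mul_assoc]

end Odd

end CliffordAlgebra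

/-! ### Commutation of lifts -/

namespace SpinOrbit

open CliffordAlgebra QuadraticMap

variable {V : Type*} [AddCommGroup V] [Module ℂ V] [FiniteDimensional ℂ V]
  {Q : QuadraticForm ℂ V}

/-- Lifts of a product of two commuting orthogonal involutions with odd-dimensional
`-1`-eigenspaces. -/
theorem mul_eq_smul_mul_of_cover [Nontrivial V] (hQ : (polarBilin Q).Nondegenerate)
    {p q : Module.End ℂ V} (hp : p * p = p) (hq : q * q = q)
    (hpadj : ∀ v w, polar Q (p v) w = polar Q v (p w))
    (hqadj : ∀ v w, polar Q (q v) w = polar Q v (q w))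
    (hpodd : Odd (Module.finrank ℂ (LinearMap.range p)))
    (hqodd : Odd (Module.finrank ℂ (LinearMap.range q))) (x y : spinGroup Q)
    (hy : ∀ v, (cover Q y : V ≃ₗ[ℂ] V) v = (1 - (2 : ℂ) • p) ((1 - (2 : ℂ) • q) v))
    {ε δ : ℂ} (hε : ε ^ 2 = 1) (hδ : δ ^ 2 = 1)
    (hxp : ∀ v, (cover Q x : V ≃ₗ[ℂ] V) (p v) = ε • p v)
    (hxq : ∀ v, (cover Q x : V ≃ₗ[ℂ] V) (q v) = δ • q v) :
    (x : CliffordAlgebra Q) * y = (ε * δ) • ((y : CliffordAlgebra Q) * x) := by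
  have := clifford_nontrivial Q
  obtain ⟨u, hu, hui, huv, hux⟩ := exists_odd_unit hQ hp hpadj hpodd
  obtain ⟨w, hw, hwi, hwv, hwx⟩ := exists_odd_unit hQ hq hqadj hqodd
  -- Two odd products multiply to an even element, and their global signs cancel, so `u * w` is a
  -- multiple of `y`; the commutation relation of `x` with `u` and `w` passes to `y`.
  obtain ⟨c, hc⟩ := eq_smul_of_cover hQ y (u * w) (by rw [map_mul, hui, hwi]; noncomm_ring)
    (fun v => by
      rw [hy, mul_assoc, hwv, mul_neg, ← mul_assoc, huv, neg_mul, neg_neg, mul_assoc])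
  have hc0 : c ≠ 0 := by
    rintro rfl
    rw [zero_smul] at hc
    exact (hu.mul hw).ne_zero hc
  have h1 : (x : CliffordAlgebra Q) * (u * w) = (ε * δ) • (u * w * x) := by
    rw [← mul_assoc, hux _ _ ε hε (cover_spec Q x) hxp, smul_mul_assoc, mul_assoc,
      hwx _ _ δ hδ (cover_spec Q x) hxq, mul_smul_comm, smul_smul, mul_assoc]
  rw [hc, mul_smul_comm, smul_mul_assoc, smul_comm] at h1
  exact smul_right_injective _ hc0 h1

end SpinOrbit

/-! ### Jordan strings and endomorphisms commuting with `e` -/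

namespace SpinOrbit

open Matrix

/-- A basis of `V` consisting of Jordan strings for `e` of the given lengths. -/
structure JordanBasis {V : Type*} [AddCommGroup V] [Module ℂ V] (e : Module.End ℂ V) {s : ℕ}
    (rows : Fin s → ℕ) where
  pos : ∀ i, 0 < rows i
  basis : Module.Basis (Σ i, Fin (rows i)) ℂ V
  apply_basis : ∀ (i : Fin s) (j : Fin (rows i)),
    e (basis ⟨i, j⟩) = if h : (j : ℕ) + 1 < rows i then basis ⟨i, ⟨j + 1, h⟩⟩ else 0

namespace JordanBasis

variable {V : Type*} [AddCommGroup V] [Module ℂ V] {e : Module.End ℂ V} {s : ℕ}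
  {rows : Fin s → ℕ} (J : JordanBasis e rows)

/-- The `j`-th vector of the `i`-th string, zero beyond its end. -/
noncomputable def vec (i : Fin s) (j : ℕ) : V :=
  if h : j < rows i then J.basis ⟨i, ⟨j, h⟩⟩ else 0

/-- The coordinate dual to `vec i j`. -/
noncomputable def co (i : Fin s) (j : ℕ) : V →ₗ[ℂ] ℂ :=
  if h : j < rows i then J.basis.coord ⟨i, ⟨j, h⟩⟩ else 0

theorem vec_fin (i : Fin s) (j : Fin (rows i)) : J.vec i j = J.basis ⟨i, j⟩ := by
  rw [vec, dif_pos j.2]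

theorem co_fin (i : Fin s) (j : Fin (rows i)) : J.co i j = J.basis.coord ⟨i, j⟩ := by
  rw [co, dif_pos j.2]

theorem vec_eq_zero {i : Fin s} {j : ℕ} (h : rows i ≤ j) : J.vec i j = 0 := by
  rw [vec, dif_neg (not_lt.2 h)]

theorem co_eq_zero {i : Fin s} {j : ℕ} (h : rows i ≤ j) : J.co i j = 0 := by
  rw [co, dif_neg (not_lt.2 h)]

theorem e_vec (i : Fin s) (j : ℕ) : e (J.vec i j) = J.vec i (j + 1) := by
  by_cases h : j < rows i
  · rw [vec, dif_pos h, J.apply_basis, vec]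
  · rw [J.vec_eq_zero (not_lt.1 h), J.vec_eq_zero (by omega), map_zero]

theorem e_pow_vec (m : ℕ) (i : Fin s) (j : ℕ) : (e ^ m) (J.vec i j) = J.vec i (j + m) := by
  induction m with
  | zero => simp
  | succ m ih => rw [pow_succ', Module.End.mul_apply, ih, e_vec, add_assoc]

theorem vec_eq_pow (i : Fin s) (j : ℕ) : J.vec i j = (e ^ j) (J.vec i 0) := by
  rw [e_pow_vec, zero_add]

theorem co_vec (i i' : Fin s) {j j' : ℕ} (hj : j < rows i) :
    J.co i j (J.vec i' j') = if i = i' ∧ j = j' then 1 else 0 := by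
  classical
  by_cases hj' : j' < rows i'
  · rw [co, dif_pos hj, vec, dif_pos hj', Module.Basis.coord_apply, Module.Basis.repr_self,
      Finsupp.single_apply]
    refine if_congr ?_ rfl rfl
    constructor
    · intro h
      obtain ⟨rfl, h⟩ := Sigma.mk.inj_iff.1 h
      exact ⟨rfl, (Fin.mk.inj_iff.1 (eq_of_heq h)).symm⟩
    · rintro ⟨rfl, rfl⟩; rfl
  · rw [J.vec_eq_zero (not_lt.1 hj'), map_zero, if_neg]
    rintro ⟨rfl, rfl⟩; exact hj' hj

theorem ext_vec {W : Type*} [AddCommGroup W] [Module ℂ W] {f g : V →ₗ[ℂ] W}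
    (h : ∀ i j, j < rows i → f (J.vec i j) = g (J.vec i j)) : f = g :=
  J.basis.ext fun ⟨i, j⟩ => by rw [← vec_fin]; exact h i j j.2

theorem sum_co_vec (v : V) : ∑ i, ∑ j : Fin (rows i), J.co i j v • J.vec i j = v := by
  conv_rhs => rw [← J.basis.sum_repr v]
  rw [Fintype.sum_sigma]
  simp [co_fin, vec_fin]

theorem co_e_succ (i : Fin s) (j : ℕ) (v : V) (h : j + 1 < rows i) :
    J.co i (j + 1) (e v) = J.co i j v := by
  have : J.co i (j + 1) ∘ₗ e = J.co i j := by
    refine J.ext_vec fun i' j' hj' => ?_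
    rw [LinearMap.comp_apply, e_vec, co_vec J i i' h, co_vec J i i' (by omega)]
    simp
  exact LinearMap.congr_fun this v

theorem co_e_zero (i : Fin s) (v : V) : J.co i 0 (e v) = 0 := by
  have : J.co i 0 ∘ₗ e = 0 := by
    refine J.ext_vec fun i' j' hj' => ?_
    rw [LinearMap.comp_apply, e_vec, co_vec J i i' (J.pos i)]
    simp
  exact LinearMap.congr_fun this v

theorem co_pow_add (m : ℕ) (i : Fin s) (j : ℕ) (v : V) (h : j + m < rows i) :
    J.co i (j + m) ((e ^ m) v) = J.co i j v := by
  induction m with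
  | zero => simp
  | succ m ih =>
    rw [pow_succ', Module.End.mul_apply, ← add_assoc, co_e_succ J _ _ _ (by omega),
      ih (by omega)]

theorem co_pow_of_lt {m : ℕ} (i : Fin s) {j : ℕ} (v : V) (h : j < m) :
    J.co i j ((e ^ m) v) = 0 := by
  by_cases hj : j < rows i
  · obtain ⟨k, rfl⟩ : ∃ k, m = j + (k + 1) := ⟨m - j - 1, by omega⟩
    have := co_pow_add J j i 0 ((e ^ (k + 1)) v) (by omega)
    rw [zero_add, ← Module.End.mul_apply, ← pow_add] at this
    rw [this, pow_succ', Module.End.mul_apply, co_e_zero]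
  · rw [J.co_eq_zero (not_lt.1 hj)]; rfl

include J in
theorem pow_eq_zero {N : ℕ} (hN : ∀ i, rows i ≤ N) : e ^ N = 0 := by
  refine J.ext_vec fun i j hj => ?_
  rw [e_pow_vec, J.vec_eq_zero (by have := hN i; omega)]; rfl

theorem apply_vec {y : Module.End ℂ V} (hy : Commute e y) (i : Fin s) (j : ℕ) :
    y (J.vec i j) = (e ^ j) (y (J.vec i 0)) := by
  rw [J.vec_eq_pow, ← Module.End.mul_apply, ← Module.End.mul_apply, (hy.pow_left j).eq]

/-- Commutation with `e` makes matrix coefficients between two strings depend only on the difference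
of positions. -/
theorem co_apply_vec_add {y : Module.End ℂ V} (hy : Commute e y) (i i' : Fin s) (j j' : ℕ)
    (h : j' + j < rows i') :
    J.co i' (j' + j) (y (J.vec i j)) = J.co i' j' (y (J.vec i 0)) := by
  rw [J.apply_vec hy, J.co_pow_add _ _ _ _ h]

theorem co_apply_vec_self {y : Module.End ℂ V} (hy : Commute e y) (i i' : Fin s) (j : ℕ)
    (h : j < rows i') : J.co i' j (y (J.vec i j)) = J.co i' 0 (y (J.vec i 0)) := by
  have := J.co_apply_vec_add hy i i' j 0 (by omega)
  rwa [zero_add] at this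

theorem co_apply_vec_of_lt {y : Module.End ℂ V} (hy : Commute e y) (i i' : Fin s) {j j' : ℕ}
    (h : j' < j) : J.co i' j' (y (J.vec i j)) = 0 := by
  rw [J.apply_vec hy, J.co_pow_of_lt _ _ h]

theorem co_eq_zero_of_pow {v : V} {r : ℕ} (hv : (e ^ r) v = 0) (i : Fin s) {j : ℕ}
    (h : j + r < rows i) : J.co i j v = 0 := by
  rw [← J.co_pow_add r i j v h, hv, map_zero]

theorem pow_apply_vec {y : Module.End ℂ V} (hy : Commute e y) (i : Fin s) {r : ℕ}
    (hr : rows i ≤ r) : (e ^ r) (y (J.vec i 0)) = 0 := by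
  rw [← J.apply_vec hy, J.vec_eq_zero hr, map_zero]

/-- If a functional only sees the beginnings of the strings, and only those of length `r`. -/
theorem apply_eq_sum {φ : V →ₗ[ℂ] ℂ} (h0 : ∀ i j, 0 < j → φ (J.vec i j) = 0) {r : ℕ} {v : V}
    (hv : (e ^ r) v = 0) (h1 : ∀ i, rows i < r → φ (J.vec i 0) = 0) :
    φ v = ∑ i, if rows i = r then J.co i 0 v * φ (J.vec i 0) else 0 := by
  conv_lhs => rw [← J.sum_co_vec v]
  rw [map_sum]
  refine Finset.sum_congr rfl fun i _ => ?_
  rw [map_sum, Finset.sum_eq_single ⟨0, J.pos i⟩]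
  · rw [map_smul, smul_eq_mul]
    change J.co i 0 v * φ (J.vec i 0) = _
    rcases lt_trichotomy (rows i) r with h | h | h
    · rw [h1 i h, mul_zero, if_neg h.ne]
    · rw [if_pos h]
    · rw [J.co_eq_zero_of_pow hv i (by omega), zero_mul, if_neg h.ne']
  · intro j _ hj
    rw [map_smul, h0 i j (Nat.pos_of_ne_zero fun h => hj (Fin.ext h)), smul_zero]
  · simp

/-! ### The action on the multiplicity spaces -/

/-- The leading part of an endomorphism commuting with `e`: the matrix of its action on the
multiplicity spaces of the Jordan blocks. -/
noncomputable def lead (y : Module.End ℂ V) : Matrix (Fin s) (Fin s) ℂ :=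
  fun i' i => if rows i' = rows i then J.co i' 0 (y (J.vec i 0)) else 0

theorem lead_of_eq (y : Module.End ℂ V) {i i' : Fin s} (h : rows i' = rows i) :
    J.lead y i' i = J.co i' 0 (y (J.vec i 0)) := if_pos h

theorem lead_of_ne (y : Module.End ℂ V) {i i' : Fin s} (h : rows i' ≠ rows i) :
    J.lead y i' i = 0 := if_neg h

/-- The first coordinate after `z` sees only the beginnings of strings. Strings shorter than `rows
i` cannot contribute because `e` kills them too early, longer ones because `y (J.vec i 0)` is killed
by `e ^ rows i`; equal lengths remain. -/
theorem lead_mul {z y : Module.End ℂ V} (hz : Commute e z) (hy : Commute e y) :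
    J.lead (z * y) = J.lead z * J.lead y := by
  ext i'' i
  rw [Matrix.mul_apply]
  by_cases h : rows i'' = rows i
  · rw [J.lead_of_eq _ h, Module.End.mul_apply]
    have := J.apply_eq_sum (φ := J.co i'' 0 ∘ₗ z)
      (fun i' j hj => by rw [LinearMap.comp_apply, J.co_apply_vec_of_lt hz _ _ hj])
      (J.pow_apply_vec hy i le_rfl) (fun i' hi' => by
        rw [LinearMap.comp_apply]
        exact J.co_eq_zero_of_pow (J.pow_apply_vec hz i' le_rfl) _ (by omega))
    rw [LinearMap.comp_apply] at this
    rw [this]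
    refine Finset.sum_congr rfl fun i' _ => ?_
    split_ifs with h'
    · rw [J.lead_of_eq _ h', J.lead_of_eq _ (h.trans h'.symm), mul_comm]; rfl
    · rw [J.lead_of_ne y h', mul_zero]
  · rw [J.lead_of_ne _ h, Finset.sum_eq_zero]
    intro i' _
    by_cases h' : rows i'' = rows i'
    · rw [J.lead_of_ne y (by rwa [← h']), mul_zero]
    · rw [J.lead_of_ne z h', zero_mul]

theorem lead_one : J.lead 1 = 1 := by
  classical
  ext i' i
  rw [lead, Module.End.one_apply, co_vec J _ _ (J.pos i'), Matrix.one_apply]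
  by_cases h : i' = i
  · simp [h]
  · simp [h]

theorem lead_add (y z : Module.End ℂ V) : J.lead (y + z) = J.lead y + J.lead z := by
  ext i' i
  simp only [lead, Matrix.add_apply, LinearMap.add_apply, map_add]
  split_ifs <;> simp

theorem lead_smul (c : ℂ) (y : Module.End ℂ V) : J.lead (c • y) = c • J.lead y := by
  ext i' i
  simp only [lead, Matrix.smul_apply, LinearMap.smul_apply, map_smul, smul_eq_mul]
  split_ifs <;> simp

theorem lead_neg (y : Module.End ℂ V) : J.lead (-y) = -J.lead y := by
  have := J.lead_smul (-1) y
  simpa using this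

theorem lead_sub (y z : Module.End ℂ V) : J.lead (y - z) = J.lead y - J.lead z := by
  rw [sub_eq_add_neg, lead_add, lead_neg, sub_eq_add_neg]

theorem lead_pow {y : Module.End ℂ V} (hy : Commute e y) (n : ℕ) :
    J.lead (y ^ n) = J.lead y ^ n := by
  induction n with
  | zero => exact J.lead_one
  | succ n ih => rw [pow_succ, pow_succ, J.lead_mul (hy.pow_right n) hy, ih]

theorem lead_aeval {y : Module.End ℂ V} (hy : Commute e y) (f : Polynomial ℂ) :
    J.lead (Polynomial.aeval y f) = Polynomial.aeval (J.lead y) f := by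
  induction f using Polynomial.induction_on' with
  | add p q hp hq => rw [map_add, map_add, lead_add, hp, hq]
  | monomial n a =>
    rw [Polynomial.aeval_monomial, Polynomial.aeval_monomial, ← Algebra.smul_def,
      ← Algebra.smul_def, lead_smul, J.lead_pow hy]

/-- An endomorphism commuting with `e` is injective if its leading part is. -/
theorem injective_of_lead {y : Module.End ℂ V} (hy : Commute e y)
    (h : ∀ c : Fin s → ℂ, J.lead y *ᵥ c = 0 → c = 0) : Function.Injective y := by
  classical
  rw [injective_iff_map_eq_zero]
  by_contra! hex
  obtain ⟨v₀, hyv₀, hv₀⟩ := hex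
  -- The last nonzero `e`-translate of a kernel vector lies in the kernels of both `y` and `e`; it
  -- is a combination of ends of strings.
  obtain ⟨v, hyv, hv, hev⟩ : ∃ v, y v = 0 ∧ v ≠ 0 ∧ e v = 0 := by
    have hN : ∃ m, (e ^ m) v₀ = 0 := by
      refine ⟨Finset.univ.sup rows, ?_⟩
      rw [J.pow_eq_zero fun i => Finset.le_sup (Finset.mem_univ i)]; rfl
    obtain ⟨m, hm⟩ : ∃ m, Nat.find hN = m + 1 := Nat.exists_eq_succ_of_ne_zero fun h0 => by
      have := Nat.find_spec hN
      rw [h0] at this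
      exact hv₀ this
    refine ⟨(e ^ m) v₀, ?_, Nat.find_min hN (by omega), ?_⟩
    · rw [← Module.End.mul_apply, ← (hy.pow_left m).eq, Module.End.mul_apply, hyv₀, map_zero]
    · rw [← Module.End.mul_apply, ← pow_succ', ← hm]; exact Nat.find_spec hN
  have hco : ∀ i j, j + 1 < rows i → J.co i j v = 0 := fun i j hj => by
    rw [← J.co_e_succ i j v hj, hev, map_zero]
  obtain ⟨c, hc⟩ : ∃ c : Fin s → ℂ, ∀ i, c i = J.co i (rows i - 1) v := ⟨_, fun _ => rfl⟩
  have hvsum : v = ∑ i, c i • J.vec i (rows i - 1) := by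
    conv_lhs => rw [← J.sum_co_vec v]
    refine Finset.sum_congr rfl fun i _ => ?_
    have hp := J.pos i
    rw [hc, Finset.sum_eq_single ⟨rows i - 1, by omega⟩]
    · intro j _ hj
      rw [hco i j, zero_smul]
      have := j.2
      have : (j : ℕ) ≠ rows i - 1 := fun h => hj (Fin.ext h)
      omega
    · simp
  -- For the least length `r` that occurs, the coordinates of `y v` at the ends of strings of length
  -- `r` involve only the leading part: longer strings cannot reach position `r - 1`.
  have hex : ∃ r, ∃ i, rows i = r ∧ c i ≠ 0 := by
    by_contra! h0
    exact hv (by rw [hvsum]; exact Finset.sum_eq_zero fun i _ => by rw [h0 _ i rfl, zero_smul])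
  obtain ⟨i₀, hi₀, hci₀⟩ := Nat.find_spec hex
  set r := Nat.find hex with hr
  have hmin : ∀ i, rows i < r → c i = 0 := fun i hi => by
    by_contra h0
    exact Nat.find_min hex hi ⟨i, rfl, h0⟩
  have hr0 : 0 < r := hi₀ ▸ J.pos i₀
  have key : J.lead y *ᵥ (fun i => if rows i = r then c i else 0) = 0 := by
    ext i'
    rw [Matrix.mulVec, dotProduct, Pi.zero_apply]
    by_cases hi' : rows i' = r
    · have h1 : J.co i' (r - 1) (y v) = 0 := by rw [hyv, map_zero]
      refine Eq.trans ?_ h1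
      conv_rhs => rw [hvsum]
      simp only [map_sum, map_smul, smul_eq_mul]
      refine Finset.sum_congr rfl fun i _ => ?_
      rcases lt_trichotomy (rows i) r with h | h | h
      · rw [if_neg h.ne, hmin i h, mul_zero, zero_mul]
      · rw [if_pos h, J.lead_of_eq _ (hi'.trans h.symm), h,
          J.co_apply_vec_self hy i i' (r - 1) (by omega), mul_comm]
      · rw [if_neg h.ne', J.co_apply_vec_of_lt hy _ _ (by omega), mul_zero, mul_zero]
    · refine Finset.sum_eq_zero fun i _ => ?_
      split_ifs with h
      · rw [J.lead_of_ne y (by rwa [h]), zero_mul]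
      · rw [mul_zero]
  have := congrFun (h _ key) i₀
  simp only [hi₀, if_true, Pi.zero_apply] at this
  exact hci₀ this

/-- The diagonal entries are constant along each string. -/
theorem trace_eq {y : Module.End ℂ V} (hy : Commute e y) :
    LinearMap.trace ℂ V y = ∑ i, (rows i : ℂ) * J.lead y i i := by
  classical
  rw [LinearMap.trace_eq_matrix_trace ℂ J.basis, Matrix.trace, Fintype.sum_sigma]
  refine Finset.sum_congr rfl fun i _ => ?_
  have : ∀ j : Fin (rows i), (LinearMap.toMatrix J.basis J.basis y).diag ⟨i, j⟩ =
      J.lead y i i := by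
    intro j
    rw [Matrix.diag_apply, LinearMap.toMatrix_apply, J.lead_of_eq _ rfl,
      ← J.co_apply_vec_self hy i i j j.2, co_fin, vec_fin, Module.Basis.coord_apply]
  rw [Finset.sum_congr rfl fun j _ => this j]; simp

/-- For `μ ≠ 0` the leading part of `y - μ` is the scalar `-μ`, so `y` has no nonzero eigenvalue and
its minimal polynomial is a power of `X`. -/
theorem isNilpotent_of_lead [FiniteDimensional ℂ V] {y : Module.End ℂ V} (hy : Commute e y)
    (h : J.lead y = 0) : IsNilpotent y := by
  have hroot : ∀ μ : ℂ, (minpoly ℂ y).IsRoot μ → μ = 0 := by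
    intro μ hμ
    by_contra hμ0
    have hev : Module.End.HasEigenvalue y μ := Module.End.hasEigenvalue_of_isRoot hμ
    obtain ⟨v, hv⟩ := hev.exists_hasEigenvector
    have hinj := J.injective_of_lead (y := y - μ • 1)
      (hy.sub_right ((Commute.one_right e).smul_right μ)) (fun c hc => by
        rw [lead_sub, lead_smul, lead_one, h, zero_sub, Matrix.neg_mulVec, Matrix.smul_mulVec,
          Matrix.one_mulVec, neg_eq_zero] at hc
        exact (smul_eq_zero.1 hc).resolve_left hμ0)
    refine hv.2 (hinj ?_)
    rw [map_zero, LinearMap.sub_apply, hv.apply_eq_smul]; simp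
  have hint : IsIntegral ℂ y := Algebra.IsIntegral.isIntegral y
  have hsplit := IsAlgClosed.splits (minpoly ℂ y)
  have h1 : minpoly ℂ y = Polynomial.X ^ (minpoly ℂ y).roots.card := by
    conv_lhs => rw [hsplit.eq_prod_roots_of_monic (minpoly.monic hint)]
    have : (minpoly ℂ y).roots = Multiset.replicate (minpoly ℂ y).roots.card 0 :=
      Multiset.eq_replicate_card.2 fun μ hμ => hroot μ (Polynomial.isRoot_of_mem_roots hμ)
    rw [this]; simp
  refine ⟨(minpoly ℂ y).roots.card, ?_⟩
  have h2 := minpoly.aeval ℂ y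
  rw [h1, map_pow, Polynomial.aeval_X] at h2
  exact h2

/-! ### Lifting matrices on the multiplicity spaces -/

/-- The endomorphism with a given leading part which respects the positions in the strings. -/
noncomputable def lift (Z : Matrix (Fin s) (Fin s) ℂ) : Module.End ℂ V :=
  J.basis.constr ℂ fun p => ∑ i', Z i' p.1 • J.vec i' p.2

variable (rows) in
/-- Matrices on the multiplicity spaces which preserve the lengths of the strings. -/
def IsBlockDiag (Z : Matrix (Fin s) (Fin s) ℂ) : Prop := ∀ i i', rows i ≠ rows i' → Z i i' = 0

theorem lift_vec {Z : Matrix (Fin s) (Fin s) ℂ} (hZ : IsBlockDiag rows Z) (i : Fin s) (j : ℕ) :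
    J.lift Z (J.vec i j) = ∑ i', Z i' i • J.vec i' j := by
  by_cases hj : j < rows i
  · rw [vec, dif_pos hj, lift, Module.Basis.constr_basis]
  · rw [J.vec_eq_zero (not_lt.1 hj), map_zero, Finset.sum_eq_zero]
    intro i' _
    by_cases h : rows i' = rows i
    · rw [J.vec_eq_zero (by omega), smul_zero]
    · rw [hZ _ _ h, zero_smul]

theorem commute_lift {Z : Matrix (Fin s) (Fin s) ℂ} (hZ : IsBlockDiag rows Z) :
    Commute e (J.lift Z) := by
  refine J.ext_vec fun i j _ => ?_
  rw [Module.End.mul_apply, Module.End.mul_apply, e_vec, J.lift_vec hZ, J.lift_vec hZ, map_sum]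
  simp [e_vec]

theorem lead_lift {Z : Matrix (Fin s) (Fin s) ℂ} (hZ : IsBlockDiag rows Z) :
    J.lead (J.lift Z) = Z := by
  ext i' i
  by_cases h : rows i' = rows i
  · rw [J.lead_of_eq _ h, J.lift_vec hZ, map_sum, Finset.sum_eq_single i']
    · rw [map_smul, co_vec J _ _ (J.pos i')]; simp
    · intro k _ hk
      rw [map_smul, co_vec J _ _ (J.pos i')]; simp [hk.symm]
    · simp
  · rw [J.lead_of_ne _ h, hZ _ _ h]

theorem lift_mul {Z Y : Matrix (Fin s) (Fin s) ℂ} (hZ : IsBlockDiag rows Z)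
    (hY : IsBlockDiag rows Y) : J.lift (Z * Y) = J.lift Z * J.lift Y := by
  have hZY : IsBlockDiag rows (Z * Y) := by
    intro i i' h
    rw [Matrix.mul_apply]
    refine Finset.sum_eq_zero fun k _ => ?_
    by_cases hk : rows i = rows k
    · rw [hY _ _ (by rwa [← hk]), mul_zero]
    · rw [hZ _ _ hk, zero_mul]
  refine J.ext_vec fun i j _ => ?_
  rw [Module.End.mul_apply, J.lift_vec hZY, J.lift_vec hY, map_sum]
  simp only [map_smul, J.lift_vec hZ, Finset.smul_sum, Matrix.mul_apply, Finset.sum_smul]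
  rw [Finset.sum_comm]
  refine Finset.sum_congr rfl fun k _ => Finset.sum_congr rfl fun l _ => ?_
  rw [smul_smul, mul_comm]

theorem isBlockDiag_lead (y : Module.End ℂ V) : IsBlockDiag rows (J.lead y) :=
  fun _ _ h => J.lead_of_ne y h

end JordanBasis

end SpinOrbit

/-! ### Adjoints and the forms on the multiplicity spaces -/

namespace SpinOrbit

open Matrix QuadraticMap

section Adjoint

variable {V : Type*} [AddCommGroup V] [Module ℂ V] [FiniteDimensional ℂ V]
  {Q : QuadraticForm ℂ V} (hQ : (polarBilin Q).Nondegenerate)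

/-- The adjoint of an endomorphism for the polar form. -/
noncomputable def adj (y : Module.End ℂ V) : Module.End ℂ V :=
  LinearMap.BilinForm.leftAdjointOfNondegenerate (polarBilin Q) hQ y

theorem polar_adj_left (y : Module.End ℂ V) (v w : V) :
    polar Q (adj hQ y v) w = polar Q v (y w) :=
  LinearMap.BilinForm.isAdjointPairLeftAdjointOfNondegenerate (polarBilin Q) hQ y v w

theorem polar_adj_right (y : Module.End ℂ V) (v w : V) :
    polar Q v (adj hQ y w) = polar Q (y v) w := by
  rw [polar_comm, polar_adj_left, polar_comm]

include hQ in
omit [FiniteDimensional ℂ V] in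
theorem eq_of_polar {v w : V} (h : ∀ u, polar Q v u = polar Q w u) : v = w := by
  rw [← sub_eq_zero]
  refine hQ.1 _ fun u => ?_
  rw [map_sub, LinearMap.sub_apply, polarBilin_apply_apply, polarBilin_apply_apply, h, sub_self]

theorem adj_eq_of_polar {x y : Module.End ℂ V}
    (h : ∀ v w, polar Q (x v) w = polar Q v (y w)) : adj hQ y = x :=
  LinearMap.ext fun v => eq_of_polar hQ fun u => by rw [polar_adj_left, h]

theorem adj_adj (y : Module.End ℂ V) : adj hQ (adj hQ y) = y :=
  adj_eq_of_polar hQ fun v w => (polar_adj_right hQ y v w).symm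

theorem adj_mul (x y : Module.End ℂ V) : adj hQ (x * y) = adj hQ y * adj hQ x :=
  adj_eq_of_polar hQ fun v w => by
    rw [Module.End.mul_apply, polar_adj_left, polar_adj_left, Module.End.mul_apply]

theorem adj_one : adj hQ 1 = 1 := adj_eq_of_polar hQ fun _ _ => rfl

theorem adj_add (x y : Module.End ℂ V) : adj hQ (x + y) = adj hQ x + adj hQ y :=
  adj_eq_of_polar hQ fun v w => by
    rw [LinearMap.add_apply, polar_add_left, polar_adj_left, polar_adj_left, LinearMap.add_apply,
      polar_add_right]

theorem adj_smul (c : ℂ) (x : Module.End ℂ V) : adj hQ (c • x) = c • adj hQ x :=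
  adj_eq_of_polar hQ fun v w => by
    rw [LinearMap.smul_apply, polar_smul_left, polar_adj_left, LinearMap.smul_apply,
      polar_smul_right]

theorem adj_neg (x : Module.End ℂ V) : adj hQ (-x) = -adj hQ x := by
  have := adj_smul hQ (-1) x
  simpa using this

theorem adj_sub (x y : Module.End ℂ V) : adj hQ (x - y) = adj hQ x - adj hQ y := by
  rw [sub_eq_add_neg, adj_add, adj_neg, sub_eq_add_neg]

theorem adj_pow (x : Module.End ℂ V) (n : ℕ) : adj hQ (x ^ n) = adj hQ x ^ n := by
  induction n with
  | zero => exact adj_one hQ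
  | succ n ih => rw [pow_succ, adj_mul, ih, ← pow_succ']

theorem adj_aeval {x : Module.End ℂ V} (hx : adj hQ x = x) (f : Polynomial ℂ) :
    adj hQ (Polynomial.aeval x f) = Polynomial.aeval x f := by
  induction f using Polynomial.induction_on' with
  | add p q hp hq => rw [map_add, adj_add, hp, hq]
  | monomial n a =>
    rw [Polynomial.aeval_monomial, ← Algebra.smul_def, adj_smul, adj_pow, hx]

/-- Through the form, the adjoint is conjugate to the dual map. -/
theorem det_adj (x : Module.End ℂ V) : LinearMap.det (adj hQ x) = LinearMap.det x := by
  let T := LinearMap.BilinForm.toDual (polarBilin Q) hQ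
  have h : x.dualMap = T ∘ₗ adj hQ x ∘ₗ T.symm := by
    refine LinearMap.ext fun f => ?_
    obtain ⟨v, rfl⟩ := T.surjective f
    refine LinearMap.ext fun w => ?_
    rw [LinearMap.dualMap_apply, LinearMap.comp_apply, LinearMap.comp_apply, LinearEquiv.coe_coe,
      LinearEquiv.coe_coe, LinearEquiv.symm_apply_apply]
    exact (polar_adj_left hQ x v w).symm
  rw [← LinearMap.det_dualMap (f := x), h, LinearMap.det_conj]

theorem commute_adj {e : Module.End ℂ V} (he : adj hQ e = -e) {y : Module.End ℂ V}
    (hy : Commute e y) : Commute e (adj hQ y) := by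
  have := congrArg (adj hQ) hy.eq
  rw [adj_mul, adj_mul, he, mul_neg, neg_mul, neg_inj] at this
  exact this.symm

omit [FiniteDimensional ℂ V] in
theorem commute_aeval {e y : Module.End ℂ V} (hy : Commute e y) (f : Polynomial ℂ) :
    Commute e (Polynomial.aeval y f) := by
  induction f using Polynomial.induction_on' with
  | add p q hp hq => rw [map_add]; exact hp.add_right hq
  | monomial n a =>
    rw [Polynomial.aeval_monomial, ← Algebra.smul_def]
    exact (hy.pow_right n).smul_right a

theorem adj_eq_neg_of_mem_so (e : so Q) : adj hQ (e : Module.End ℂ V) = -e := by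
  refine adj_eq_of_polar hQ fun v w => ?_
  have h : polar Q ((e : Module.End ℂ V) v) w = polar Q v ((-(e : Module.End ℂ V)) w) :=
    (LinearMap.mem_skewAdjointSubmodule (B := polarBilin Q) _).1 e.2 v w
  rw [LinearMap.neg_apply, polar_neg_left, h, LinearMap.neg_apply, polar_neg_right, neg_neg]

end Adjoint

namespace JordanBasis

variable {V : Type*} [AddCommGroup V] [Module ℂ V] [FiniteDimensional ℂ V]
  {Q : QuadraticForm ℂ V} (hQ : (polarBilin Q).Nondegenerate) {e : Module.End ℂ V} {s : ℕ}
  {rows : Fin s → ℕ} (J : JordanBasis e rows) (he : adj hQ e = -e)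

include he in
theorem polar_e_pow (m : ℕ) (v w : V) :
    polar Q ((e ^ m) v) w = (-1) ^ m * polar Q v ((e ^ m) w) := by
  rw [← polar_adj_right hQ, adj_pow, he, neg_pow, Module.End.mul_apply]
  rcases Nat.even_or_odd m with h | h
  · rw [h.neg_one_pow, h.neg_one_pow]; simp
  · rw [h.neg_one_pow, h.neg_one_pow, LinearMap.neg_apply, polar_neg_right]; simp

variable (Q) in
/-- The bilinear forms induced on the multiplicity spaces. -/
noncomputable def form : Matrix (Fin s) (Fin s) ℂ :=
  fun i i' => if rows i = rows i' then polar Q (J.vec i 0) (J.vec i' (rows i - 1)) else 0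

omit [FiniteDimensional ℂ V] in
theorem isBlockDiag_form : IsBlockDiag rows (J.form Q) := fun _ _ h => if_neg h

include he in
theorem polar_vec_eq_sum (i' : Fin s) {v : V} (hv : (e ^ rows i') v = 0) :
    polar Q v (J.vec i' (rows i' - 1)) = ∑ i, J.co i 0 v * J.form Q i i' := by
  have h0 : ∀ i j, 0 < j → polar Q (J.vec i j) (J.vec i' (rows i' - 1)) = 0 := by
    intro i j hj
    obtain ⟨j, rfl⟩ : ∃ k, j = k + 1 := ⟨j - 1, by omega⟩
    have hp := J.pos i'
    have h := polar_e_pow hQ he 1 (J.vec i j) (J.vec i' (rows i' - 1))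
    rw [J.e_pow_vec, J.e_pow_vec, J.vec_eq_zero (i := i') (j := rows i' - 1 + 1) (by omega)] at h
    rw [h]
    simp
  have h1 : ∀ i, rows i < rows i' → polar Q (J.vec i 0) (J.vec i' (rows i' - 1)) = 0 := by
    intro i hi
    have : J.vec i' (rows i' - 1) = (e ^ (rows i' - 1)) (J.vec i' 0) := by
      rw [J.e_pow_vec, zero_add]
    rw [this, ← polar_adj_left hQ, adj_pow, he, neg_pow, Module.End.mul_apply, J.e_pow_vec,
      J.vec_eq_zero (by omega), map_zero]
    simp
  have := J.apply_eq_sum (φ := (polarBilin Q).flip (J.vec i' (rows i' - 1))) h0 hv h1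
  rw [LinearMap.flip_apply, polarBilin_apply_apply] at this
  rw [this]
  refine Finset.sum_congr rfl fun i _ => ?_
  rw [form]
  split_ifs with h
  · rw [h]; rfl
  · rw [mul_zero]

include he in
-- Each of the `rows i - 1` powers of `e` moved across the form costs a sign. Hence the form is
-- symmetric on odd rows and skew on even rows, the source of all differences between them.
theorem form_swap (i i' : Fin s) :
    J.form Q i' i = (-1) ^ (rows i - 1) * J.form Q i i' := by
  rw [form, form]
  by_cases h : rows i = rows i'
  · rw [if_pos h, if_pos h.symm, polar_comm, J.vec_eq_pow i, polar_e_pow hQ he, J.e_pow_vec,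
      zero_add, h]
  · rw [if_neg h, if_neg (Ne.symm h), mul_zero]

include he in
/-- The leading part of the adjoint is the adjoint of the leading part. -/
theorem lead_adj {y : Module.End ℂ V} (hy : Commute e y) :
    (J.lead y)ᵀ * J.form Q = J.form Q * J.lead (adj hQ y) := by
  have hy' := commute_adj hQ he hy
  ext i i'
  rw [Matrix.mul_apply, Matrix.mul_apply]
  by_cases h : rows i = rows i'
  · have h1 := J.polar_vec_eq_sum hQ he i' (J.pow_apply_vec hy i h.le)
    have h2 := J.polar_vec_eq_sum hQ he i (J.pow_apply_vec hy' i' h.ge)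
    have h3 : ∑ k, (J.lead y)ᵀ i k * J.form Q k i' =
        ∑ k, J.co k 0 (y (J.vec i 0)) * J.form Q k i' := by
      refine Finset.sum_congr rfl fun k _ => ?_
      rw [Matrix.transpose_apply]
      by_cases hk : rows k = rows i
      · rw [J.lead_of_eq _ hk]
      · rw [J.isBlockDiag_form k i' (by rwa [← h]), mul_zero, mul_zero]
    have h4 : ∑ k, J.form Q i k * J.lead (adj hQ y) k i' =
        (-1) ^ (rows i - 1) * ∑ k, J.co k 0 (adj hQ y (J.vec i' 0)) * J.form Q k i := by
      rw [Finset.mul_sum]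
      refine Finset.sum_congr rfl fun k _ => ?_
      by_cases hk : rows k = rows i'
      · have hs : ((-1 : ℂ) ^ (rows i - 1)) * ((-1) ^ (rows i - 1)) = 1 := by
          rw [← pow_add, Even.neg_one_pow ⟨_, rfl⟩]
        rw [J.lead_of_eq _ hk, J.form_swap hQ he i k]
        linear_combination -(J.form Q i k * J.co k 0 (adj hQ y (J.vec i' 0))) * hs
      · rw [J.lead_of_ne _ hk, J.isBlockDiag_form k i (by rwa [h]), mul_zero, mul_zero, mul_zero]
    rw [h3, h4, ← h1, ← h2, ← polar_adj_right hQ, J.vec_eq_pow i' (rows i' - 1),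
      J.vec_eq_pow i (rows i - 1), polar_comm _ (adj hQ y (J.vec i' 0)), polar_e_pow hQ he,
      ← mul_assoc, ← pow_add, Even.neg_one_pow ⟨_, rfl⟩, one_mul, ← h,
      ← Module.End.mul_apply, ← Module.End.mul_apply, (hy'.pow_left (rows i - 1)).eq]
  · rw [Finset.sum_eq_zero, Finset.sum_eq_zero]
    · intro k _
      by_cases hk : rows i = rows k
      · rw [J.lead_of_ne _ (by rwa [← hk]), mul_zero]
      · rw [J.isBlockDiag_form i k hk, zero_mul]
    · intro k _
      rw [Matrix.transpose_apply]
      by_cases hk : rows k = rows i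
      · rw [J.isBlockDiag_form k i' (by rwa [hk]), mul_zero]
      · rw [J.lead_of_ne _ hk, zero_mul]

include he in
-- For each length `r`, the combination of ends of strings with coefficients `c` is orthogonal to
-- the kernel of `e ^ r`, so by duality it lies in the image of `e ^ r`. Elements of that image have
-- no coordinate at position `r - 1`.
theorem form_vecMul_injective {c : Fin s → ℂ} (hc : c ᵥ* J.form Q = 0) : c = 0 := by
  classical
  funext i₀
  set r := rows i₀ with hr
  let u : V := ∑ i, (if rows i = r then c i else 0) • J.vec i (r - 1)
  have hr0 : 0 < r := J.pos i₀
  have hu : ∀ w, (e ^ r) w = 0 → polar Q u w = 0 := by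
    intro w hw
    have h1 : ∀ i, rows i = r → polar Q (J.vec i (r - 1)) w =
        ∑ k, J.co k 0 w * J.form Q k i := fun i hi => by
      have h2 := J.polar_vec_eq_sum hQ he i (v := w) (by rw [hi]; exact hw)
      rw [polar_comm, ← h2, hi]
    have h3 : polar Q u w = ∑ i, (if rows i = r then c i else 0) * polar Q (J.vec i (r - 1)) w := by
      change polarBilin Q u w = _
      simp only [u, map_sum, LinearMap.sum_apply, map_smul, LinearMap.smul_apply, smul_eq_mul,
        polarBilin_apply_apply]
    have h4 : ∀ i, (if rows i = r then c i else 0) * polar Q (J.vec i (r - 1)) w =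
        ∑ k, (-1) ^ (r - 1) * (J.co k 0 w * ((if rows k = r then 1 else 0) *
          (c i * J.form Q i k))) := by
      intro i
      by_cases hi : rows i = r
      · rw [if_pos hi, h1 i hi, Finset.mul_sum]
        refine Finset.sum_congr rfl fun k _ => ?_
        by_cases hk : rows k = r
        · rw [if_pos hk, J.form_swap hQ he i k, hi]; ring
        · rw [if_neg hk, J.isBlockDiag_form k i (by rwa [hi])]; ring
      · rw [if_neg hi, zero_mul, Finset.sum_eq_zero]
        intro k _
        by_cases hk : rows k = r
        · rw [J.isBlockDiag_form i k (by rwa [hk])]; ring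
        · rw [if_neg hk]; ring
    rw [h3, Finset.sum_congr rfl fun i _ => h4 i, Finset.sum_comm]
    refine Finset.sum_eq_zero fun k _ => ?_
    rw [← Finset.mul_sum, ← Finset.mul_sum, ← Finset.mul_sum]
    have : ∑ i, c i * J.form Q i k = 0 := congrFun hc k
    rw [this]; ring
  have hfac : polarBilin Q u ∈ LinearMap.range (e ^ r).dualMap := by
    rw [LinearMap.range_dualMap_eq_dualAnnihilator_ker, Submodule.mem_dualAnnihilator]
    exact fun w hw => hu w hw
  obtain ⟨f, hf⟩ := hfac
  obtain ⟨u', rfl⟩ := (LinearMap.BilinForm.toDual (polarBilin Q) hQ).surjective f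
  have hu' : u = ((-1 : ℂ) ^ r) • (e ^ r) u' := by
    refine eq_of_polar hQ fun w => ?_
    have h5 : polar Q u' ((e ^ r) w) = polar Q u w := LinearMap.congr_fun hf w
    rw [polar_smul_left, polar_e_pow hQ he, h5, smul_eq_mul, ← mul_assoc, ← pow_add,
      Even.neg_one_pow ⟨_, rfl⟩, one_mul]
  have h6 : J.co i₀ (r - 1) u = c i₀ := by
    rw [map_sum, Finset.sum_eq_single i₀]
    · rw [map_smul, J.co_vec _ _ (by omega)]; simp [hr]
    · intro i _ hi
      rw [map_smul, J.co_vec _ _ (by omega)]; simp [hi.symm]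
    · simp
  rw [← h6, hu', map_smul, J.co_pow_of_lt _ _ (by omega), smul_zero]; rfl

include he in
theorem isUnit_form : IsUnit (J.form Q) := by
  rw [Matrix.isUnit_iff_isUnit_det, isUnit_iff_ne_zero]
  intro h
  obtain ⟨c, hc, hc'⟩ := Matrix.exists_vecMul_eq_zero_iff.2 h
  exact hc (J.form_vecMul_injective hQ he hc')

end JordanBasis

end SpinOrbit

/-! ### Spectral projections onto the summands of the odd rows -/

namespace SpinOrbit

open Matrix QuadraticMap Polynomial

/-- Polynomials which give the spectral projections of an endomorphism whose eigenvalues are in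
`R` with multiplicities at most `n`. -/
theorem exists_idempotent_polynomials {K : Type*} [Field K] [DecidableEq K] (R : Finset K) {n : ℕ}
    (hn : n ≠ 0) : ∃ f : K → K[X], ∀ μ ∈ R, (f μ).eval μ = 1 ∧
      (∏ ν ∈ R, (X - C ν)) ^ n ∣ (X - C μ) ^ n * f μ ∧
      (∏ ν ∈ R, (X - C ν)) ^ n ∣ f μ * f μ - f μ ∧ ∀ ν ∈ R, ν ≠ μ → (f μ).eval ν = 0 ∧
      (∏ ν ∈ R, (X - C ν)) ^ n ∣ f μ * f ν := by
  have hex : ∀ μ, ∃ a b : K[X], a * (X - C μ) ^ n + b * (∏ ν ∈ R.erase μ, (X - C ν)) ^ n = 1 := by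
    intro μ
    refine IsCoprime.pow (IsCoprime.prod_right fun ν hν => ?_)
    exact Polynomial.isCoprime_X_sub_C_of_isUnit_sub
      (sub_ne_zero.2 (Finset.ne_of_mem_erase hν).symm).isUnit
  choose a b hab using hex
  have hm : ∀ μ ∈ R, (∏ ν ∈ R, (X - C ν)) = (X - C μ) * ∏ ν ∈ R.erase μ, (X - C ν) :=
    fun μ hμ => (Finset.mul_prod_erase R _ hμ).symm
  -- The Bézout coefficient times the complementary factor is 1 modulo `(X - C μ) ^ n` and 0 modulo
  -- the other factors.
  refine ⟨fun μ => b μ * (∏ ν ∈ R.erase μ, (X - C ν)) ^ n, fun μ hμ => ⟨?_, ?_, ?_, ?_⟩⟩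
  · have := congrArg (eval μ) (hab μ)
    simpa [hn] using this
  · rw [hm μ hμ, mul_pow]
    exact ⟨b μ, by ring⟩
  · rw [hm μ hμ, mul_pow]
    exact ⟨-(a μ * b μ), by linear_combination (b μ * (∏ ν ∈ R.erase μ, (X - C ν)) ^ n) * hab μ⟩
  · intro ν hν hνμ
    constructor
    · rw [eval_mul, eval_pow, eval_prod, Finset.prod_eq_zero (Finset.mem_erase.2 ⟨hνμ, hν⟩)
        (by simp), zero_pow hn, mul_zero]
    · have h1 : (X - C μ) ∣ ∏ ν ∈ R.erase ν, (X - C ν) :=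
        Finset.dvd_prod_of_mem (fun ν => X - C ν) (Finset.mem_erase.2 ⟨hνμ.symm, hμ⟩)
      rw [hm μ hμ, mul_pow, mul_mul_mul_comm, mul_comm ((X - C μ) ^ n)]
      exact (mul_dvd_mul_left _ (pow_dvd_pow_of_dvd h1 n)).mul_left _

/-- The determinant of the reflection in the range of an idempotent. -/
theorem det_one_sub_two_smul {V : Type*} [AddCommGroup V] [Module ℂ V] [FiniteDimensional ℂ V]
    {p : Module.End ℂ V} (hp : p * p = p) :
    LinearMap.det (1 - (2 : ℂ) • p) = (-1) ^ Module.finrank ℂ (LinearMap.range p) := by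
  have hpp : ∀ v, p (p v) = p v := fun v => LinearMap.congr_fun hp v
  have hle : LinearMap.range p ≤ (LinearMap.range p).comap (1 - (2 : ℂ) • p) := by
    rintro _ ⟨v, rfl⟩
    refine ⟨-v, ?_⟩
    rw [map_neg, LinearMap.sub_apply, Module.End.one_apply, LinearMap.smul_apply, hpp]
    module
  rw [LinearMap.det_eq_det_mul_det _ _ hle]
  have h1 : (LinearMap.range p).mapQ (LinearMap.range p) (1 - (2 : ℂ) • p) hle = 1 := by
    refine LinearMap.ext fun v => ?_
    obtain ⟨v, rfl⟩ := Submodule.Quotient.mk_surjective _ v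
    rw [Submodule.mapQ_apply, Module.End.one_apply, Submodule.Quotient.eq]
    exact ⟨-(2 : ℂ) • v, by simp⟩
  have h2 : LinearMap.restrict (p := LinearMap.range p) (q := LinearMap.range p)
      (1 - (2 : ℂ) • p) hle = (-1 : ℂ) • 1 := by
    refine LinearMap.ext fun ⟨_, v, rfl⟩ => Subtype.ext ?_
    change p v - (2 : ℂ) • p (p v) = (-1 : ℂ) • p v
    rw [hpp]; module
  rw [h1, h2, LinearMap.det_smul]; simp

namespace JordanBasis

variable {V : Type*} [AddCommGroup V] [Module ℂ V] [FiniteDimensional ℂ V]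
  {Q : QuadraticForm ℂ V} (hQ : (polarBilin Q).Nondegenerate) {e : Module.End ℂ V} {s : ℕ}
  {rows : Fin s → ℕ} (J : JordanBasis e rows) (he : adj hQ e = -e)

theorem aeval_diagonal (d : Fin s → ℂ) (f : ℂ[X]) :
    aeval (Matrix.diagonal d) f = Matrix.diagonal fun i => f.eval (d i) := by
  have h := Polynomial.aeval_algHom_apply (Matrix.diagonalAlgHom ℂ (n := Fin s) (α := ℂ)) d f
  rw [Matrix.diagonalAlgHom_apply, Matrix.diagonalAlgHom_apply] at h
  rw [h]
  congr 1
  funext i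
  have h2 := Polynomial.aeval_algHom_apply (Pi.evalAlgHom ℂ (fun _ : Fin s => ℂ) i) d f
  rw [Pi.evalAlgHom_apply, Pi.evalAlgHom_apply, Polynomial.coe_aeval_eq_eval] at h2
  exact h2.symm

include he in
-- A matrix that is scalar on each multiplicity space is self-adjoint for any form there, so
-- averaging a lift with its adjoint keeps the leading part.
theorem exists_selfAdjoint_lead_eq_diagonal (d : Fin s → ℂ)
    (hd : ∀ i i', rows i = rows i' → d i = d i') :
    ∃ y : Module.End ℂ V, Commute e y ∧ adj hQ y = y ∧ J.lead y = Matrix.diagonal d := by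
  have hD : IsBlockDiag rows (Matrix.diagonal d) := fun i i' h =>
    Matrix.diagonal_apply_ne _ fun h' => h (by rw [h'])
  have hc := J.commute_lift hD
  have h1 : J.lead (adj hQ (J.lift (Matrix.diagonal d))) = Matrix.diagonal d := by
    refine (J.isUnit_form hQ he).mul_left_cancel ?_
    rw [← J.lead_adj hQ he hc, J.lead_lift hD, Matrix.diagonal_transpose]
    ext i i'
    rw [Matrix.diagonal_mul, Matrix.mul_diagonal]
    by_cases h : rows i = rows i'
    · rw [hd i i' h, mul_comm]
    · rw [J.isBlockDiag_form i i' h, mul_zero, zero_mul]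
  refine ⟨(2⁻¹ : ℂ) • (J.lift (Matrix.diagonal d) + adj hQ (J.lift (Matrix.diagonal d))),
    (hc.add_right (commute_adj hQ he hc)).smul_right _, ?_, ?_⟩
  · rw [adj_smul, adj_add, adj_adj, add_comm]
  · rw [lead_smul, lead_add, h1, J.lead_lift hD, ← two_smul ℂ, smul_smul]
    norm_num

include he in
/-- Commuting projections onto pairwise orthogonal `e`-stable subspaces, one for each odd row. -/
theorem exists_projections (hinj : ∀ i i', Odd (rows i) → rows i = rows i' → i = i') :
    ∃ p : Fin s → Module.End ℂ V, ∀ i, Odd (rows i) → Commute e (p i) ∧ adj hQ (p i) = p i ∧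
      p i * p i = p i ∧ J.lead (p i) = Matrix.single i i 1 ∧
      ∀ i', Odd (rows i') → i' ≠ i → p i * p i' = 0 := by
  classical
  -- The value at an odd row differs from the value at every other row: the odd lengths are distinct
  -- and positive, and even rows get 0. A spectral projection at such a value isolates one row.
  let d : Fin s → ℂ := fun i => if Odd (rows i) then (rows i : ℂ) else 0
  have hd1 : ∀ i j, Odd (rows i) → j ≠ i → d j ≠ d i := by
    intro i j hi hji h
    simp only [d, if_pos hi] at h
    split_ifs at h with hj
    · exact hji (hinj i j hi (by exact_mod_cast h.symm)).symm
    · exact (J.pos i).ne (by exact_mod_cast h)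
  obtain ⟨y, hy, hya, hyl⟩ := J.exists_selfAdjoint_lead_eq_diagonal hQ he d
    (fun i i' h => by simp only [d, h])
  let R := Finset.univ.image d
  have hdR : ∀ i, d i ∈ R := fun i => Finset.mem_image_of_mem _ (Finset.mem_univ i)
  -- The polynomial kills the leading part of `y`, so its value at `y` is nilpotent.
  have hnil : IsNilpotent (aeval y (∏ ν ∈ R, (X - C ν))) := by
    refine J.isNilpotent_of_lead (commute_aeval hy _) ?_
    rw [J.lead_aeval hy, hyl, aeval_diagonal, ← Matrix.diagonal_zero]
    congr 1
    funext i
    rw [eval_prod, Finset.prod_eq_zero (hdR i) (by simp)]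
  obtain ⟨n, hn⟩ := hnil
  obtain ⟨f, hf⟩ := exists_idempotent_polynomials R (Nat.succ_ne_zero n)
  have hzero : ∀ q : ℂ[X], (∏ ν ∈ R, (X - C ν)) ^ (n + 1) ∣ q → aeval y q = 0 := by
    rintro _ ⟨q, rfl⟩
    rw [map_mul, map_pow, pow_succ, hn, zero_mul, zero_mul]
  refine ⟨fun i => aeval y (f (d i)), fun i hi => ⟨commute_aeval hy _, adj_aeval hQ hya _, ?_, ?_,
    fun i' hi' hii' => ?_⟩⟩
  · have := hzero _ (hf _ (hdR i)).2.2.1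
    rwa [map_sub, map_mul, sub_eq_zero] at this
  · rw [J.lead_aeval hy, hyl, aeval_diagonal, ← Matrix.diagonal_single]
    congr 1
    funext j
    by_cases hj : j = i
    · rw [hj, (hf _ (hdR i)).1, Pi.single_eq_same]
    · rw [((hf _ (hdR i)).2.2.2 _ (hdR j) (hd1 i j hi hj)).1, Pi.single_eq_of_ne hj]
  · rw [← map_mul]
    exact hzero _ ((hf _ (hdR i)).2.2.2 _ (hdR i') (hd1 i i' hi hii')).2

/-- The rank of an idempotent is its trace, which the leading part determines. -/
theorem finrank_range_of_lead_eq_single {p : Module.End ℂ V} (hp : Commute e p) (hpp : p * p = p)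
    {i : Fin s} (hl : J.lead p = Matrix.single i i 1) :
    Module.finrank ℂ (LinearMap.range p) = rows i := by
  have h1 := J.trace_eq hp
  have h2 := ((LinearMap.isProj_range_iff_isIdempotentElem p).2 hpp).trace
  rw [hl, Finset.sum_eq_single i, Matrix.single_apply_same, mul_one] at h1
  · rw [h1] at h2
    exact_mod_cast h2.symm
  · intro j _ hj
    rw [Matrix.single_apply_of_ne _ _ _ _ _ (by tauto), mul_zero]
  · simp

end JordanBasis

end SpinOrbit

/-! ### Invertible skew endomorphisms on summands without odd rows -/

namespace SpinOrbit

open Matrix QuadraticMap Polynomial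

/-- A symmetric matrix with the same kernel as a given idempotent. -/
theorem exists_isSymm_of_isIdempotentElem {n : ℕ} {M : Matrix (Fin n) (Fin n) ℂ}
    (hM : M * M = M) : ∃ S : Matrix (Fin n) (Fin n) ℂ, Sᵀ = S ∧ S * M = S ∧
      ∀ v, S *ᵥ v = 0 → M *ᵥ v = 0 := by
  let f := Matrix.toLin' M
  let b := Module.finBasis ℂ (LinearMap.range f)
  let B := LinearMap.toMatrix' (b.equivFun.toLinearMap ∘ₗ f.rangeRestrict)
  let A := LinearMap.toMatrix' ((LinearMap.range f).subtype ∘ₗ b.equivFun.symm.toLinearMap)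
  have hAB : A * B = M := by
    rw [← LinearMap.toMatrix'_comp]
    conv_rhs => rw [← LinearMap.toMatrix'_toLin' M]
    congr 1
    refine LinearMap.ext fun v => ?_
    simp [f]
  have hBA : B * A = 1 := by
    rw [← LinearMap.toMatrix'_comp, ← LinearMap.toMatrix'_one]
    congr 1
    refine LinearMap.ext fun v => ?_
    obtain ⟨w, hw⟩ := (b.equivFun.symm v).2
    have h1 : f.rangeRestrict (b.equivFun.symm v : Fin n → ℂ) = b.equivFun.symm v := by
      refine Subtype.ext ?_
      change f (b.equivFun.symm v : Fin n → ℂ) = _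
      rw [← hw]
      simp only [f, Matrix.toLin'_apply, Matrix.mulVec_mulVec, hM]
    change b.equivFun (f.rangeRestrict (b.equivFun.symm v : Fin n → ℂ)) = v
    rw [h1, LinearEquiv.apply_symm_apply]
  -- This uses the rank factorisation `M = A * B` with `B * A = 1`; multiplication by `Aᵀ` recovers
  -- `B` from `Bᵀ * B`, so no kernel is added.
  refine ⟨Bᵀ * B, by rw [Matrix.transpose_mul, Matrix.transpose_transpose], ?_, fun v hv => ?_⟩
  · rw [← hAB, Matrix.mul_assoc, ← Matrix.mul_assoc B, hBA, Matrix.one_mul]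
  · have h1 : Aᵀ * (Bᵀ * B) = B := by
      rw [← Matrix.mul_assoc, ← Matrix.transpose_mul, hBA, Matrix.transpose_one, Matrix.one_mul]
    rw [← hAB, ← Matrix.mulVec_mulVec, ← h1, ← Matrix.mulVec_mulVec, hv, Matrix.mulVec_zero,
      Matrix.mulVec_zero]

/-- The previous construction is applied to the part `P * D r` on the rows of each length `r`; the
sum of the results respects the blocks. -/
theorem IsBlockDiag.exists_isSymm {s : ℕ} {rows : Fin s → ℕ} {P : Matrix (Fin s) (Fin s) ℂ}
    (hP : JordanBasis.IsBlockDiag rows P) (hPP : P * P = P) :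
    ∃ S : Matrix (Fin s) (Fin s) ℂ, JordanBasis.IsBlockDiag rows S ∧ Sᵀ = S ∧ S * P = S ∧
      ∀ v, S *ᵥ v = 0 → P *ᵥ v = 0 := by
  classical
  let D : ℕ → Matrix (Fin s) (Fin s) ℂ := fun r =>
    Matrix.diagonal fun i => if rows i = r then 1 else 0
  have hDP : ∀ r, D r * P = P * D r := by
    intro r
    ext i j
    rw [Matrix.diagonal_mul, Matrix.mul_diagonal]
    by_cases h : rows i = rows j
    · rw [h, mul_comm]
    · rw [hP i j h, mul_zero, zero_mul]
  have hDD : ∀ r, D r * D r = D r := by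
    intro r
    rw [Matrix.diagonal_mul_diagonal]
    congr 1
    funext i
    simp
  have hid : ∀ r, P * D r * (P * D r) = P * D r := by
    intro r
    rw [Matrix.mul_assoc, ← Matrix.mul_assoc (D r), hDP, Matrix.mul_assoc, hDD,
      ← Matrix.mul_assoc, hPP]
  choose S hS1 hS2 hS3 using fun r => exists_isSymm_of_isIdempotentElem (hid r)
  have hcol : ∀ r i j, rows j ≠ r → S r i j = 0 := by
    intro r i j hj
    rw [← hS2 r, ← Matrix.mul_assoc, Matrix.mul_diagonal, if_neg hj, mul_zero]
  have hrow : ∀ r i j, rows i ≠ r → S r i j = 0 := by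
    intro r i j hi
    rw [← hS1 r, Matrix.transpose_apply, hcol r j i hi]
  let T := ∑ r ∈ Finset.univ.image rows, S r
  have hT : ∀ i j, T i j = S (rows i) i j := by
    intro i j
    refine (Matrix.sum_apply i j _ S).trans ?_
    rw [Finset.sum_eq_single (rows i)]
    · exact fun r _ hr => hrow r i j hr.symm
    · intro h
      exact absurd (Finset.mem_image_of_mem rows (Finset.mem_univ i)) h
  refine ⟨T, fun i j hij => by rw [hT, hcol _ _ _ (Ne.symm hij)], ?_, ?_, fun v hv => ?_⟩
  · rw [Matrix.transpose_sum]
    exact Finset.sum_congr rfl fun r _ => hS1 r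
  · rw [Finset.sum_mul]
    refine Finset.sum_congr rfl fun r _ => ?_
    have h1 : P * D r * P = P * D r := by rw [Matrix.mul_assoc, hDP, ← Matrix.mul_assoc, hPP]
    rw [← hS2 r, Matrix.mul_assoc, h1]
  · have h1 : ∀ r, S r *ᵥ v = 0 := by
      intro r
      funext i
      by_cases hi : rows i = r
      · have := congrFun hv i
        subst hi
        simpa [Matrix.mulVec, dotProduct, hT] using this
      · simp [Matrix.mulVec, dotProduct, hrow r i _ hi]
    funext i
    have h2 := congrFun (hS3 (rows i) v (h1 _)) i
    rw [Pi.zero_apply] at h2 ⊢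
    rw [← h2, Matrix.mulVec, Matrix.mulVec, dotProduct, dotProduct]
    refine Finset.sum_congr rfl fun j _ => ?_
    rw [Matrix.mul_diagonal]
    by_cases h : rows j = rows i
    · rw [if_pos h, mul_one]
    · rw [hP i j (Ne.symm h), zero_mul, zero_mul, zero_mul]

/-- The isometry `u = (1 + n) (1 + n*)⁻¹` attached to a normal endomorphism `n`. -/
structure IsCayley {V : Type*} [AddCommGroup V] [Module ℂ V] [FiniteDimensional ℂ V]
    {Q : QuadraticForm ℂ V} (hQ : (polarBilin Q).Nondegenerate) (n u : Module.End ℂ V) : Prop where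
  normal : Commute n (adj hQ n)
  det_ne_zero : LinearMap.det (1 + n) ≠ 0
  mul_eq : u * (1 + adj hQ n) = 1 + n

theorem isUnit_of_injective {V : Type*} [AddCommGroup V] [Module ℂ V] [FiniteDimensional ℂ V]
    {y : Module.End ℂ V} (h : ∀ v, y v = 0 → v = 0) : IsUnit y := by
  rw [LinearMap.isUnit_iff_ker_eq_bot, LinearMap.ker_eq_bot']
  exact h

theorem det_ne_zero_of_injective {V : Type*} [AddCommGroup V] [Module ℂ V] [FiniteDimensional ℂ V]
    {y : Module.End ℂ V} (h : ∀ v, y v = 0 → v = 0) : LinearMap.det y ≠ 0 :=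
  ((LinearMap.isUnit_iff_isUnit_det y).1 (isUnit_of_injective h)).ne_zero

namespace JordanBasis

variable {V : Type*} [AddCommGroup V] [Module ℂ V] [FiniteDimensional ℂ V]
  {Q : QuadraticForm ℂ V} (hQ : (polarBilin Q).Nondegenerate) {e : Module.End ℂ V} {s : ℕ}
  {rows : Fin s → ℕ} (J : JordanBasis e rows) (he : adj hQ e = -e)

include he in
/-- A projection which does not involve the odd rows carries an invertible skew endomorphism. -/
theorem exists_skew {p : Module.End ℂ V} (hp : Commute e p) (hpp : p * p = p) (hpa : adj hQ p = p)
    (hodd : ∀ i j, Odd (rows j) → J.lead p i j = 0) :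
    ∃ x : Module.End ℂ V, Commute e x ∧ adj hQ x = -x ∧ x * p = x ∧ p * x = x ∧
      ∀ v, (1 - p + x) v = 0 → v = 0 := by
  set P := J.lead p with hPdef
  have hPP : P * P = P := by rw [← J.lead_mul hp hp, hpp]
  have hP : IsBlockDiag rows P := J.isBlockDiag_lead p
  obtain ⟨S, hSb, hSt, hSP, hker⟩ := IsBlockDiag.exists_isSymm hP hPP
  have hβ := J.isUnit_form hQ he
  obtain ⟨Z', hZ'⟩ : ∃ Z' : Matrix (Fin s) (Fin s) ℂ, J.form Q * Z' = S :=
    ⟨(J.form Q)⁻¹ * S, Matrix.mul_nonsing_inv_cancel_left _ _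
      ((Matrix.isUnit_iff_isUnit_det _).1 hβ)⟩
  -- the part of `Z'` respecting the blocks
  let Z : Matrix (Fin s) (Fin s) ℂ := fun i j => if rows i = rows j then Z' i j else 0
  have hZb : IsBlockDiag rows Z := fun i j h => if_neg h
  have hZ : J.form Q * Z = S := by
    ext i j
    rw [Matrix.mul_apply]
    by_cases h : rows i = rows j
    · rw [← hZ', Matrix.mul_apply]
      refine Finset.sum_congr rfl fun k _ => ?_
      by_cases hk : rows k = rows j
      · simp only [Z, if_pos hk]
      · rw [J.isBlockDiag_form i k (by rw [h]; exact Ne.symm hk), zero_mul, zero_mul]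
    · rw [hSb i j h]
      refine Finset.sum_eq_zero fun k _ => ?_
      by_cases hk : rows k = rows j
      · rw [J.isBlockDiag_form i k (by rwa [hk]), zero_mul]
      · rw [hZb k j hk, mul_zero]
  have hSodd : ∀ i j, Odd (rows j) → S i j = 0 := by
    intro i j hj
    rw [← hSP, Matrix.mul_apply]
    exact Finset.sum_eq_zero fun k _ => by rw [hodd k j hj, mul_zero]
  have hc := J.commute_lift hZb
  set z := J.lift Z with hz
  have hzl : J.lead z = Z := J.lead_lift hZb
  -- With `S` symmetric and the form skew on even rows, `Z` is skew for the form; on odd rows, where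
  -- the sign would be wrong, `S` vanishes.
  have hza : J.lead (adj hQ z) = -Z := by
    refine hβ.mul_left_cancel ?_
    rw [← J.lead_adj hQ he hc, hzl, mul_neg, hZ]
    ext i j
    have h1 : (Zᵀ * (J.form Q)ᵀ) i j = S i j := by rw [← Matrix.transpose_mul, hZ, hSt]
    have h2 : (Zᵀ * J.form Q) i j = (-1) ^ (rows j - 1) * (Zᵀ * (J.form Q)ᵀ) i j := by
      rw [Matrix.mul_apply, Matrix.mul_apply, Finset.mul_sum]
      refine Finset.sum_congr rfl fun k _ => ?_
      rw [Matrix.transpose_apply (J.form Q), J.form_swap hQ he j k]; ring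
    rw [h2, h1, Matrix.neg_apply]
    rcases Nat.even_or_odd (rows j) with h | h
    · rw [(Nat.Even.sub_odd (J.pos j) h odd_one).neg_one_pow, neg_one_mul]
    · rw [hSodd i j h, mul_zero, neg_zero]
  have hzc := commute_adj hQ he hc
  have hxc : Commute e (p * (z - adj hQ z) * p) := (hp.mul_right (hc.sub_right hzc)).mul_right hp
  -- Taking the skew part and cutting down by `p` gives an element with leading part `2 P Z P`.
  refine ⟨p * (z - adj hQ z) * p, hxc, ?_, ?_, ?_, ?_⟩
  · rw [adj_mul, adj_mul, hpa, adj_sub, adj_adj]; noncomm_ring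
  · rw [mul_assoc, hpp]
  · rw [← mul_assoc, ← mul_assoc, hpp]
  · have h1c : Commute e (1 - p + p * (z - adj hQ z) * p) :=
      ((Commute.one_right e).sub_right hp).add_right hxc
    have hinj := J.injective_of_lead h1c (fun c hc0 => ?_)
    · intro v hv
      exact hinj (by rw [hv, map_zero])
    · rw [lead_add, lead_sub, lead_one, J.lead_mul (hp.mul_right (hc.sub_right hzc)) hp,
        J.lead_mul hp (hc.sub_right hzc), lead_sub, hzl, hza, ← hPdef] at hc0
      -- Multiplication by `P` splits the kernel equation into `P Z P c = 0` and `P c = c`; pairing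
      -- the first with the form gives `S c = 0`, so `P c = 0`.
      have h2 := congrArg (P *ᵥ ·) hc0
      have h3 : P * (1 - P + P * (Z - -Z) * P) = (2 : ℂ) • (P * Z * P) := by
        rw [mul_add, mul_sub, hPP, mul_one, sub_self, zero_add, ← mul_assoc, ← mul_assoc, hPP,
          sub_neg_eq_add, ← two_smul ℂ Z, Matrix.mul_smul, Matrix.smul_mul]
      have h4 : (P * Z * P) *ᵥ c = 0 := by
        simp only [Matrix.mulVec_mulVec, h3, Matrix.mulVec_zero, Matrix.smul_mulVec] at h2
        exact (smul_eq_zero.1 h2).resolve_left two_ne_zero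
      have h5 : P *ᵥ c = c := by
        have h6 : P * (Z - -Z) * P = (2 : ℂ) • (P * Z * P) := by
          rw [sub_neg_eq_add, ← two_smul ℂ Z, Matrix.mul_smul, Matrix.smul_mul]
        rw [h6, Matrix.add_mulVec, Matrix.smul_mulVec, h4, smul_zero, add_zero, Matrix.sub_mulVec,
          Matrix.one_mulVec, sub_eq_zero] at hc0
        exact hc0.symm
      have h6 : S *ᵥ c = 0 := by
        have h7 : J.form Q * P = Pᵀ * J.form Q := by
          have := J.lead_adj hQ he hp
          rw [hpa] at this; exact this.symm
        have h8 : Pᵀ * S = S := by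
          rw [← hSt, ← Matrix.transpose_mul, hSP]
        rw [← Matrix.mulVec_mulVec, h5] at h4
        have h9 := congrArg (J.form Q *ᵥ ·) h4
        simp only [Matrix.mulVec_mulVec, Matrix.mulVec_zero] at h9
        rwa [← Matrix.mul_assoc, h7, Matrix.mul_assoc, hZ, h8] at h9
      rw [← h5]
      exact hker c h6

end JordanBasis

end SpinOrbit

/-! ### Factorisation into Cayley transforms -/

namespace SpinOrbit

open Matrix QuadraticMap Polynomial

theorem aeval_apply_of_eq_smul {V : Type*} [AddCommGroup V] [Module ℂ V] {y : Module.End ℂ V}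
    {v : V} {c : ℂ} (h : y v = c • v) (f : ℂ[X]) : aeval y f v = f.eval c • v := by
  have hp : ∀ n : ℕ, (y ^ n) v = c ^ n • v := by
    intro n
    induction n with
    | zero => simp
    | succ n ih => rw [pow_succ, Module.End.mul_apply, h, map_smul, ih, smul_smul, pow_succ']
  induction f using Polynomial.induction_on' with
  | add p q hp hq => rw [map_add, LinearMap.add_apply, hp, hq, eval_add, add_smul]
  | monomial n a =>
    rw [Polynomial.aeval_monomial, ← Algebra.smul_def, LinearMap.smul_apply, hp, eval_monomial,
      smul_smul]

theorem Multiset.prod_map_dvd_pow_card {α M : Type*} [CommMonoid M] (f : α → M) (m : M)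
    (t : Multiset α) (h : ∀ a ∈ t, f a ∣ m) : (t.map f).prod ∣ m ^ t.card := by
  induction t using Multiset.induction_on with
  | empty => simp
  | cons a t ih =>
    rw [Multiset.map_cons, Multiset.prod_cons, Multiset.card_cons, pow_succ']
    exact mul_dvd_mul (h a (Multiset.mem_cons_self a t))
      (ih fun b hb => h b (Multiset.mem_cons_of_mem hb))

/-- Every endomorphism is annihilated by a power of a product over its spectrum. -/
theorem exists_prod_pow_aeval_eq_zero {V : Type*} [AddCommGroup V] [Module ℂ V]
    [FiniteDimensional ℂ V] (y : Module.End ℂ V) (R : Finset ℂ)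
    (hR : ∀ μ, (minpoly ℂ y).IsRoot μ → μ ∈ R) :
    ∃ n ≠ 0, aeval y ((∏ ν ∈ R, (X - C ν)) ^ n) = 0 := by
  have hint : IsIntegral ℂ y := Algebra.IsIntegral.isIntegral y
  have h1 := (IsAlgClosed.splits (minpoly ℂ y)).eq_prod_roots_of_monic (minpoly.monic hint)
  have h2 := Multiset.prod_map_dvd_pow_card (fun a => X - C a) (∏ ν ∈ R, (X - C ν))
    (minpoly ℂ y).roots fun a ha => Finset.dvd_prod_of_mem (fun ν => X - C ν)
      (hR a (Polynomial.isRoot_of_mem_roots ha))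
  rw [← h1] at h2
  obtain ⟨q, hq⟩ := h2.trans (pow_dvd_pow _ (Nat.le_succ _))
  exact ⟨_, Nat.succ_ne_zero _, by rw [hq, map_mul, minpoly.aeval, zero_mul]⟩

theorem det_ne_zero_of_mul_eq_one {V : Type*} [AddCommGroup V] [Module ℂ V]
    {x y : Module.End ℂ V} (h : x * y = 1) : LinearMap.det y ≠ 0 := by
  intro h0
  have := congrArg LinearMap.det h
  rw [map_mul, h0, mul_zero, map_one] at this
  exact zero_ne_one this

/-- The Cayley transform of an isometry without eigenvalue `-1`. -/
theorem exists_isCayley_of_isometry {V : Type*} [AddCommGroup V] [Module ℂ V]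
    [FiniteDimensional ℂ V] {Q : QuadraticForm ℂ V} (hQ : (polarBilin Q).Nondegenerate)
    {e g : Module.End ℂ V} (hge : Commute e g) (hg : adj hQ g * g = 1)
    (hinj : ∀ v, (1 + g) v = 0 → v = 0) : ∃ n, Commute e n ∧ IsCayley hQ n g := by
  obtain ⟨U, hU⟩ := isUnit_of_injective hinj
  have hg' : g * adj hQ g = 1 := mul_eq_one_comm.1 hg
  set W : Module.End ℂ V := ((U⁻¹ : (Module.End ℂ V)ˣ) : Module.End ℂ V) with hW
  have hUW : (1 + g) * W = 1 := by rw [← hU]; exact U.mul_inv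
  have hWU : W * (1 + g) = 1 := by rw [← hU]; exact U.inv_mul
  have hgW : Commute g W := by
    have : Commute g (U : Module.End ℂ V) := by
      rw [hU]; exact (Commute.one_right g).add_right (Commute.refl g)
    exact this.units_inv_right
  have heW : Commute e W := by
    have : Commute e (U : Module.End ℂ V) := by
      rw [hU]; exact (Commute.one_right e).add_right hge
    exact this.units_inv_right
  have hWa : adj hQ W * adj hQ g = W := by
    have h1 := congrArg (adj hQ) hUW
    rw [adj_mul, adj_add, adj_one] at h1
    calc adj hQ W * adj hQ g = adj hQ W * adj hQ g * ((1 + g) * W) := by rw [hUW, mul_one]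
      _ = adj hQ W * (adj hQ g + adj hQ g * g) * W := by noncomm_ring
      _ = W := by rw [hg, add_comm, h1, one_mul]
  -- The classical transform (g - 1)(1 + g)⁻¹ is skew, so `1 + n*` is `1 - n`; the next two
  -- identities exhibit `g` as the quotient.
  have hn : adj hQ ((g - 1) * W) = -((g - 1) * W) := by
    rw [adj_mul, adj_sub, adj_one]
    calc adj hQ W * (adj hQ g - 1) = adj hQ W * adj hQ g - adj hQ W * adj hQ g * g := by
          rw [mul_assoc, hg]; noncomm_ring
      _ = -((g - 1) * W) := by rw [hWa, ← hgW.eq]; noncomm_ring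
  have h2 : 1 + (g - 1) * W = (2 : ℂ) • (g * W) := by
    calc 1 + (g - 1) * W = (1 + g) * W + (g - 1) * W := by rw [hUW]
      _ = g * W + g * W := by noncomm_ring
      _ = _ := (two_smul ℂ _).symm
  have h3 : 1 - (g - 1) * W = (2 : ℂ) • W := by
    calc 1 - (g - 1) * W = (1 + g) * W - (g - 1) * W := by rw [hUW]
      _ = W + W := by noncomm_ring
      _ = _ := (two_smul ℂ _).symm
  refine ⟨(g - 1) * W, (hge.sub_right (Commute.one_right e)).mul_right heW, ?_, ?_, ?_⟩
  · rw [hn]; exact (Commute.refl _).neg_right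
  · rw [h2]
    refine det_ne_zero_of_mul_eq_one (x := (2⁻¹ : ℂ) • ((1 + g) * adj hQ g)) ?_
    rw [smul_mul_smul_comm, mul_assoc, ← mul_assoc (adj hQ g), hg, one_mul, hUW]
    norm_num
  · rw [hn, ← sub_eq_add_neg, h3, h2, mul_smul_comm]

namespace JordanBasis

variable {V : Type*} [AddCommGroup V] [Module ℂ V] [FiniteDimensional ℂ V]
  {Q : QuadraticForm ℂ V} (hQ : (polarBilin Q).Nondegenerate) {e : Module.End ℂ V} {s : ℕ}
  {rows : Fin s → ℕ} (J : JordanBasis e rows) (he : adj hQ e = -e)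
  (hinj : ∀ i i', Odd (rows i) → rows i = rows i' → i = i')

omit [FiniteDimensional ℂ V] in
include hinj in
theorem eq_zero_of_isBlockDiag {Z : Matrix (Fin s) (Fin s) ℂ} (hZ : IsBlockDiag rows Z) {i j : Fin s}
    (hi : Odd (rows i)) (hij : i ≠ j) : Z i j = 0 := hZ i j fun h => hij (hinj i j hi h)

omit [FiniteDimensional ℂ V] in
include hinj in
theorem lead_mul_self {y z : Module.End ℂ V} (hy : Commute e y) (hz : Commute e z) {i : Fin s}
    (hi : Odd (rows i)) : J.lead (y * z) i i = J.lead y i i * J.lead z i i := by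
  rw [J.lead_mul hy hz, Matrix.mul_apply, Finset.sum_eq_single i]
  · intro k _ hk
    rw [eq_zero_of_isBlockDiag hinj (J.isBlockDiag_lead y) hi hk.symm, zero_mul]
  · simp

include he hinj in
theorem form_self_ne_zero {i : Fin s} (hi : Odd (rows i)) : J.form Q i i ≠ 0 := by
  classical
  intro h
  have := J.form_vecMul_injective hQ he (c := Pi.single i 1) (by
    funext j
    rw [Matrix.single_one_vecMul]
    by_cases hj : i = j
    · rw [← hj]; exact h
    · exact eq_zero_of_isBlockDiag hinj J.isBlockDiag_form hi hj)
  simpa using congrFun this i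

include he hinj in
-- An odd row has multiplicity one, so its nonzero form is a 1 × 1 block and cancels from
-- `lead_adj`.
theorem lead_adj_self {y : Module.End ℂ V} (hy : Commute e y) {i : Fin s} (hi : Odd (rows i)) :
    J.lead (adj hQ y) i i = J.lead y i i := by
  have h := congrFun (congrFun (J.lead_adj hQ he hy) i) i
  rw [Matrix.mul_apply, Matrix.mul_apply, Finset.sum_eq_single i, Finset.sum_eq_single i] at h
  · rw [Matrix.transpose_apply, mul_comm] at h
    exact (mul_left_cancel₀ (J.form_self_ne_zero hQ he hinj hi) h).symm
  · intro k _ hk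
    rw [eq_zero_of_isBlockDiag hinj J.isBlockDiag_form hi hk.symm, zero_mul]
  · simp
  · intro k _ hk
    rw [Matrix.transpose_apply, J.isBlockDiag_lead y k i fun h => hk (hinj i k hi h.symm).symm,
      zero_mul]
  · simp

include he hinj in
/-- An isometry commuting with `e` which acts trivially on the multiplicity spaces of the odd rows
is a product of two Cayley transforms. -/
theorem exists_cayley_factors {g : Module.End ℂ V} (hge : Commute e g) (hg : adj hQ g * g = 1)
    (hodd : ∀ i, Odd (rows i) → J.lead g i i = 1) :
    ∃ n₁ n₂ u₁ u₂ : Module.End ℂ V, Commute e n₁ ∧ Commute e n₂ ∧ IsCayley hQ n₁ u₁ ∧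
      IsCayley hQ n₂ u₂ ∧ g = u₁ * u₂ := by
  classical
  have hg' : g * adj hQ g = 1 := mul_eq_one_comm.1 hg
  -- Since the adjoint of `g` is its inverse, the eigenvalue -2 of the self-adjoint `h` corresponds
  -- to the eigenvalue -1 of `g`. Working with `h` makes the spectral projection self-adjoint.
  set h := g + adj hQ g with hh
  have hgh : Commute g h := (Commute.refl g).add_right (hg'.trans hg.symm)
  have heh : Commute e h := hge.add_right (commute_adj hQ he hge)
  have hha : adj hQ h = h := by rw [hh, adj_add, adj_adj, add_comm]
  -- Both 2 and -2 are included whether or not they are eigenvalues, so that the polynomial for -2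
  -- exists and vanishes at 2.
  let R : Finset ℂ := insert 2 (insert (-2) (minpoly ℂ h).roots.toFinset)
  have h2R : (2 : ℂ) ∈ R := by simp [R]
  have h2R' : (-2 : ℂ) ∈ R := by simp [R]
  obtain ⟨n, hn, hnz⟩ := exists_prod_pow_aeval_eq_zero h R (fun μ hμ => by
    have h0 : minpoly ℂ h ≠ 0 := minpoly.ne_zero (Algebra.IsIntegral.isIntegral h)
    simp only [R, Finset.mem_insert, Multiset.mem_toFinset, Polynomial.mem_roots h0]
    exact Or.inr (Or.inr hμ))
  obtain ⟨f, hf⟩ := exists_idempotent_polynomials R hn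
  obtain ⟨hf1, hf2, hf3, hf4⟩ := hf (-2) h2R'
  have hzero : ∀ q : ℂ[X], (∏ ν ∈ R, (X - C ν)) ^ n ∣ q → aeval h q = 0 := by
    rintro _ ⟨q, rfl⟩
    rw [map_mul, hnz, zero_mul]
  have hne : (2 : ℂ) ≠ -2 := by norm_num
  set p := aeval h (f (-2)) with hp
  have hpp : p * p = p := by
    have := hzero _ hf3
    rwa [map_sub, map_mul, sub_eq_zero] at this
  have hpa : adj hQ p = p := adj_aeval hQ hha _
  have hpe : Commute e p := commute_aeval heh _
  have hpg : Commute g p := commute_aeval hgh _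
  -- On an odd row `g` has leading entry 1, so `h` has leading entry 2, a zero of the polynomial
  -- defining `p`.
  have hpodd : ∀ i j, Odd (rows j) → J.lead p i j = 0 := by
    intro i j hj
    have h1 : Matrix.toLin' (J.lead h) (Pi.single j 1) = (2 : ℂ) • Pi.single j 1 := by
      rw [Matrix.toLin'_apply, Matrix.mulVec_single_one]
      funext k
      by_cases hk : k = j
      · rw [hk, Matrix.col_apply, hh, lead_add, Matrix.add_apply,
          J.lead_adj_self hQ he hinj hge hj, hodd j hj]
        simp; norm_num
      · rw [Matrix.col_apply, J.isBlockDiag_lead h k j fun h => hk (hinj j k hj h.symm).symm]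
        simp [hk]
    have h2 := aeval_apply_of_eq_smul h1 (f (-2))
    have h3 : aeval (Matrix.toLin' (J.lead h)) (f (-2)) = Matrix.toLin' (J.lead p) := by
      rw [hp, J.lead_aeval heh]
      exact Polynomial.aeval_algHom_apply (Matrix.toLinAlgEquiv' (R := ℂ) (n := Fin s)).toAlgHom
        (J.lead h) (f (-2))
    rw [h3, (hf4 2 h2R hne).1, zero_smul, Matrix.toLin'_apply, Matrix.mulVec_single_one] at h2
    exact congrFun h2 i
  obtain ⟨x, hxe, hxa, hxp, hpx, hxinj⟩ := J.exists_skew hQ he hpe hpp hpa hpodd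
  have hww : (1 - 2 * p) * (1 - 2 * p) = 1 := by
    calc (1 - 2 * p) * (1 - 2 * p) = 1 - 4 * p + 4 * (p * p) := by noncomm_ring
      _ = 1 := by rw [hpp]; noncomm_ring
  have hwa : adj hQ (1 - 2 * p) = 1 - 2 * p := by
    rw [two_mul, adj_sub, adj_add, hpa, adj_one]
  have hwe : Commute e (1 - 2 * p) := by
    rw [two_mul]; exact (Commute.one_right e).sub_right (hpe.add_right hpe)
  have hwg : Commute g (1 - 2 * p) := by
    rw [two_mul]; exact (Commute.one_right g).sub_right (hpg.add_right hpg)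
  have happ : ∀ v, p (p v) = p v := fun v => LinearMap.congr_fun hpp v
  -- Changing the sign of `g` on the range of `p` removes the eigenvalue -1: a vector sent to its
  -- negative has `p`-part fixed by `g`, where `h` is 2 and so `p` vanishes; the rest is an
  -- eigenvector of `h` for -2, on which `p` is the identity.
  obtain ⟨n₁, hn₁, hc₁⟩ := exists_isCayley_of_isometry hQ (g := g * (1 - 2 * p))
    (hge.mul_right hwe) (by
      rw [adj_mul, hwa, mul_assoc, ← mul_assoc (adj hQ g), hg, one_mul, hww]) (by
    intro v hv
    have hv' : v + g v - 2 • g (p v) = 0 := by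
      rw [← hv]
      simp [mul_sub, two_mul, two_smul]
      abel
    have hgp : ∀ w, p (g w) = g (p w) := fun w => (LinearMap.congr_fun hpg.eq w).symm
    have hadj : ∀ w, adj hQ g (g w) = w := fun w => LinearMap.congr_fun hg w
    have h1 : g (p v) = p v := by
      have := congrArg p hv'
      rw [map_sub, map_add, map_nsmul, hgp, hgp, happ, map_zero] at this
      rw [← sub_eq_zero, ← neg_eq_zero, ← this, two_smul]
      abel
    have h2 : p v = 0 := by
      have h3 : h (p v) = (2 : ℂ) • p v := by
        have h4 : adj hQ g (p v) = p v := by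
          conv_lhs => rw [← h1]
          rw [hadj]
        rw [hh, LinearMap.add_apply, h1, h4, two_smul]
      have h5 := aeval_apply_of_eq_smul h3 (f (-2))
      rwa [← hp, happ, (hf4 2 h2R hne).1, zero_smul] at h5
    have h3 : g v = -v := by
      rw [h2, map_zero, smul_zero, sub_zero] at hv'
      exact eq_neg_of_add_eq_zero_right hv'
    have h4 : h v = (-2 : ℂ) • v := by
      have h5 : adj hQ g v = -v := by
        have := hadj v
        rw [h3, map_neg] at this
        rw [← this, neg_neg, this]
      rw [hh, LinearMap.add_apply, h3, h5]
      module
    have h5 := aeval_apply_of_eq_smul h4 (f (-2))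
    rw [← hp, hf1, one_smul, h2] at h5
    exact h5.symm)
  -- The numerator `1 - p + x` and the denominator `1 - p - x` differ by a sign on the range of `p`
  -- and agree on its kernel; the quotient is `1 - 2 * p`.
  refine ⟨n₁, -p + x, g * (1 - 2 * p), 1 - 2 * p, hn₁, hpe.neg_right.add_right hxe, hc₁,
    ⟨?_, ?_, ?_⟩, by rw [mul_assoc, hww, mul_one]⟩
  · rw [adj_add, adj_neg, hpa, hxa]
    have hc : Commute p x := hpx.trans hxp.symm
    exact (((Commute.refl p).neg_right.add_right hc.neg_right).neg_left).add_left
      (hc.symm.neg_right.add_right (Commute.refl x).neg_right)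
  · rw [← add_assoc, ← sub_eq_add_neg]
    exact det_ne_zero_of_injective hxinj
  · rw [adj_add, adj_neg, hpa, hxa]
    calc (1 - 2 * p) * (1 + (-p + -x)) = 1 - 3 * p - x + 2 * (p * p) + 2 * (p * x) := by
          noncomm_ring
      _ = 1 + (-p + x) := by rw [hpp, hpx]; noncomm_ring

end JordanBasis

end SpinOrbit

/-! ### The isotropic subspace of right halves, and determinants on it -/

namespace SpinOrbit

open Matrix QuadraticMap CliffordAlgebra

theorem det_one_add_of_isNilpotent {W : Type*} [AddCommGroup W] [Module ℂ W]
    [FiniteDimensional ℂ W] {y : Module.End ℂ W} (hy : IsNilpotent y) :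
    LinearMap.det (1 + y) = 1 := by
  have h1 := hy.neg.charpoly_eq_X_pow_finrank
  have h2 := LinearMap.eval_charpoly (-y) 1
  rw [h1, map_one, sub_neg_eq_add] at h2
  simpa using h2.symm

namespace JordanBasis

variable {V : Type*} [AddCommGroup V] [Module ℂ V] [FiniteDimensional ℂ V]
  {Q : QuadraticForm ℂ V} (hQ : (polarBilin Q).Nondegenerate) {e : Module.End ℂ V} {s : ℕ}
  {rows : Fin s → ℕ} (J : JordanBasis e rows) (he : adj hQ e = -e)
  (hinj : ∀ i i', Odd (rows i) → rows i = rows i' → i = i')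

variable (rows) in
/-- The positions in the right half of the diagram. -/
noncomputable def rightHalf : List (Σ i, Fin (rows i)) :=
  (Finset.univ.filter fun p => rows p.1 ≤ 2 * p.2).toList

theorem nodup_rightHalf : (rightHalf rows).Nodup := Finset.nodup_toList _

theorem mem_rightHalf {p : Σ i, Fin (rows i)} : p ∈ rightHalf rows ↔ rows p.1 ≤ 2 * p.2 := by
  rw [rightHalf, Finset.mem_toList, Finset.mem_filter]; simp

/-- The isotropic subspace spanned by the right half of the Jordan basis. -/
noncomputable abbrev isoSpan : Submodule ℂ V := listSpan J.basis (rightHalf rows)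

omit [FiniteDimensional ℂ V] in
theorem vec_mem_isoSpan {i : Fin s} {j : ℕ} (h : rows i ≤ 2 * j) : J.vec i j ∈ J.isoSpan := by
  by_cases hj : j < rows i
  · rw [vec, dif_pos hj]
    exact mem_listSpan J.basis (mem_rightHalf.2 h)
  · rw [J.vec_eq_zero (not_lt.1 hj)]; exact zero_mem _

omit [FiniteDimensional ℂ V] in
theorem mem_isoSpan_iff {v : V} : v ∈ J.isoSpan ↔ ∀ i j, 2 * j < rows i → J.co i j v = 0 := by
  constructor
  · intro hv i j hj
    have : J.isoSpan ≤ LinearMap.ker (J.co i j) := by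
      refine listSpan_le J.basis ?_
      rintro ⟨i', j'⟩ hp
      have := mem_rightHalf.1 hp
      rw [LinearMap.mem_ker, ← vec_fin, J.co_vec _ _ (by omega), if_neg]
      rintro ⟨rfl, rfl⟩
      simp only at this
      omega
    exact this hv
  · intro h
    rw [← J.sum_co_vec v]
    refine sum_mem fun i _ => sum_mem fun j _ => ?_
    by_cases hj : 2 * (j : ℕ) < rows i
    · rw [h i j hj, zero_smul]; exact zero_mem _
    · exact Submodule.smul_mem _ _ (J.vec_mem_isoSpan (not_lt.1 hj))

include he in
-- All powers of `e` can be moved onto the shorter string, which they kill.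
theorem polar_vec_vec_eq_zero {i i' : Fin s} {j j' : ℕ} (h : min (rows i) (rows i') ≤ j + j') :
    polar Q (J.vec i j) (J.vec i' j') = 0 := by
  rcases min_le_iff.1 h with h | h
  · rw [J.vec_eq_pow i' j', ← polar_adj_left hQ, adj_pow, he, neg_pow, Module.End.mul_apply,
      J.e_pow_vec, J.vec_eq_zero h, map_zero]; simp
  · rw [J.vec_eq_pow i j, polar_e_pow hQ he, J.e_pow_vec, J.vec_eq_zero (j := j' + j) (by omega)]; simp

include he in
theorem polar_basis_rightHalf (p q : Σ i, Fin (rows i)) (hp : p ∈ rightHalf rows)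
    (hq : q ∈ rightHalf rows) : polar Q (J.basis p) (J.basis q) = 0 := by
  obtain ⟨i, j⟩ := p
  obtain ⟨i', j'⟩ := q
  have h1 := mem_rightHalf.1 hp
  have h2 := mem_rightHalf.1 hq
  rw [← vec_fin, ← vec_fin]
  exact J.polar_vec_vec_eq_zero hQ he (by simp only at h1 h2; omega)

include he in
theorem polar_isoSpan {v w : V} (hv : v ∈ J.isoSpan) (hw : w ∈ J.isoSpan) : polar Q v w = 0 := by
  have h1 : ∀ p ∈ rightHalf rows, J.isoSpan ≤ LinearMap.ker (polarBilin Q (J.basis p)) :=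
    fun p hp => listSpan_le J.basis fun q hq => J.polar_basis_rightHalf hQ he p q hp hq
  have h2 : J.isoSpan ≤ LinearMap.ker ((polarBilin Q).flip w) :=
    listSpan_le J.basis fun p hp => h1 p hp hw
  exact h2 hv

include he in
theorem isotropic {v : V} (hv : v ∈ J.isoSpan) : Q v = 0 := by
  have h := J.polar_isoSpan hQ he hv hv
  rw [polar_self] at h
  simpa using h

/-- The span of the basis vectors in the right half of the diagram or in a middle column. -/
noncomputable def perpSpan : Submodule ℂ V :=
  Submodule.span ℂ (Set.range fun p : {p : Σ i, Fin (rows i) // rows p.1 ≤ 2 * p.2 + 1} =>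
    J.basis p)

include he in
-- One inclusion is a check on basis vectors, and the dimensions agree: reversing the strings
-- matches the right half with the middle with the complement of the right half.
theorem orthogonal_isoSpan :
    LinearMap.BilinForm.orthogonal (polarBilin Q) J.isoSpan = J.perpSpan := by
  classical
  symm
  refine Submodule.eq_of_le_of_finrank_eq ?_ ?_
  · refine Submodule.span_le.2 ?_
    rintro _ ⟨⟨⟨i, j⟩, hp⟩, rfl⟩
    rw [SetLike.mem_coe, LinearMap.BilinForm.mem_orthogonal_iff]
    intro w hw
    have : J.isoSpan ≤ LinearMap.ker ((polarBilin Q).flip (J.basis ⟨i, j⟩)) := by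
      refine listSpan_le J.basis ?_
      rintro ⟨i', j'⟩ hq
      have h2 := mem_rightHalf.1 hq
      rw [LinearMap.mem_ker, LinearMap.flip_apply, polarBilin_apply_apply, ← vec_fin, ← vec_fin]
      exact J.polar_vec_vec_eq_zero hQ he (by simp only at hp h2; omega)
    exact this hw
  · have hf1 := finrank_span_eq_card (J.basis.linearIndependent.comp
      (fun p : {p : Σ i, Fin (rows i) // rows p.1 ≤ 2 * p.2 + 1} => p.1) Subtype.val_injective)
    have hf2 := finrank_span_eq_card (J.basis.linearIndependent.comp _
        (List.nodup_iff_injective_get.1 (nodup_rightHalf (rows := rows))))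
    change Module.finrank ℂ J.perpSpan = _ at hf1
    change Module.finrank ℂ J.isoSpan = _ at hf2
    rw [LinearMap.BilinForm.finrank_orthogonal hQ,
      Module.finrank_eq_card_basis J.basis, hf1, hf2, Fintype.card_fin, rightHalf,
      Finset.length_toList, Fintype.card_subtype]
    have h1 : (Finset.univ.filter fun p : Σ i, Fin (rows i) => rows p.1 ≤ 2 * p.2 + 1).card =
        (Finset.univ.filter fun p : Σ i, Fin (rows i) => ¬ rows p.1 ≤ 2 * p.2).card := by
      refine Finset.card_bij' (fun p _ => ⟨p.1, p.2.rev⟩) (fun p _ => ⟨p.1, p.2.rev⟩) ?_ ?_ ?_ ?_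
      · rintro ⟨i, j⟩ h
        have := j.2
        simp only [Finset.mem_filter, Finset.mem_univ, true_and, Fin.val_rev] at h ⊢
        omega
      · rintro ⟨i, j⟩ h
        have := j.2
        simp only [Finset.mem_filter, Finset.mem_univ, true_and, Fin.val_rev] at h ⊢
        omega
      · rintro ⟨i, j⟩ _
        simp
      · rintro ⟨i, j⟩ _
        simp
    rw [h1, ← Finset.card_univ, ← Finset.card_filter_add_card_filter_not (s := Finset.univ)
      (fun p : Σ i, Fin (rows i) => rows p.1 ≤ 2 * p.2)]
    simp

omit [FiniteDimensional ℂ V] in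
-- Commuting with `e`, `y` takes position `j` of row `i` to positions `j + k` of row `i'` with `k ≥
-- 0` and `k ≥ rows i' - rows i`. Hence `2 * j - rows i` cannot decrease, and the right half is
-- where it is nonnegative.
theorem apply_mem_isoSpan {y : Module.End ℂ V} (hy : Commute e y) {v : V} (hv : v ∈ J.isoSpan) :
    y v ∈ J.isoSpan := by
  have : J.isoSpan ≤ J.isoSpan.comap y := by
    refine listSpan_le J.basis ?_
    rintro ⟨i, j⟩ hp
    have hp := mem_rightHalf.1 hp
    simp only at hp
    rw [Submodule.mem_comap, mem_isoSpan_iff, ← vec_fin]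
    intro i' j' hj'
    rcases lt_or_ge j' (j : ℕ) with h | h
    · exact J.co_apply_vec_of_lt hy _ _ h
    · obtain ⟨k, rfl⟩ := Nat.exists_eq_add_of_le' h
      rw [J.co_apply_vec_add hy _ _ _ _ (by omega)]
      exact J.co_eq_zero_of_pow (J.pow_apply_vec hy i le_rfl) _ (by omega)
  exact this hv

omit [FiniteDimensional ℂ V] in
include hinj in
-- The quantity `2 * j - rows i` is -1 on middle vectors. It can stay there only with no shift
-- between rows of equal odd length, that is, through the diagonal leading entry, which is zero
-- here.
theorem apply_mem_isoSpan_of_mem_perpSpan {y : Module.End ℂ V} (hy : Commute e y)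
    (hodd : ∀ i, Odd (rows i) → J.lead y i i = 0) {v : V} (hv : v ∈ J.perpSpan) :
    y v ∈ J.isoSpan := by
  have : J.perpSpan ≤ J.isoSpan.comap y := by
    refine Submodule.span_le.2 ?_
    rintro _ ⟨⟨⟨i, j⟩, hp⟩, rfl⟩
    simp only at hp
    change y (J.basis ⟨i, j⟩) ∈ J.isoSpan
    rw [mem_isoSpan_iff, ← vec_fin]
    intro i' j' hj'
    rcases lt_or_ge j' (j : ℕ) with h | h
    · exact J.co_apply_vec_of_lt hy _ _ h
    · obtain ⟨k, rfl⟩ := Nat.exists_eq_add_of_le' h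
      rw [J.co_apply_vec_add hy _ _ _ _ (by omega)]
      by_cases hk : k + rows i < rows i'
      · exact J.co_eq_zero_of_pow (J.pow_apply_vec hy i le_rfl) _ hk
      · obtain rfl : k = 0 := by omega
        have h1 : rows i' = rows i := by omega
        obtain rfl := hinj i' i ⟨j, by omega⟩ h1
        rw [← J.lead_of_eq y rfl]
        exact hodd _ ⟨j, by omega⟩
  exact this hv

open Classical in
/-- The determinant of an endomorphism on the isotropic subspace, when it preserves it. -/
noncomputable def isoDet (y : Module.End ℂ V) : ℂ :=
  if h : ∀ v ∈ J.isoSpan, y v ∈ J.isoSpan then LinearMap.det (y.restrict h) else 0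

omit [FiniteDimensional ℂ V] in
theorem isoDet_eq_det {y : Module.End ℂ V} (h : ∀ v ∈ J.isoSpan, y v ∈ J.isoSpan) :
    J.isoDet y = LinearMap.det (y.restrict h) := dif_pos h

omit [FiniteDimensional ℂ V] in
theorem isoDet_mul {y z : Module.End ℂ V} (hy : Commute e y) (hz : Commute e z) :
    J.isoDet (y * z) = J.isoDet y * J.isoDet z := by
  rw [J.isoDet_eq_det fun _ => J.apply_mem_isoSpan hy, J.isoDet_eq_det fun _ =>
    J.apply_mem_isoSpan hz, J.isoDet_eq_det fun _ => J.apply_mem_isoSpan (hy.mul_right hz),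
    ← map_mul]
  rfl

omit [FiniteDimensional ℂ V] in
theorem isoDet_one : J.isoDet 1 = 1 := by
  rw [J.isoDet_eq_det fun _ => J.apply_mem_isoSpan (Commute.one_right e),
    ← map_one (LinearMap.det (A := ℂ) (M := J.isoSpan))]
  rfl

theorem isoDet_one_add {y : Module.End ℂ V} (hy : Commute e y) (hn : IsNilpotent y) :
    J.isoDet (1 + y) = 1 := by
  rw [J.isoDet_eq_det fun _ => J.apply_mem_isoSpan ((Commute.one_right e).add_right hy)]
  have h1 : IsNilpotent (LinearMap.restrict (p := J.isoSpan) (q := J.isoSpan) y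
    fun _ hv => J.apply_mem_isoSpan hy hv) := Module.End.isNilpotent.restrict _ hn
  rw [← det_one_add_of_isNilpotent h1]
  rfl

omit [FiniteDimensional ℂ V] in
theorem isoDet_eq_matrix_det {y : Module.End ℂ V} (h : ∀ v ∈ J.isoSpan, y v ∈ J.isoSpan) :
    J.isoDet y = Matrix.det (Matrix.of fun k l =>
      J.basis.coord ((rightHalf rows).get k) (y (J.basis ((rightHalf rows).get l)))) := by
  classical
  have hli : LinearIndependent ℂ fun k : Fin (rightHalf rows).length =>
      J.basis ((rightHalf rows).get k) :=
    J.basis.linearIndependent.comp _ (List.nodup_iff_injective_get.1 nodup_rightHalf)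
  let b : Module.Basis (Fin (rightHalf rows).length) ℂ J.isoSpan := Module.Basis.span hli
  have hb : ∀ k, ((b k : J.isoSpan) : V) = J.basis ((rightHalf rows).get k) := fun k => by
    simp only [b, Module.Basis.span_apply]
  have hco : ∀ k (w : J.isoSpan), b.repr w k = J.basis.coord ((rightHalf rows).get k) w := by
    intro k w
    have : b.coord k = J.basis.coord ((rightHalf rows).get k) ∘ₗ J.isoSpan.subtype := by
      refine b.ext fun l => ?_
      rw [LinearMap.comp_apply, Submodule.subtype_apply, hb, Module.Basis.coord_apply,
        Module.Basis.coord_apply, Module.Basis.repr_self, Module.Basis.repr_self,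
        Finsupp.single_apply, Finsupp.single_apply]
      exact if_congr (List.nodup_iff_injective_get.1 nodup_rightHalf).eq_iff.symm rfl rfl
    exact LinearMap.congr_fun this w
  rw [J.isoDet_eq_det h, ← LinearMap.det_toMatrix b]
  congr 1
  ext k l
  rw [LinearMap.toMatrix_apply, hco, LinearMap.coe_restrict_apply, hb, Matrix.of_apply]

omit [FiniteDimensional ℂ V] in
-- A lift preserves positions with coefficients independent of the position, so on the right half
-- transposing `Z` transposes the whole matrix.
theorem isoDet_lift_transpose {Z : Matrix (Fin s) (Fin s) ℂ} (hZ : IsBlockDiag rows Z)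
    (hZt : IsBlockDiag rows Zᵀ) : J.isoDet (J.lift Zᵀ) = J.isoDet (J.lift Z) := by
  have hent : ∀ {Y : Matrix (Fin s) (Fin s) ℂ} (hY : IsBlockDiag rows Y)
      (p q : Σ i, Fin (rows i)), J.basis.coord p (J.lift Y (J.basis q)) =
        if (p.2 : ℕ) = q.2 then Y p.1 q.1 else 0 := by
    rintro Y hY ⟨i, j⟩ ⟨i', j'⟩
    rw [← co_fin, ← vec_fin, J.lift_vec hY, map_sum, Finset.sum_eq_single i]
    · rw [map_smul, J.co_vec _ _ j.2]
      simp
    · intro k _ hk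
      rw [map_smul, J.co_vec _ _ j.2, if_neg (fun h => hk h.1.symm), smul_zero]
    · simp
  rw [J.isoDet_eq_matrix_det fun _ => J.apply_mem_isoSpan (J.commute_lift hZ),
    J.isoDet_eq_matrix_det fun _ => J.apply_mem_isoSpan (J.commute_lift hZt),
    ← Matrix.det_transpose]
  congr 1
  ext k l
  rw [Matrix.transpose_apply, Matrix.of_apply, Matrix.of_apply, hent hZt, hent hZ]
  exact if_congr eq_comm rfl rfl

/-- The endomorphism differs from the lift of its leading part by a unipotent factor, whose
determinant on the subspace is 1. -/
theorem isoDet_eq_lift {y : Module.End ℂ V} (hy : Commute e y) (hu : IsUnit (J.lead y)) :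
    J.isoDet y = J.isoDet (J.lift (J.lead y)) := by
  have hZ := J.isBlockDiag_lead y
  have hinj : Function.Injective (J.lift (J.lead y)) := by
    refine J.injective_of_lead (J.commute_lift hZ) fun c hc => ?_
    rw [J.lead_lift hZ] at hc
    have := Matrix.mulVec_injective_of_isUnit hu
    exact this (by rw [hc, Matrix.mulVec_zero])
  obtain ⟨U, hU⟩ := isUnit_of_injective fun v hv => hinj (hv.trans (map_zero _).symm)
  have heU : Commute e ((U⁻¹ : (Module.End ℂ V)ˣ) : Module.End ℂ V) := by
    have : Commute e (U : Module.End ℂ V) := by rw [hU]; exact J.commute_lift hZ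
    exact this.units_inv_right
  have hyν : Commute e (((U⁻¹ : (Module.End ℂ V)ˣ) : Module.End ℂ V) * y - 1) :=
    (heU.mul_right hy).sub_right (Commute.one_right e)
  have hnil := J.isNilpotent_of_lead hyν (by
    refine hu.mul_left_cancel ?_
    have h1 : J.lead y * J.lead ((U⁻¹ : (Module.End ℂ V)ˣ) : Module.End ℂ V) = 1 := by
      conv_lhs => rw [← J.lead_lift hZ]
      rw [← J.lead_mul (J.commute_lift hZ) heU, ← hU, Units.mul_inv, lead_one]
    rw [mul_zero, lead_sub, J.lead_mul heU hy, lead_one, mul_sub, ← mul_assoc, h1, one_mul, mul_one,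
      sub_self])
  have h2 : y = J.lift (J.lead y) *
      (1 + (((U⁻¹ : (Module.End ℂ V)ˣ) : Module.End ℂ V) * y - 1)) := by
    rw [add_sub_cancel, ← hU, Units.mul_inv_cancel_left]
  conv_lhs => rw [h2]
  rw [J.isoDet_mul (J.commute_lift hZ)
    ((Commute.one_right e).add_right hyν), J.isoDet_one_add hyν hnil, mul_one]

include he in
-- The determinant depends only on the leading part, and the form intertwines the leading part of
-- the adjoint with the transpose of the leading part. So `g` and its adjoint have equal
-- determinants, and their product is 1.
theorem isoDet_sq {g : Module.End ℂ V} (hge : Commute e g) (hg : adj hQ g * g = 1) :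
    J.isoDet g ^ 2 = 1 := by
  have hga := commute_adj hQ he hge
  have h1 : J.isoDet (adj hQ g) * J.isoDet g = 1 := by
    rw [← J.isoDet_mul hga hge, hg, isoDet_one]
  have hu : J.lead (adj hQ g) * J.lead g = 1 := by rw [← J.lead_mul hga hge, hg, lead_one]
  have hu1 : IsUnit (J.lead g) := IsUnit.of_mul_eq_one_right _ hu
  have hu2 : IsUnit (J.lead (adj hQ g)) := IsUnit.of_mul_eq_one _ hu
  have hZ := J.isBlockDiag_lead g
  have hZt : IsBlockDiag rows (J.lead g)ᵀ := fun i i' h => by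
    rw [Matrix.transpose_apply]; exact hZ _ _ (Ne.symm h)
  have hZa := J.isBlockDiag_lead (adj hQ g)
  have hβ := J.isBlockDiag_form (Q := Q)
  have h2 : J.lift (J.lead g)ᵀ * J.lift (J.form Q) =
      J.lift (J.form Q) * J.lift (J.lead (adj hQ g)) := by
    rw [← J.lift_mul hZt hβ, ← J.lift_mul hβ hZa, J.lead_adj hQ he hge]
  have h3 : J.isoDet (J.lift (J.form Q)) ≠ 0 := by
    have hinj : Function.Injective (J.lift (J.form Q)) := by
      refine J.injective_of_lead (J.commute_lift hβ) fun c hc => ?_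
      rw [J.lead_lift hβ] at hc
      exact Matrix.mulVec_injective_of_isUnit (J.isUnit_form hQ he)
        (by rw [hc, Matrix.mulVec_zero])
    rw [J.isoDet_eq_det fun _ => J.apply_mem_isoSpan (J.commute_lift hβ)]
    refine det_ne_zero_of_injective fun v hv => Subtype.ext (hinj ?_)
    exact (congrArg Subtype.val hv).trans (map_zero _).symm
  have h4 : J.isoDet (J.lift (J.lead g)ᵀ) * J.isoDet (J.lift (J.form Q)) =
      J.isoDet (J.lift (J.form Q)) * J.isoDet (J.lift (J.lead (adj hQ g))) := by
    rw [← J.isoDet_mul (J.commute_lift hZt) (J.commute_lift hβ),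
      ← J.isoDet_mul (J.commute_lift hβ) (J.commute_lift hZa), h2]
  rw [mul_comm] at h4
  have h5 := mul_left_cancel₀ h3 h4
  rw [J.isoDet_lift_transpose hZ hZt, ← J.isoDet_eq_lift hga hu2, ← J.isoDet_eq_lift hge hu1] at h5
  rw [pow_two]
  nth_rewrite 1 [h5]
  exact h1

end JordanBasis

end SpinOrbit

/-! ### The identity component of the centralizer in SO -/

namespace SpinOrbit

open Matrix QuadraticMap

section ModuleTopology

theorem continuous_of_linearMap_moduleTopology {M N : Type*} [AddCommGroup M] [Module ℂ M]
    [TopologicalSpace M] [IsModuleTopology ℂ M] [AddCommGroup N] [Module ℂ N]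
    [TopologicalSpace N] [IsModuleTopology ℂ N] (φ : M →ₗ[ℂ] N) : Continuous φ := by
  have : ContinuousAdd N := IsModuleTopology.toContinuousAdd ℂ N
  exact IsModuleTopology.continuous_of_linearMap φ

theorem continuous_of_forall_toMatrix {X M ι : Type*} [TopologicalSpace X] [Fintype ι]
    [DecidableEq ι] [AddCommGroup M] [Module ℂ M] [TopologicalSpace (Module.End ℂ M)]
    [IsModuleTopology ℂ (Module.End ℂ M)] (b : Module.Basis ι ℂ M) {f : X → Module.End ℂ M}
    (hf : Continuous fun x => LinearMap.toMatrix b b (f x)) : Continuous f := by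
  have : IsModuleTopology ℂ (Matrix ι ι ℂ) := inferInstanceAs (IsModuleTopology ℂ (ι → ι → ℂ))
  have h : f = fun x => Matrix.toLin b b (LinearMap.toMatrix b b (f x)) := by
    funext x
    rw [Matrix.toLin_toMatrix]
  rw [h]
  exact (continuous_of_linearMap_moduleTopology (Matrix.toLin b b).toLinearMap).comp hf

end ModuleTopology

/-- The affine line through `1` in the direction of an endomorphism meets the singular
endomorphisms in finitely many points. -/
theorem finite_det_one_add_smul_eq_zero {V : Type*} [AddCommGroup V] [Module ℂ V]
    [FiniteDimensional ℂ V] (n : Module.End ℂ V) :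
    {t : ℂ | LinearMap.det (1 + t • n) = 0}.Finite := by
  refine ((LinearMap.charpoly n).roots.toFinset.image fun μ => -μ⁻¹).finite_toSet.subset ?_
  intro t ht
  rw [Set.mem_ofPred_eq] at ht
  have ht0 : t ≠ 0 := by
    rintro rfl
    simp at ht
  rw [Finset.mem_coe, Finset.mem_image]
  refine ⟨-t⁻¹, ?_, by simp⟩
  rw [Multiset.mem_toFinset, Polynomial.mem_roots (LinearMap.charpoly_monic n).ne_zero,
    Polynomial.IsRoot.def, LinearMap.eval_charpoly]
  have h1 : algebraMap ℂ (Module.End ℂ V) (-t⁻¹) - n = (-t⁻¹) • (1 + t • n) := by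
    rw [Algebra.algebraMap_eq_smul_one, smul_add, smul_smul]
    have : -t⁻¹ * t = -1 := by field_simp
    rw [this]; module
  rw [h1, LinearMap.det_smul, ht, mul_zero]

variable {V : Type*} [AddCommGroup V] [Module ℂ V] [FiniteDimensional ℂ V]
  {Q : QuadraticForm ℂ V} (hQ : (polarBilin Q).Nondegenerate)

section Centralizer

variable (e : so Q)

/-- The endomorphism underlying an element of the centralizer. -/
def toEnd (g : centralizerSO Q e) : Module.End ℂ V := ((g : SO Q) : V ≃ₗ[ℂ] V)

variable {e}

omit [FiniteDimensional ℂ V] in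
theorem toEnd_injective : Function.Injective (toEnd e) := fun _ _ h =>
  Subtype.ext (Subtype.ext (LinearEquiv.toLinearMap_injective h))

omit [FiniteDimensional ℂ V] in
theorem toEnd_mul (g h : centralizerSO Q e) : toEnd e (g * h) = toEnd e g * toEnd e h := rfl

omit [FiniteDimensional ℂ V] in
theorem toEnd_one : toEnd e 1 = 1 := rfl

omit [FiniteDimensional ℂ V] in
theorem commute_toEnd (g : centralizerSO Q e) : Commute (e : Module.End ℂ V) (toEnd e g) := by
  have h : ((g : SO Q) : V ≃ₗ[ℂ] V).conj (e : Module.End ℂ V) = e := g.2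
  refine LinearMap.ext fun v => ?_
  have := LinearMap.congr_fun h (((g : SO Q) : V ≃ₗ[ℂ] V) v)
  rw [LinearEquiv.conj_apply_apply, LinearEquiv.symm_apply_apply] at this
  exact this.symm

omit [FiniteDimensional ℂ V] in
theorem map_toEnd (g : centralizerSO Q e) (v : V) : Q (toEnd e g v) = Q v := (g : SO Q).2.1 v

omit [FiniteDimensional ℂ V] in
theorem polar_toEnd (g : centralizerSO Q e) (v w : V) :
    polar Q (toEnd e g v) (toEnd e g w) = polar Q v w := by
  rw [polar, ← map_add, map_toEnd, map_toEnd, map_toEnd, polar]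

theorem adj_toEnd_mul (g : centralizerSO Q e) : adj hQ (toEnd e g) * toEnd e g = 1 :=
  LinearMap.ext fun v => eq_of_polar hQ fun u => by
    rw [Module.End.mul_apply, polar_adj_left, polar_toEnd]; rfl

omit [FiniteDimensional ℂ V] in
theorem det_toEnd (g : centralizerSO Q e) : LinearMap.det (toEnd e g) = 1 := by
  have h : LinearEquiv.det ((g : SO Q) : V ≃ₗ[ℂ] V) = 1 := (g : SO Q).2.2
  have := congrArg Units.val h
  rwa [LinearEquiv.coe_det] at this

theorem exists_toEnd_eq {u : Module.End ℂ V} (hu : Commute (e : Module.End ℂ V) u)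
    (hu' : adj hQ u * u = 1) (hd : LinearMap.det u = 1) :
    ∃ g : centralizerSO Q e, toEnd e g = u := by
  let g : V ≃ₗ[ℂ] V := LinearEquiv.ofLinearMap u (adj hQ u) (mul_eq_one_comm.1 hu') hu'
  have hg : (g : V →ₗ[ℂ] V) = u := rfl
  have hgQ : ∀ v, Q (g v) = Q v := by
    intro v
    have h1 : polar Q (u v) (u v) = polar Q v v := by
      rw [← polar_adj_left hQ, ← Module.End.mul_apply, hu']; rfl
    rw [polar_self, polar_self, nsmul_eq_mul, nsmul_eq_mul] at h1
    exact mul_left_cancel₀ (by norm_num) h1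
  refine ⟨⟨⟨g, hgQ, Units.ext (by rw [LinearEquiv.coe_det, hg, hd]; rfl)⟩, ?_⟩, rfl⟩
  refine LinearMap.ext fun v => ?_
  have h1 := LinearMap.congr_fun hu.eq (g.symm v)
  have h2 : u (g.symm v) = v := g.apply_symm_apply v
  change u ((e : Module.End ℂ V) (g.symm v)) = _
  rw [Module.End.mul_apply, Module.End.mul_apply, h2] at h1
  exact h1.symm

omit [FiniteDimensional ℂ V] in
theorem continuous_toEnd [TopologicalSpace (Module.End ℂ V)]
    [h : IsModuleTopology ℂ (Module.End ℂ V)] : Continuous (toEnd e) := by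
  have h1 : Continuous fun g : SO Q => ((g : V ≃ₗ[ℂ] V) : Module.End ℂ V) := by
    rw [h.eq_moduleTopology']
    exact continuous_induced_dom
  exact h1.comp (continuous_subtype_val (p := (· ∈ centralizerSO Q e)))

omit [FiniteDimensional ℂ V] in
theorem continuous_centralizer_iff [TopologicalSpace (Module.End ℂ V)]
    [h : IsModuleTopology ℂ (Module.End ℂ V)] {X : Type*} [TopologicalSpace X]
    {f : X → centralizerSO Q e} : Continuous f ↔ Continuous fun x => toEnd e (f x) := by
  refine ⟨fun hf => continuous_toEnd.comp hf, fun hf => ?_⟩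
  rw [h.eq_moduleTopology'] at hf
  have h1 : Continuous fun x => (f x : SO Q) := continuous_induced_rng.2 hf
  exact h1.subtype_mk fun x => (f x).2

theorem IsCayley.isUnit {n u : Module.End ℂ V} (hc : IsCayley hQ n u) :
    IsUnit (1 + n) := by
  rw [LinearMap.isUnit_iff_isUnit_det, isUnit_iff_ne_zero]
  exact hc.det_ne_zero

theorem IsCayley.isUnit_adj {n u : Module.End ℂ V} (hc : IsCayley hQ n u) :
    IsUnit (1 + adj hQ n) := by
  rw [LinearMap.isUnit_iff_isUnit_det, isUnit_iff_ne_zero, ← adj_one hQ, ← adj_add, det_adj]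
  exact hc.det_ne_zero

/-- Cayley transforms of endomorphisms commuting with `e` are in the centralizer. -/
theorem IsCayley.exists_toEnd_eq {n u : Module.End ℂ V}
    (hn : Commute (e : Module.End ℂ V) n) (hc : IsCayley hQ n u) :
    ∃ g : centralizerSO Q e, toEnd e g = u := by
  have hne := commute_adj hQ (adj_eq_neg_of_mem_so hQ e) hn
  have h1 : Commute (e : Module.End ℂ V) (1 + n) := (Commute.one_right _).add_right hn
  have h2 : Commute (e : Module.End ℂ V) (1 + adj hQ n) := (Commute.one_right _).add_right hne
  have h3 : Commute (1 + n) (1 + adj hQ n) :=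
    (Commute.one_left _).add_left ((Commute.one_right _).add_right hc.normal)
  have h4 := congrArg (adj hQ) hc.mul_eq
  rw [adj_mul, adj_add, adj_one, adj_adj, adj_add, adj_one] at h4
  refine SpinOrbit.exists_toEnd_eq hQ (hc.isUnit_adj.mul_right_cancel ?_) ?_ ?_
  · rw [mul_assoc, hc.mul_eq, mul_assoc, h2.eq, ← mul_assoc, hc.mul_eq, h1.eq]
  · refine hc.isUnit_adj.mul_right_cancel (hc.isUnit.mul_left_cancel ?_)
    rw [mul_assoc, hc.mul_eq, ← mul_assoc, h4, one_mul, h3.eq]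
  · have h5 := congrArg LinearMap.det hc.mul_eq
    rw [map_mul, show 1 + adj hQ n = adj hQ (1 + n) by rw [adj_add, adj_one], det_adj] at h5
    exact mul_right_cancel₀ hc.det_ne_zero (by rw [h5, one_mul])

/-- An isometry which is a Cayley transform lies in the identity component. -/
theorem mem_connectedComponent_of_isCayley {n : Module.End ℂ V}
    (hn : Commute (e : Module.End ℂ V) n) (g : centralizerSO Q e)
    (hc : IsCayley hQ n (toEnd e g)) : g ∈ connectedComponent (1 : centralizerSO Q e) := by
  let _ : TopologicalSpace (Module.End ℂ V) := moduleTopology ℂ _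
  have : IsModuleTopology ℂ (Module.End ℂ V) := ⟨rfl⟩
  have : ContinuousAdd (Module.End ℂ V) := IsModuleTopology.toContinuousAdd ℂ _
  have he := adj_eq_neg_of_mem_so hQ e
  set n' := adj hQ n with hn'
  have hne' : Commute (e : Module.End ℂ V) n' := commute_adj hQ he hn
  -- The parameter is complex because a real segment from 0 to 1 could meet singular values; a
  -- finite set does not disconnect the plane.
  let D : Set ℂ := {t : ℂ | LinearMap.det (1 + t • n) = 0}ᶜ
  have hD : IsPathConnected D :=
    (finite_det_one_add_smul_eq_zero n).countable.isPathConnected_compl_of_one_lt_rank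
      (by rw [Complex.rank_real_complex]; norm_num)
  have hDconn : IsPreconnected (Set.univ : Set D) :=
    have := isPreconnected_iff_preconnectedSpace.1 hD.isConnected.isPreconnected
    isPreconnected_univ
  have hadj : ∀ t : ℂ, adj hQ (1 + t • n) = 1 + t • n' := fun t => by
    rw [adj_add, adj_one, adj_smul]
  let b := Module.finBasis ℂ V
  let A : ℂ → Matrix _ _ ℂ := fun t => LinearMap.toMatrix b b (1 + t • n)
  let B : ℂ → Matrix _ _ ℂ := fun t => LinearMap.toMatrix b b (1 + t • n')
  have hBdet : ∀ t : D, (B t).det ≠ 0 := fun t => by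
    rw [LinearMap.det_toMatrix, ← hadj, det_adj]; exact t.2
  -- This is the Cayley transform of `t • n`, written with matrices so that continuity follows from
  -- the adjugate formula for the inverse.
  let u : D → Module.End ℂ V := fun t => Matrix.toLin b b (A t * (B t)⁻¹)
  have hu : ∀ t : D, u t * (1 + (t : ℂ) • n') = 1 + (t : ℂ) • n := by
    intro t
    have h1 : (1 + (t : ℂ) • n' : Module.End ℂ V) = Matrix.toLin b b (B t) := by
      rw [Matrix.toLin_toMatrix]
    rw [h1, Module.End.mul_eq_comp, ← Matrix.toLin_mul, Matrix.mul_assoc,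
      Matrix.nonsing_inv_mul _ (isUnit_iff_ne_zero.2 (hBdet t)), mul_one, Matrix.toLin_toMatrix]
  have hcay : ∀ t : D, IsCayley hQ ((t : ℂ) • n) (u t) := fun t =>
    ⟨by rw [adj_smul]; exact (hc.normal.smul_left _).smul_right _, t.2,
      by rw [adj_smul]; exact hu t⟩
  have hmk : ∀ t : D, ∃ g : centralizerSO Q e, toEnd e g = u t := fun t =>
    (hcay t).exists_toEnd_eq hQ (hn.smul_right _)
  choose γ hγ using hmk
  have hcont : Continuous γ := by
    rw [continuous_centralizer_iff]
    simp only [hγ]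
    refine continuous_of_forall_toMatrix b ?_
    simp only [u, LinearMap.toMatrix_toLin]
    have hA : ∀ m : Module.End ℂ V, Continuous fun t : D => LinearMap.toMatrix b b (1 + (t : ℂ) • m) := by
      intro m
      simp only [map_add, map_smul]
      exact continuous_const.add (continuous_subtype_val.smul continuous_const)
    refine (hA n).mul ?_
    have hB := hA n'
    simp only [B, Matrix.inv_def, Ring.inverse_eq_inv']
    exact (hB.matrix_det.inv₀ hBdet).smul hB.matrix_adjugate
  have h0 : (0 : ℂ) ∈ D := by simp [D]
  have h1 : (1 : ℂ) ∈ D := by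
    have := hc.det_ne_zero
    simpa [D] using this
  have hγ0 : γ ⟨0, h0⟩ = 1 := toEnd_injective (by
    have := hu ⟨0, h0⟩
    rw [hγ, toEnd_one]
    simpa using this)
  have hγ1 : γ ⟨1, h1⟩ = g := toEnd_injective (by
    refine hc.isUnit_adj.mul_right_cancel ?_
    have := hu ⟨1, h1⟩
    rw [one_smul, one_smul] at this
    rw [hγ, this, hc.mul_eq])
  rw [← hγ0, ← hγ1]
  exact (hDconn.image γ hcont.continuousOn).subset_connectedComponent
    (Set.mem_image_of_mem γ (Set.mem_univ _)) (Set.mem_image_of_mem γ (Set.mem_univ _))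

end Centralizer

section Signs

variable {e : so Q} {s : ℕ} {rows : Fin s → ℕ} (J : JordanBasis (e : Module.End ℂ V) rows)
  (hinj : ∀ i i', Odd (rows i) → rows i = rows i' → i = i')

/-- The action of an element of the centralizer on the multiplicity space of a row. -/
noncomputable def sign (i : Fin s) (g : centralizerSO Q e) : ℂ := J.lead (toEnd e g) i i

include hinj in
omit [FiniteDimensional ℂ V] in
theorem sign_mul {i : Fin s} (hi : Odd (rows i)) (g h : centralizerSO Q e) :
    sign J i (g * h) = sign J i g * sign J i h :=
  J.lead_mul_self hinj (commute_toEnd g) (commute_toEnd h) hi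

omit [FiniteDimensional ℂ V] in
theorem sign_one (i : Fin s) : sign J i (1 : centralizerSO Q e) = 1 := by
  rw [sign, toEnd_one, JordanBasis.lead_one, Matrix.one_apply_eq]

include hinj hQ in
theorem sign_eq_one_or {i : Fin s} (hi : Odd (rows i)) (g : centralizerSO Q e) :
    sign J i g = 1 ∨ sign J i g = -1 := by
  have he := adj_eq_neg_of_mem_so hQ e
  have h1 := J.lead_mul_self hinj (commute_adj hQ he (commute_toEnd g)) (commute_toEnd g) hi
  rw [adj_toEnd_mul, J.lead_one, Matrix.one_apply_eq,
    J.lead_adj_self hQ he hinj (commute_toEnd g) hi] at h1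
  exact mul_self_eq_one_iff.1 h1.symm

omit [FiniteDimensional ℂ V] in
theorem continuous_sign (i : Fin s) : Continuous (sign J i : centralizerSO Q e → ℂ) := by
  let _ : TopologicalSpace (Module.End ℂ V) := moduleTopology ℂ _
  have : IsModuleTopology ℂ (Module.End ℂ V) := ⟨rfl⟩
  have h : sign J i = fun g : centralizerSO Q e =>
      (J.co i 0 ∘ₗ LinearMap.applyₗ (J.vec i 0)) (toEnd e g) := by
    funext g
    rw [sign, J.lead_of_eq _ rfl]; rfl
  rw [h]
  exact (continuous_of_linearMap_moduleTopology _).comp continuous_toEnd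

include hinj hQ in
/-- The identity component of the centralizer consists of the elements with trivial signs. -/
theorem mem_identityComponent_iff (g : centralizerSO Q e) :
    g ∈ identityComponent (centralizerSO Q e) ↔ ∀ i, Odd (rows i) → sign J i g = 1 := by
  have he := adj_eq_neg_of_mem_so hQ e
  constructor
  · intro hg i hi
    -- A continuous function with values in `{1, -1}` is constant on a connected set.
    obtain ⟨y, -, hy⟩ := isPreconnected_connectedComponent.eqOn_const_of_mapsTo
      (S := connectedComponent (1 : centralizerSO Q e)) (T := {1, -1}) (f := sign J i)
      (Set.toFinite _).isDiscrete (continuous_sign J i).continuousOn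
      (fun g _ => sign_eq_one_or hQ J hinj hi g) ⟨1, Or.inl rfl⟩
    rw [hy hg, ← sign_one J i, hy mem_connectedComponent]
    rfl
  · intro hg
    obtain ⟨n₁, n₂, u₁, u₂, hn₁, hn₂, hc₁, hc₂, h⟩ :=
      J.exists_cayley_factors hQ he hinj (commute_toEnd g) (adj_toEnd_mul hQ g) hg
    obtain ⟨g₁, rfl⟩ := hc₁.exists_toEnd_eq hQ hn₁
    obtain ⟨g₂, rfl⟩ := hc₂.exists_toEnd_eq hQ hn₂
    obtain rfl : g = g₁ * g₂ := toEnd_injective h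
    exact mul_mem (mem_connectedComponent_of_isCayley hQ hn₁ g₁ hc₁)
      (mem_connectedComponent_of_isCayley hQ hn₂ g₂ hc₂)

end Signs

end SpinOrbit

/-! ### The identity component of the centralizer in Spin -/

namespace SpinOrbit

open Matrix QuadraticMap CliffordAlgebra

variable {V : Type*} [AddCommGroup V] [Module ℂ V] [FiniteDimensional ℂ V]
  {Q : QuadraticForm ℂ V} (hQ : (polarBilin Q).Nondegenerate)

variable (Q) in
theorem finite_cliffordAlgebra : Module.Finite ℂ (CliffordAlgebra Q) := by
  let _ : Invertible (2 : ℂ) := invertibleOfNonzero two_ne_zero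
  have : Module.Finite ℂ (ExteriorAlgebra ℂ V) :=
    Module.Finite.of_basis (Module.finBasis ℂ V).ExteriorAlgebra
  exact Module.Finite.equiv (equivExterior Q).symm

variable {e : so Q}

theorem toEnd_coverCentralizer (x : centralizerSpin Q e) (v : V) :
    toEnd e (coverCentralizer Q e x) v = (cover Q (x : spinGroup Q) : V ≃ₗ[ℂ] V) v := rfl

theorem spin_mul_ι (x : centralizerSpin Q e) (v : V) :
    ((x : spinGroup Q) : CliffordAlgebra Q) * ι Q v =
      ι Q (toEnd e (coverCentralizer Q e x) v) * ((x : spinGroup Q) : CliffordAlgebra Q) :=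
  cover_spec Q x v

theorem continuous_spin_coe [TopologicalSpace (CliffordAlgebra Q)]
    [h : IsModuleTopology ℂ (CliffordAlgebra Q)] :
    Continuous fun x : centralizerSpin Q e => ((x : spinGroup Q) : CliffordAlgebra Q) := by
  have h1 : Continuous fun x : spinGroup Q => (x : CliffordAlgebra Q) := by
    rw [h.eq_moduleTopology']
    exact continuous_induced_dom
  exact h1.comp (continuous_subtype_val (p := (· ∈ centralizerSpin Q e)))

theorem isInducing_spin_coe [TopologicalSpace (CliffordAlgebra Q)]
    [h : IsModuleTopology ℂ (CliffordAlgebra Q)] :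
    Topology.IsInducing fun x : centralizerSpin Q e => ((x : spinGroup Q) : CliffordAlgebra Q) := by
  have h1 : Topology.IsInducing fun x : spinGroup Q => (x : CliffordAlgebra Q) := by
    refine ⟨?_⟩
    rw [h.eq_moduleTopology']
    rfl
  exact h1.comp (Topology.IsInducing.subtypeVal (t := {x | x ∈ centralizerSpin Q e}))

/-- The isometry is `v ↦ x v x*`, read back in `V` by a linear left inverse of `ι Q`; its entries
are continuous in `x`. -/
theorem continuous_coverCentralizer : Continuous (coverCentralizer Q e) := by
  let _ : TopologicalSpace (Module.End ℂ V) := moduleTopology ℂ _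
  have : IsModuleTopology ℂ (Module.End ℂ V) := ⟨rfl⟩
  let _ : TopologicalSpace (CliffordAlgebra Q) := moduleTopology ℂ _
  have : IsModuleTopology ℂ (CliffordAlgebra Q) := ⟨rfl⟩
  have := finite_cliffordAlgebra Q
  have : IsTopologicalRing (CliffordAlgebra Q) := IsModuleTopology.isTopologicalRing ℂ _
  obtain ⟨π, hπ⟩ := LinearMap.exists_leftInverse_of_injective (ι Q)
    (LinearMap.ker_eq_bot.2 (ι_injective Q))
  have hstar : Continuous fun x : centralizerSpin Q e =>
      star ((x : spinGroup Q) : CliffordAlgebra Q) :=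
    (continuous_of_linearMap_moduleTopology
      ((reverse (Q := Q)) ∘ₗ (involute (Q := Q)).toLinearMap)).comp continuous_spin_coe
  rw [continuous_centralizer_iff]
  refine continuous_of_forall_toMatrix (Module.finBasis ℂ V) (continuous_matrix fun i j => ?_)
  have h : ∀ x : centralizerSpin Q e, LinearMap.toMatrix (Module.finBasis ℂ V)
      (Module.finBasis ℂ V) (toEnd e (coverCentralizer Q e x)) i j =
      ((Module.finBasis ℂ V).coord i ∘ₗ π) (((x : spinGroup Q) : CliffordAlgebra Q) *
        ι Q (Module.finBasis ℂ V j) * star ((x : spinGroup Q) : CliffordAlgebra Q)) := by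
    intro x
    rw [LinearMap.toMatrix_apply, spin_mul_ι, mul_assoc,
      spinGroup.mul_star_self_of_mem (x : spinGroup Q).2, mul_one, LinearMap.comp_apply,
      ← LinearMap.comp_apply π, hπ]
    rfl
  simp only [h]
  exact (continuous_of_linearMap_moduleTopology _).comp
    ((continuous_spin_coe.mul continuous_const).mul hstar)

section Scalar

variable {s : ℕ} {rows : Fin s → ℕ} (J : JordanBasis (e : Module.End ℂ V) rows)
  (hinj : ∀ i i', Odd (rows i) → rows i = rows i' → i = i')

/-- The product of the isotropic vectors in the right half of the Jordan basis. -/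
noncomputable def isoProd : CliffordAlgebra Q := vectorProd Q ((JordanBasis.rightHalf rows).map J.basis)


omit [FiniteDimensional ℂ V] in
theorem isoProd_ne_zero : isoProd (Q := Q) J ≠ 0 :=
  vectorProd_basis_ne_zero J.basis JordanBasis.nodup_rightHalf

omit [FiniteDimensional ℂ V] in
/-- A linear functional which picks the coefficient of the product of isotropic vectors. -/
theorem exists_dual_isoProd_eq_one : ∃ f : Module.Dual ℂ (CliffordAlgebra Q),
    f (isoProd J) = 1 := by
  obtain ⟨f, hf⟩ := Module.Projective.exists_dual_ne_zero ℂ (isoProd_ne_zero J)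
  exact ⟨(f (isoProd J))⁻¹ • f, by
    rw [LinearMap.smul_apply, smul_eq_mul, inv_mul_cancel₀ hf]⟩

include hinj hQ in
/-- The lifts of the elements with trivial signs act on the product of isotropic vectors by a
scalar. -/
theorem exists_mul_isoProd_eq_smul (x : centralizerSpin Q e)
    (hx : coverCentralizer Q e x ∈ identityComponent (centralizerSO Q e)) :
    ∃ c : ℂ, c ^ 4 = 1 ∧ c ^ 2 = J.isoDet (toEnd e (coverCentralizer Q e x)) ∧
      ((x : spinGroup Q) : CliffordAlgebra Q) * isoProd J = c • isoProd J := by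
  have he := adj_eq_neg_of_mem_so hQ e
  set g := coverCentralizer Q e x with hg
  have hginv : ∀ v, ι Q v * ((x : spinGroup Q) : CliffordAlgebra Q) =
      ((x : spinGroup Q) : CliffordAlgebra Q) * ι Q (toEnd e g⁻¹ v) := by
    intro v
    rw [spin_mul_ι, ← hg, ← Module.End.mul_apply, ← toEnd_mul, mul_inv_cancel]; rfl
  have hinv := spinGroup.involute_eq (x : spinGroup Q).2
  have hsign : ∀ i, Odd (rows i) → J.lead (toEnd e g⁻¹ - 1) i i = 0 := by
    intro i hi
    have h1 := (mem_identityComponent_iff hQ J hinj g⁻¹).1 (inv_mem hx) i hi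
    rw [JordanBasis.lead_sub, JordanBasis.lead_one, Matrix.sub_apply, Matrix.one_apply_eq,
      ← sign, h1, sub_self]
  obtain ⟨c, hc⟩ := exists_mul_vectorProd_eq_smul J.basis hQ JordanBasis.nodup_rightHalf
    (fun p hp => J.isotropic hQ he (mem_listSpan J.basis hp))
    (fun p hp q hq => J.polar_basis_rightHalf hQ he p q hp hq) hinv hginv
    (fun v hv => J.apply_mem_isoSpan (commute_toEnd g⁻¹) hv) (fun v hv => by
      have hv' : v ∈ J.perpSpan := by
        rw [← J.orthogonal_isoSpan hQ he, LinearMap.BilinForm.mem_orthogonal_iff]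
        intro w hw
        have : J.isoSpan ≤ LinearMap.ker ((polarBilin Q).flip v) :=
          listSpan_le J.basis fun p hp => by
            rw [LinearMap.mem_ker, LinearMap.flip_apply, polarBilin_apply_apply, polar_comm]
            exact hv p hp
        exact this hw
      exact J.apply_mem_isoSpan_of_mem_perpSpan hinj
        ((commute_toEnd g⁻¹).sub_right (Commute.one_right _)) hsign hv')
  have hc2 := sq_eq_det_of_mul_vectorProd J.basis JordanBasis.nodup_rightHalf
    (fun v hv => J.isotropic hQ he hv) hinv (spinGroup.star_mul_self_of_mem (x : spinGroup Q).2)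
    (toEnd e g) (spin_mul_ι x) (fun v hv => J.apply_mem_isoSpan (commute_toEnd g) hv) hc
  rw [← J.isoDet_eq_det] at hc2
  refine ⟨c, ?_, hc2, hc⟩
  rw [show c ^ 4 = (c ^ 2) ^ 2 by ring, hc2]
  exact J.isoDet_sq hQ he (commute_toEnd g) (adj_toEnd_mul hQ g)

include hQ in
-- The determinant is continuous with values in `{1, -1}`, and it is 1 at the identity.
theorem isoDet_of_mem_identityComponent {g : centralizerSO Q e}
    (hg : g ∈ identityComponent (centralizerSO Q e)) : J.isoDet (toEnd e g) = 1 := by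
  let _ : TopologicalSpace (Module.End ℂ V) := moduleTopology ℂ _
  have : IsModuleTopology ℂ (Module.End ℂ V) := ⟨rfl⟩
  have he := adj_eq_neg_of_mem_so hQ e
  have hcont : Continuous fun g : centralizerSO Q e => J.isoDet (toEnd e g) := by
    simp only [fun g : centralizerSO Q e => J.isoDet_eq_matrix_det fun v =>
      J.apply_mem_isoSpan (commute_toEnd g)]
    refine Continuous.matrix_det (continuous_matrix fun k l => ?_)
    exact (continuous_of_linearMap_moduleTopology
      (J.basis.coord ((JordanBasis.rightHalf rows).get k) ∘ₗ
        LinearMap.applyₗ (J.basis ((JordanBasis.rightHalf rows).get l)))).comp continuous_toEnd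
  obtain ⟨y, -, hy⟩ := isPreconnected_connectedComponent.eqOn_const_of_mapsTo
    (S := connectedComponent (1 : centralizerSO Q e)) (T := {1, -1})
    (f := fun g => J.isoDet (toEnd e g)) (Set.toFinite _).isDiscrete hcont.continuousOn
    (fun g _ => sq_eq_one_iff.1 (J.isoDet_sq hQ he (commute_toEnd g)
      (adj_toEnd_mul hQ g))) ⟨1, Or.inl rfl⟩
  have h1 := hy hg
  have h2 := hy (mem_connectedComponent (x := (1 : centralizerSO Q e)))
  simp only [Function.const_apply, toEnd_one, JordanBasis.isoDet_one] at h1 h2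
  rw [h1, ← h2]

section Covering

variable [Nontrivial V]

variable (e) in
/-- The element `-1` of the centralizer of `e` in the spin group. -/
noncomputable def negOne : centralizerSpin Q e :=
  ⟨⟨-1, neg_one_mem_spinGroup hQ⟩, by
    have : cover Q ⟨-1, neg_one_mem_spinGroup hQ⟩ = 1 :=
      (cover_eq_one_iff hQ _).2 (Or.inr rfl)
    rw [centralizerSpin, Subgroup.mem_comap, this]
    exact one_mem _⟩

theorem coverCentralizer_negOne : coverCentralizer Q e (negOne hQ e) = 1 :=
  Subtype.ext ((cover_eq_one_iff hQ _).2 (Or.inr rfl))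

theorem negOne_mul_coe (x : centralizerSpin Q e) :
    (((negOne hQ e * x : centralizerSpin Q e) : spinGroup Q) : CliffordAlgebra Q) =
      -((x : spinGroup Q) : CliffordAlgebra Q) :=
  neg_one_mul _

include hQ in
theorem coverCentralizer_surjective : Function.Surjective (coverCentralizer Q e) := by
  intro g
  obtain ⟨x, hx⟩ := cover_surjective hQ (g : SO Q)
  exact ⟨⟨x, by rw [centralizerSpin, Subgroup.mem_comap, hx]; exact g.2⟩, Subtype.ext hx⟩

theorem eq_or_eq_negOne_mul {x y : centralizerSpin Q e}
    (h : coverCentralizer Q e x = coverCentralizer Q e y) : x = y ∨ x = negOne hQ e * y := by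
  have h1 : cover Q ((x * y⁻¹ : centralizerSpin Q e) : spinGroup Q) = 1 := by
    have : coverCentralizer Q e (x * y⁻¹) = 1 := by rw [map_mul, map_inv, h, mul_inv_cancel]
    exact congrArg Subtype.val this
  rcases (cover_eq_one_iff hQ _).1 h1 with h2 | h2
  · left
    have : x * y⁻¹ = 1 := Subtype.ext (Subtype.ext h2)
    exact mul_inv_eq_one.1 this
  · right
    have : x * y⁻¹ = negOne hQ e := Subtype.ext (Subtype.ext h2)
    rw [← this, inv_mul_cancel_right]

include hinj hQ in
-- The scalar by which a lift acts has square 1, and replacing the lift by its negative changes the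
-- scalar's sign.
theorem exists_lift_of_mem_identityComponent {g : centralizerSO Q e}
    (hg : g ∈ identityComponent (centralizerSO Q e)) :
    ∃ x : centralizerSpin Q e, coverCentralizer Q e x = g ∧
      ((x : spinGroup Q) : CliffordAlgebra Q) * isoProd J = isoProd J := by
  obtain ⟨x, rfl⟩ := coverCentralizer_surjective hQ g
  obtain ⟨c, -, hc2, hc⟩ := exists_mul_isoProd_eq_smul hQ J hinj x hg
  rw [isoDet_of_mem_identityComponent hQ J hg] at hc2
  rcases sq_eq_one_iff.1 hc2 with rfl | rfl
  · exact ⟨x, rfl, by rw [hc, one_smul]⟩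
  · exact ⟨negOne hQ e * x, by rw [map_mul, coverCentralizer_negOne, one_mul], by
      rw [negOne_mul_coe, neg_mul, hc, neg_one_smul, neg_neg]⟩

include hQ in
-- The only other lift is the negative, which sends the product of isotropic vectors to its
-- negative.
theorem eq_of_mul_isoProd {x y : centralizerSpin Q e}
    (h : coverCentralizer Q e x = coverCentralizer Q e y)
    (hx : ((x : spinGroup Q) : CliffordAlgebra Q) * isoProd J = isoProd J)
    (hy : ((y : spinGroup Q) : CliffordAlgebra Q) * isoProd J = isoProd J) : x = y := by
  rcases eq_or_eq_negOne_mul hQ h with h | h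
  · exact h
  · rw [h, negOne_mul_coe, neg_mul, hy] at hx
    have h2 : (2 : ℂ) • isoProd (Q := Q) J = 0 := by
      rw [two_smul]
      nth_rewrite 1 [← hx]
      exact neg_add_cancel _
    exact absurd ((smul_eq_zero.1 h2).resolve_left two_ne_zero) (isoProd_ne_zero J)

include hinj hQ in
/-- The lift of the identity component which fixes the product of isotropic vectors. -/
theorem exists_continuous_lift : ∃ σ : identityComponent (centralizerSO Q e) →
    centralizerSpin Q e, Continuous σ ∧ ∀ g, coverCentralizer Q e (σ g) = g ∧
      ((σ g : spinGroup Q) : CliffordAlgebra Q) * isoProd J = isoProd J := by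
  let _ : TopologicalSpace (Module.End ℂ V) := moduleTopology ℂ _
  have : IsModuleTopology ℂ (Module.End ℂ V) := ⟨rfl⟩
  let _ : TopologicalSpace (CliffordAlgebra Q) := moduleTopology ℂ _
  have : IsModuleTopology ℂ (CliffordAlgebra Q) := ⟨rfl⟩
  have := finite_cliffordAlgebra Q
  have : IsTopologicalRing (CliffordAlgebra Q) := IsModuleTopology.isTopologicalRing ℂ _
  choose σ hσ1 hσ2 using fun g : identityComponent (centralizerSO Q e) =>
    exists_lift_of_mem_identityComponent hQ J hinj g.2
  refine ⟨σ, ?_, fun g => ⟨hσ1 g, hσ2 g⟩⟩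
  -- Uniqueness of the chosen lift makes the section multiplicative, so continuity at 1 suffices.
  have hmul : ∀ g h, σ (g * h) = σ g * σ h := fun g h => eq_of_mul_isoProd hQ J
    (by rw [map_mul, hσ1, hσ1, hσ1]; rfl) (hσ2 _) (by
      change ((σ g : spinGroup Q) : CliffordAlgebra Q) * ((σ h : spinGroup Q) : CliffordAlgebra Q) *
        isoProd J = isoProd J
      rw [mul_assoc, hσ2, hσ2])
  have hone : ContinuousAt σ 1 := by
    obtain ⟨b, hb, hb0⟩ := exists_anisotropic_orthogonal_basis hQ
    obtain ⟨f, hf⟩ := exists_dual_isoProd_eq_one (Q := Q) J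
    let l := List.ofFn b
    have hl : l.Pairwise fun v w => polar Q v w = 0 := by
      rw [List.pairwise_ofFn]
      exact fun i j hij => hb i j hij.ne
    have hl0 : ∀ v ∈ l, Q v ≠ 0 := by
      intro v hv
      obtain ⟨i, rfl⟩ := (List.mem_ofFn' _ _).1 hv
      exact hb0 i
    -- The intertwiner is continuous in `g` and a multiple of the chosen lift; the functional `f`
    -- reads off the factor, which is nonzero near 1 and can be divided out.
    let T : identityComponent (centralizerSO Q e) → CliffordAlgebra Q := fun g =>
      intertwiner Q (toEnd e (g : centralizerSO Q e)) l
    have hT : ∀ g, T g = f (T g * isoProd J) • ((σ g : spinGroup Q) : CliffordAlgebra Q) := by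
      intro g
      have h1 : ∀ v, T g * ι Q v = ι Q (toEnd e (g : centralizerSO Q e) v) * T g := by
        have h2 : LinearMap.mulLeft ℂ (T g) ∘ₗ ι Q =
            LinearMap.mulRight ℂ (T g) ∘ₗ ι Q ∘ₗ toEnd e (g : centralizerSO Q e) :=
          b.ext fun i => (ι_mul_intertwiner (map_toEnd _) (polar_toEnd _) hl hl0
            ((List.mem_ofFn' _ _).2 ⟨i, rfl⟩)).symm
        exact fun v => LinearMap.congr_fun h2 v
      obtain ⟨d, hd⟩ := eq_smul_of_cover hQ (σ g : spinGroup Q) (T g) (involute_intertwiner _ _)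
        (fun v => by rw [h1, ← hσ1, toEnd_coverCentralizer])
      rw [hd, smul_mul_assoc, hσ2, map_smul, hf, smul_eq_mul, mul_one]
    have hTc : Continuous T := by
      have : ∀ l : List V, Continuous fun g : identityComponent (centralizerSO Q e) =>
          intertwiner Q (toEnd e (g : centralizerSO Q e)) l := by
        intro l
        induction l with
        | nil => exact continuous_const
        | cons v l ih =>
          have h1 : Continuous fun g : identityComponent (centralizerSO Q e) =>
              ι Q (toEnd e (g : centralizerSO Q e) v) :=
            (continuous_of_linearMap_moduleTopology (ι Q ∘ₗ LinearMap.applyₗ v)).comp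
              (continuous_toEnd.comp continuous_subtype_val)
          have h2 : Continuous fun g : identityComponent (centralizerSO Q e) =>
              ι Q (toEnd e (g : centralizerSO Q e) v) *
                intertwiner Q (toEnd e (g : centralizerSO Q e)) l * ι Q v :=
            (h1.mul ih).mul continuous_const
          exact ih.add (h2.const_smul (Q v)⁻¹)
      exact this l
    have hdc : Continuous fun g => f (T g * isoProd J) :=
      (continuous_of_linearMap_moduleTopology f).comp (hTc.mul continuous_const)
    have hd1 : f (T 1 * isoProd J) ≠ 0 := by
      have : T 1 = algebraMap ℂ _ (2 ^ l.length) := intertwiner_id hl0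
      rw [this, ← Algebra.smul_def, map_smul, hf]
      simp
    rw [isInducing_spin_coe.continuousAt_iff]
    have hcont : ContinuousAt (fun g => (f (T g * isoProd J))⁻¹ • T g) 1 :=
      (hdc.continuousAt.inv₀ hd1).smul hTc.continuousAt
    refine hcont.congr ?_
    filter_upwards [hdc.continuousAt.eventually_ne hd1] with g hg
    conv_lhs => rw [hT g]
    rw [smul_mul_assoc, hσ2, map_smul, hf, smul_eq_mul, mul_one, smul_smul, inv_mul_cancel₀ hg,
      one_smul]
    rfl
  rw [continuous_iff_continuousAt]
  intro g
  have h1 : σ = (fun x => σ g * x) ∘ σ ∘ (fun h => g⁻¹ * h) := by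
    funext h
    rw [Function.comp_apply, Function.comp_apply, ← hmul, mul_inv_cancel_left]
  rw [h1]
  refine ContinuousAt.comp
    (SeparatelyContinuousMul.continuous_const_mul (a := σ g)).continuousAt ?_
  refine ContinuousAt.comp (x := g) (f := fun h => g⁻¹ * h) (by rwa [inv_mul_cancel])
    (SeparatelyContinuousMul.continuous_const_mul (a := g⁻¹)).continuousAt

include hinj hQ in
/-- The identity component of the centralizer of `e` in the spin group. -/
theorem mem_identityComponent_spin_iff (x : centralizerSpin Q e) :
    x ∈ identityComponent (centralizerSpin Q e) ↔
      coverCentralizer Q e x ∈ identityComponent (centralizerSO Q e) ∧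
      ((x : spinGroup Q) : CliffordAlgebra Q) * isoProd J = isoProd J := by
  let _ : TopologicalSpace (CliffordAlgebra Q) := moduleTopology ℂ _
  have : IsModuleTopology ℂ (CliffordAlgebra Q) := ⟨rfl⟩
  have := finite_cliffordAlgebra Q
  have : IsTopologicalRing (CliffordAlgebra Q) := IsModuleTopology.isTopologicalRing ℂ _
  constructor
  · intro hx
    have hcov : ∀ y ∈ connectedComponent (1 : centralizerSpin Q e),
        coverCentralizer Q e y ∈ identityComponent (centralizerSO Q e) := by
      intro y hy
      have := continuous_coverCentralizer.image_connectedComponent_subset 1 ⟨y, hy, rfl⟩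
      rwa [map_one] at this
    refine ⟨hcov x hx, ?_⟩
    obtain ⟨f, hf⟩ := exists_dual_isoProd_eq_one (Q := Q) J
    have hval : ∀ y ∈ connectedComponent (1 : centralizerSpin Q e),
        f (((y : spinGroup Q) : CliffordAlgebra Q) * isoProd J) ^ 4 = 1 ∧
        ((y : spinGroup Q) : CliffordAlgebra Q) * isoProd J =
          f (((y : spinGroup Q) : CliffordAlgebra Q) * isoProd J) • isoProd J := by
      intro y hy
      obtain ⟨c, hc4, -, hc⟩ := exists_mul_isoProd_eq_smul hQ J hinj y (hcov y hy)
      rw [hc, map_smul, hf, smul_eq_mul, mul_one]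
      exact ⟨hc4, rfl⟩
    -- The scalar is a fourth root of unity depending continuously on the lift, so it is constant on
    -- the component.
    have hfin : {z : ℂ | z ^ 4 = 1}.Finite := by
      refine (Polynomial.nthRoots 4 (1 : ℂ)).toFinset.finite_toSet.subset fun z hz => ?_
      rw [Finset.mem_coe, Multiset.mem_toFinset, Polynomial.mem_nthRoots (by norm_num)]
      exact hz
    obtain ⟨c, -, hc⟩ := isPreconnected_connectedComponent.eqOn_const_of_mapsTo
      (S := connectedComponent (1 : centralizerSpin Q e)) (T := {z : ℂ | z ^ 4 = 1})
      (f := fun y => f (((y : spinGroup Q) : CliffordAlgebra Q) * isoProd J)) hfin.isDiscrete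
      ((continuous_of_linearMap_moduleTopology f).comp
        (continuous_spin_coe.mul continuous_const)).continuousOn
      (fun y hy => (hval y hy).1) ⟨1, one_pow 4⟩
    have h1 := hc hx
    have h2 := hc (mem_connectedComponent (x := (1 : centralizerSpin Q e)))
    have h3 : (((1 : centralizerSpin Q e) : spinGroup Q) : CliffordAlgebra Q) = 1 := rfl
    simp only [Function.const_apply, h3, one_mul, hf] at h1 h2
    rw [(hval x hx).2, h1, ← h2, one_smul]
  · rintro ⟨hx1, hx2⟩
    -- The continuous section carries the connected identity component below to a connected set
    -- containing both 1 and `x`.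
    obtain ⟨σ, hσc, hσ⟩ := exists_continuous_lift hQ J hinj
    have hpre : PreconnectedSpace (identityComponent (centralizerSO Q e)) :=
      isPreconnected_iff_preconnectedSpace.1
        (isPreconnected_connectedComponent (x := (1 : centralizerSO Q e)))
    have h1 : x = σ ⟨_, hx1⟩ := eq_of_mul_isoProd hQ J (hσ ⟨_, hx1⟩).1.symm hx2 (hσ _).2
    have h2 : (1 : centralizerSpin Q e) = σ 1 := eq_of_mul_isoProd hQ J
      (by rw [(hσ 1).1]; exact map_one _) (one_mul _) (hσ 1).2
    change x ∈ connectedComponent 1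
    rw [h1, h2]
    exact (isPreconnected_univ.image σ hσc.continuousOn).subset_connectedComponent
      (Set.mem_image_of_mem σ (Set.mem_univ _)) (Set.mem_image_of_mem σ (Set.mem_univ _))

end Covering

end Scalar

end SpinOrbit

/-! ### Sign sets, reflections and the commutator pairing -/

namespace SpinOrbit

open Matrix QuadraticMap CliffordAlgebra

variable {V : Type*} [AddCommGroup V] [Module ℂ V] [FiniteDimensional ℂ V]
  {Q : QuadraticForm ℂ V} (hQ : (polarBilin Q).Nondegenerate)

namespace JordanBasis

variable {e : Module.End ℂ V} {s : ℕ} {rows : Fin s → ℕ} (J : JordanBasis e rows)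
  (he : adj hQ e = -e) (hinj : ∀ i i', Odd (rows i) → rows i = rows i' → i = i')

/-- Orthogonal projections commuting with `e` onto pairwise orthogonal subspaces, indexed by the
odd rows. -/
def IsProjectionFamily (p : Fin s → Module.End ℂ V) : Prop :=
  ∀ i, Odd (rows i) → Commute e (p i) ∧ adj hQ (p i) = p i ∧
      p i * p i = p i ∧ J.lead (p i) = Matrix.single i i 1 ∧
      ∀ i', Odd (rows i') → i' ≠ i → p i * p i' = 0

/-- The involution which is `-1` on the ranges of the projections in `S`. -/
noncomputable def reflection (p : Fin s → Module.End ℂ V) (S : Finset (Fin s)) : Module.End ℂ V :=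
  1 - (2 : ℂ) • ∑ i ∈ S, p i

variable {hQ J} {p : Fin s → Module.End ℂ V} (hp : J.IsProjectionFamily hQ p)
  {S : Finset (Fin s)} (hS : ∀ i ∈ S, Odd (rows i))

include hp hS

theorem IsProjectionFamily.reflection_mul {j : Fin s} (hj : Odd (rows j)) :
    reflection p S * p j = if j ∈ S then -p j else p j := by
  have h1 : (∑ i ∈ S, p i) * p j = if j ∈ S then p j else 0 := by
    rw [Finset.sum_mul, ← Finset.sum_ite_eq' S j fun _ => p j]
    refine Finset.sum_congr rfl fun i hi => ?_
    by_cases hij : i = j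
    · rw [if_pos hij, hij, (hp j hj).2.2.1]
    · rw [if_neg hij, (hp i (hS i hi)).2.2.2.2 j hj (Ne.symm hij)]
  rw [reflection, sub_mul, one_mul, smul_mul_assoc, h1]
  split_ifs
  · module
  · simp

theorem IsProjectionFamily.commute_reflection : Commute e (reflection p S) :=
  (Commute.one_right e).sub_right
    ((Commute.sum_right S p e fun i hi => (hp i (hS i hi)).1).smul_right 2)

theorem IsProjectionFamily.adj_reflection : adj hQ (reflection p S) = reflection p S := by
  have h1 : adj hQ (∑ i ∈ S, p i) = ∑ i ∈ S, p i := by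
    have h2 := map_sum (AddMonoidHom.mk' (adj hQ) (adj_add hQ)) p S
    rw [AddMonoidHom.mk'_apply] at h2
    rw [h2]
    exact Finset.sum_congr rfl fun i hi => (hp i (hS i hi)).2.1
  rw [reflection, adj_sub, adj_one, adj_smul, h1]

theorem IsProjectionFamily.reflection_mul_self : reflection p S * reflection p S = 1 := by
  have h1 : reflection p S * ∑ i ∈ S, p i = -∑ i ∈ S, p i := by
    rw [Finset.mul_sum, ← Finset.sum_neg_distrib]
    exact Finset.sum_congr rfl fun i hi => by rw [hp.reflection_mul hS (hS i hi), if_pos hi]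
  conv_lhs => rw [show reflection p S * reflection p S =
    reflection p S * (1 - (2 : ℂ) • ∑ i ∈ S, p i) from rfl, mul_sub, mul_one, mul_smul_comm, h1,
    reflection]
  module

omit hS in
theorem IsProjectionFamily.det_reflection (hS : ∀ i ∈ S, Odd (rows i)) :
    LinearMap.det (reflection p S) = (-1) ^ S.card := by
  induction S using Finset.induction_on with
  | empty => simp [reflection]
  | insert j S hj ih =>
    have hS' : ∀ i ∈ S, Odd (rows i) := fun i hi => hS i (Finset.mem_insert_of_mem hi)
    have hjo := hS j (Finset.mem_insert_self j S)
    have h1 : reflection p (insert j S) = reflection p S * (1 - (2 : ℂ) • p j) := by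
      rw [mul_sub, mul_one, mul_smul_comm, hp.reflection_mul hS' hjo, if_neg hj, reflection,
        reflection, Finset.sum_insert hj]
      module
    obtain ⟨hc, -, hpp, hl, -⟩ := hp j hjo
    rw [h1, map_mul, ih hS', det_one_sub_two_smul hpp, J.finrank_range_of_lead_eq_single hc hpp hl,
      hjo.neg_one_pow, Finset.card_insert_of_notMem hj, pow_succ]

theorem IsProjectionFamily.lead_reflection (j : Fin s) :
    J.lead (reflection p S) j j = if j ∈ S then -1 else 1 := by
  have h1 : J.lead (∑ i ∈ S, p i) j j = if j ∈ S then 1 else 0 := by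
    have h2 := map_sum (AddMonoidHom.mk' J.lead J.lead_add) p S
    simp only [AddMonoidHom.mk'_apply] at h2
    rw [h2, Matrix.sum_apply, ← Finset.sum_ite_eq' S j fun _ => (1 : ℂ)]
    refine Finset.sum_congr rfl fun i hi => ?_
    rw [(hp i (hS i hi)).2.2.2.1, Matrix.single_apply]
    simp
  rw [reflection, lead_sub, lead_one, lead_smul, Matrix.sub_apply, Matrix.smul_apply, h1,
    Matrix.one_apply_eq]
  split_ifs <;> norm_num

end JordanBasis

variable {e : so Q} {s : ℕ} {rows : Fin s → ℕ} {J : JordanBasis (e : Module.End ℂ V) rows}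
  {hQ} {p : Fin s → Module.End ℂ V} (hp : J.IsProjectionFamily hQ p)
  (hinj : ∀ i i', Odd (rows i) → rows i = rows i' → i = i')

open JordanBasis

include hp in
theorem exists_toEnd_eq_reflection {S : Finset (Fin s)} (hS : ∀ i ∈ S, Odd (rows i))
    (heven : Even S.card) : ∃ g : centralizerSO Q e, toEnd e g = reflection p S :=
  exists_toEnd_eq hQ (hp.commute_reflection hS)
    (by rw [hp.adj_reflection hS, hp.reflection_mul_self hS])
    (by rw [hp.det_reflection hS, heven.neg_one_pow])

variable (J) in
open Classical in
/-- The odd rows on whose multiplicity space an element of the centralizer acts by `-1`. -/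
noncomputable def signSet (g : centralizerSO Q e) : Finset (Fin s) :=
  Finset.univ.filter fun i => Odd (rows i) ∧ sign J i g = -1

omit [FiniteDimensional ℂ V] in
theorem mem_signSet {g : centralizerSO Q e} {i : Fin s} :
    i ∈ signSet J g ↔ Odd (rows i) ∧ sign J i g = -1 := by
  rw [signSet, Finset.mem_filter]; simp

omit [FiniteDimensional ℂ V] in
theorem odd_of_mem_signSet {g : centralizerSO Q e} {i : Fin s} (h : i ∈ signSet J g) :
    Odd (rows i) := (mem_signSet.1 h).1

include hp hinj in
-- Multiplying `g` by the reflection in its own sign set makes all signs trivial, hence gives a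
-- product of Cayley transforms, of determinant 1. So the reflection has determinant 1, and this
-- determinant is the parity of the set because each projection has odd rank.
theorem even_card_signSet (g : centralizerSO Q e) : Even (signSet J g).card := by
  have he := adj_eq_neg_of_mem_so hQ e
  set S := signSet J g with hSdef
  have hS : ∀ i ∈ S, Odd (rows i) := fun i hi => odd_of_mem_signSet hi
  have hc := (commute_toEnd g).mul_right (hp.commute_reflection hS)
  obtain ⟨n₁, n₂, u₁, u₂, hn₁, hn₂, hc₁, hc₂, h⟩ := J.exists_cayley_factors hQ he hinj hc (by
    rw [adj_mul, hp.adj_reflection hS, mul_assoc, ← mul_assoc (adj hQ _), adj_toEnd_mul, one_mul,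
      hp.reflection_mul_self hS]) (by
    intro i hi
    rw [J.lead_mul_self hinj (commute_toEnd g) (hp.commute_reflection hS) hi,
      hp.lead_reflection hS, ← sign]
    by_cases his : i ∈ S
    · rw [if_pos his, (mem_signSet.1 his).2]; norm_num
    · rw [if_neg his, mul_one]
      exact (sign_eq_one_or hQ J hinj hi g).resolve_right fun h => his (mem_signSet.2 ⟨hi, h⟩))
  obtain ⟨g₁, rfl⟩ := hc₁.exists_toEnd_eq hQ hn₁
  obtain ⟨g₂, rfl⟩ := hc₂.exists_toEnd_eq hQ hn₂
  have h1 := congrArg LinearMap.det h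
  rw [map_mul, map_mul, det_toEnd, det_toEnd, det_toEnd, hp.det_reflection hS, one_mul, one_mul]
    at h1
  by_contra hodd
  rw [(Nat.not_even_iff_odd.1 hodd).neg_one_pow] at h1
  norm_num at h1

variable [Nontrivial V]

variable (hQ e) in
/-- The class of `-1` in the component group. -/
noncomputable def negOneClass : ASpin Q e := toASpin Q e (negOne hQ e)

variable (hQ) in
theorem negOneClass_mul_self : negOneClass hQ e * negOneClass hQ e = 1 := by
  have h : negOne hQ e * negOne hQ e = 1 :=
    Subtype.ext (Subtype.ext ((negOne_mul_coe hQ _).trans (neg_neg 1)))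
  rw [negOneClass, ← map_mul, h, map_one]

variable (hQ) in
theorem negOneClass_mul (a : ASpin Q e) : negOneClass hQ e * a = a * negOneClass hQ e := by
  obtain ⟨x, rfl⟩ := QuotientGroup.mk'_surjective _ a
  have h : negOne hQ e * x = x * negOne hQ e :=
    Subtype.ext (Subtype.ext ((negOne_mul_coe hQ x).trans (mul_neg_one _).symm))
  exact congrArg (toASpin Q e) h

variable (hQ J) in
include J hinj in
-- The identity component fixes the product of isotropic vectors, and -1 does not.
theorem negOneClass_ne_one : negOneClass hQ e ≠ 1 := by
  intro h
  have h1 : negOne hQ e ∈ identityComponent (centralizerSpin Q e) :=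
    (QuotientGroup.eq_one_iff _).1 h
  have h2 := ((mem_identityComponent_spin_iff hQ J hinj _).1 h1).2
  have h3 : isoProd (Q := Q) J + isoProd J = 0 := by
    nth_rewrite 1 [← h2]
    change -1 * isoProd J + isoProd J = 0
    rw [neg_one_mul, neg_add_cancel]
  rw [← two_smul ℂ] at h3
  exact isoProd_ne_zero J ((smul_eq_zero.1 h3).resolve_left two_ne_zero)

variable (hQ J) in
include J hinj in
/-- Classes of elements of the spin group with images in the same component. -/
theorem toASpin_eq_or {x y : centralizerSpin Q e}
    (h : toASO Q e (coverCentralizer Q e x) = toASO Q e (coverCentralizer Q e y)) :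
    toASpin Q e x = toASpin Q e y ∨ toASpin Q e x = negOneClass hQ e * toASpin Q e y := by
  have h1 : coverCentralizer Q e (x * y⁻¹) ∈ identityComponent (centralizerSO Q e) := by
    rw [map_mul, map_inv]
    refine (QuotientGroup.eq_one_iff _).1 ?_
    change toASO Q e (_ * _⁻¹) = 1
    rw [map_mul, map_inv, h, mul_inv_cancel]
  obtain ⟨w, hw, hw'⟩ := exists_lift_of_mem_identityComponent hQ J hinj h1
  have hw1 : toASpin Q e w = 1 := (QuotientGroup.eq_one_iff _).2
    ((mem_identityComponent_spin_iff hQ J hinj _).2 ⟨by rwa [hw], hw'⟩)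
  rcases eq_or_eq_negOne_mul hQ hw.symm with h2 | h2
  · left
    rw [← mul_inv_eq_one, ← map_inv, ← map_mul, h2, hw1]
  · right
    rw [← mul_inv_eq_iff_eq_mul, ← map_inv, ← map_mul, h2, map_mul, hw1, mul_one, negOneClass]

include hp hinj in
/-- The commutator pairing of the component group in the spin group is nondegenerate. -/
theorem exists_conj_eq_negOneClass_mul
    (hodd : Odd (Finset.univ.filter fun i => Odd (rows i)).card) (a : ASpin Q e) (ha : a ≠ 1)
    (ha' : a ≠ negOneClass hQ e) : ∃ b, b * a * b⁻¹ = negOneClass hQ e * a := by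
  obtain ⟨x, rfl⟩ : ∃ x, toASpin Q e x = a := QuotientGroup.mk'_surjective _ a
  set S := signSet J (coverCentralizer Q e x) with hSdef
  have hS : ∀ i ∈ S, Odd (rows i) := fun i hi => odd_of_mem_signSet hi
  have hSeven : Even S.card := even_card_signSet hp hinj _
  have hnot : ¬ coverCentralizer Q e x ∈ identityComponent (centralizerSO Q e) := by
    intro h
    have h1 : toASO Q e (coverCentralizer Q e x) = toASO Q e (coverCentralizer Q e 1) := by
      rw [map_one, map_one]; exact (QuotientGroup.eq_one_iff _).2 h
    rcases toASpin_eq_or hQ J hinj h1 with h2 | h2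
    · exact ha (by rw [h2, map_one])
    · exact ha' (by rw [h2, map_one, mul_one])
  obtain ⟨i, hiS⟩ : ∃ i, i ∈ S := by
    by_contra! h0
    refine hnot ((mem_identityComponent_iff hQ J hinj _).2 fun i hi => ?_)
    exact (sign_eq_one_or hQ J hinj hi _).resolve_right fun h => h0 i (mem_signSet.2 ⟨hi, h⟩)
  -- The sign set is even and the set of all odd rows is odd, so they differ.
  obtain ⟨j, hj, hjS⟩ : ∃ j, Odd (rows j) ∧ j ∉ S := by
    by_contra! h0
    have : S = Finset.univ.filter fun i => Odd (rows i) := by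
      ext i
      simp only [Finset.mem_filter, Finset.mem_univ, true_and]
      exact ⟨hS i, h0 i⟩
    rw [this] at hSeven
    exact (Nat.not_even_iff_odd.2 hodd) hSeven
  have hi := hS i hiS
  have hij : i ≠ j := fun h => hjS (h ▸ hiS)
  -- Within its component the image of `x` is replaced by the reflection in its sign set, which acts
  -- on the ranges of `p i` and `p j` by honest scalars.
  obtain ⟨g, hg⟩ := exists_toEnd_eq_reflection hp hS hSeven
  obtain ⟨h, hh⟩ := exists_toEnd_eq_reflection hp (S := {i, j})
    (by
      intro k hk
      rcases Finset.mem_insert.1 hk with rfl | hk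
      · exact hi
      · rw [Finset.mem_singleton.1 hk]; exact hj)
    (by rw [Finset.card_pair hij]; exact even_two)
  obtain ⟨x', hx'⟩ := coverCentralizer_surjective hQ g
  obtain ⟨y, hy⟩ := coverCentralizer_surjective hQ h
  obtain ⟨hpic, hpia, hpii, hpil, hpio⟩ := hp i hi
  obtain ⟨hpjc, hpja, hpjj, hpjl, -⟩ := hp j hj
  have hxx : toASO Q e (coverCentralizer Q e x) = toASO Q e (coverCentralizer Q e x') := by
    rw [hx', ← mul_inv_eq_one, ← map_inv, ← map_mul]
    refine (QuotientGroup.eq_one_iff _).2 ((mem_identityComponent_iff hQ J hinj _).2 fun k hk => ?_)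
    have hsg : sign J k g = if k ∈ S then -1 else 1 := by
      rw [sign, hg, hp.lead_reflection hS]
    have h1 : sign J k g⁻¹ = sign J k g := by
      have h2 := sign_mul J hinj hk g g⁻¹
      rw [mul_inv_cancel, sign_one] at h2
      rcases sign_eq_one_or hQ J hinj hk g with h3 | h3 <;> rw [h3] at h2 ⊢
      · rw [one_mul] at h2; exact h2.symm
      · linear_combination h2
    rw [sign_mul J hinj hk, h1, hsg]
    by_cases hkS : k ∈ S
    · rw [if_pos hkS, (mem_signSet.1 hkS).2]; norm_num
    · rw [if_neg hkS, mul_one]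
      exact (sign_eq_one_or hQ J hinj hk _).resolve_right fun h => hkS (mem_signSet.2 ⟨hk, h⟩)
  -- Row `i` is in the sign set and row `j` is not, so the two scalars are -1 and 1 and the lifts
  -- anticommute.
  have hanti := mul_eq_smul_mul_of_cover hQ hpii hpjj
    (fun v w => by conv_lhs => rw [← hpia, polar_adj_left])
    (fun v w => by conv_lhs => rw [← hpja, polar_adj_left])
    (by rwa [J.finrank_range_of_lead_eq_single hpic hpii hpil])
    (by rwa [J.finrank_range_of_lead_eq_single hpjc hpjj hpjl]) (x' : spinGroup Q)
    (y : spinGroup Q) (ε := -1) (δ := 1) (fun v => by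
      rw [← toEnd_coverCentralizer, hy, hh, ← Module.End.mul_apply]
      congr 1
      rw [reflection, Finset.sum_pair hij]
      have h0 : p i * p j = 0 := hpio j hj hij.symm
      rw [sub_mul, mul_sub, mul_sub, smul_mul_smul_comm, h0]
      simp only [mul_one, one_mul, smul_zero, smul_add]
      abel) (by norm_num) (by norm_num)
    (fun v => by
      rw [← toEnd_coverCentralizer, hx', hg, ← Module.End.mul_apply, hp.reflection_mul hS hi,
        if_pos hiS, LinearMap.neg_apply, neg_one_smul])
    (fun v => by
      rw [← toEnd_coverCentralizer, hx', hg, ← Module.End.mul_apply, hp.reflection_mul hS hj,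
        if_neg hjS, one_smul])
  have hyx : y * x' = negOne hQ e * x' * y := by
    refine Subtype.ext (Subtype.ext ?_)
    rw [mul_assoc, negOne_mul_coe]
    change ((y : spinGroup Q) : CliffordAlgebra Q) * ((x' : spinGroup Q) : CliffordAlgebra Q) =
      -(((x' : spinGroup Q) : CliffordAlgebra Q) * ((y : spinGroup Q) : CliffordAlgebra Q))
    rw [hanti, mul_one, neg_one_smul, neg_neg]
  have hconj : toASpin Q e y * toASpin Q e x' * (toASpin Q e y)⁻¹ =
      negOneClass hQ e * toASpin Q e x' := by
    rw [mul_inv_eq_iff_eq_mul, ← map_mul, hyx, map_mul, map_mul, negOneClass]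
  refine ⟨toASpin Q e y, ?_⟩
  rcases toASpin_eq_or hQ J hinj hxx with h1 | h1
  · rw [h1, hconj]
  · rw [h1, ← mul_assoc, ← negOneClass_mul hQ, mul_assoc (negOneClass hQ e),
      mul_assoc (negOneClass hQ e), hconj]

end SpinOrbit

/-! ### Extensions by a group of order two -/

namespace GroupExtension

/-- The central extension by a group of order two generated by the kernel of an epimorphism. -/
theorem exists_of_ker_eq_pair {E A : Type*} [Group E] [Group A] {π : E →* A}
    (hπ : Function.Surjective π) {z : E} (hz1 : z ≠ 1) (hz2 : z * z = 1)
    (hker : ∀ a, π a = 1 ↔ a = 1 ∨ a = z) :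
    ∃ S : GroupExtension (Multiplicative (ZMod 2)) E A,
      S.rightHom = π ∧ S.inl (Multiplicative.ofAdd 1) = z := by
  have h2 : z ^ 2 = 1 := by rw [pow_two, hz2]
  let f : Multiplicative (ZMod 2) →* E :=
    { toFun m := z ^ (Multiplicative.toAdd m).val
      map_one' := by simp
      map_mul' a b := by
        rw [toAdd_mul, ZMod.val_add, ← pow_eq_pow_mod _ h2, pow_add] }
  have hf0 : ∀ m, f m = 1 ∨ f m = z := by
    intro m
    have h := ZMod.val_lt (Multiplicative.toAdd m)
    change z ^ (Multiplicative.toAdd m).val = 1 ∨ z ^ (Multiplicative.toAdd m).val = z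
    interval_cases (Multiplicative.toAdd m).val
    · left; simp
    · right; simp
  have hf1 : f (Multiplicative.ofAdd 1) = z := by
    change z ^ (1 : ZMod 2).val = z
    rw [show (1 : ZMod 2).val = 1 from rfl, pow_one]
  refine ⟨⟨f, π, ?_, ?_, hπ⟩, rfl, hf1⟩
  · rw [injective_iff_map_eq_one]
    intro m hm
    by_contra hne
    have hm1 : Multiplicative.toAdd m = 1 := by
      have : ∀ t : ZMod 2, t ≠ 0 → t = 1 := by decide
      exact this _ hne
    rw [← ofAdd_toAdd m, hm1, hf1] at hm
    exact hz1 hm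
  · ext a
    rw [MonoidHom.mem_ker, hker, MonoidHom.mem_range]
    constructor
    · rintro ⟨m, rfl⟩
      exact hf0 m
    · rintro (rfl | rfl)
      · exact ⟨1, map_one f⟩
      · exact ⟨_, hf1⟩

variable {E A : Type*} [Group E] [Group A] (S : GroupExtension (Multiplicative (ZMod 2)) E A)

theorem rightHom_eq_one_iff (a : E) :
    S.rightHom a = 1 ↔ a = 1 ∨ a = S.inl (Multiplicative.ofAdd 1) := by
  rw [← MonoidHom.mem_ker, ← S.range_inl_eq_ker_rightHom, MonoidHom.mem_range]
  constructor
  · rintro ⟨m, rfl⟩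
    have : ∀ t : ZMod 2, t = 0 ∨ t = 1 := by decide
    rcases this (Multiplicative.toAdd m) with h | h
    · left
      rw [← ofAdd_toAdd m, h, ofAdd_zero, map_one]
    · right
      rw [← ofAdd_toAdd m, h]
  · rintro (rfl | rfl)
    · exact ⟨1, map_one _⟩
    · exact ⟨_, rfl⟩

include S in
theorem card_eq_two_mul : Nat.card E = 2 * Nat.card A := by
  rw [Subgroup.card_eq_card_quotient_mul_card_subgroup S.rightHom.ker,
    Nat.card_congr (QuotientGroup.quotientKerEquivOfSurjective _ S.rightHom_surjective).toEquiv,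
    ← S.range_inl_eq_ker_rightHom,
    ← Nat.card_congr (MonoidHom.ofInjective S.inl_injective).toEquiv, mul_comm]
  congr 1
  exact Nat.card_zmod 2

/-- A central extension of a nontrivial abelian group by a group of order two whose commutator
pairing is nondegenerate does not split. -/
theorem isEmpty_splitting (hz : ∀ a, S.inl (Multiplicative.ofAdd 1) * a =
      a * S.inl (Multiplicative.ofAdd 1))
    (hcomm : ∀ a, a ≠ 1 → a ≠ S.inl (Multiplicative.ofAdd 1) →
      ∃ b, b * a * b⁻¹ = S.inl (Multiplicative.ofAdd 1) * a)
    (hA : ∀ a b : A, a * b = b * a) [Nontrivial A] : IsEmpty S.Splitting := by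
  refine ⟨fun t => ?_⟩
  set z := S.inl (Multiplicative.ofAdd 1) with hzdef
  obtain ⟨a, ha⟩ := exists_ne (1 : A)
  have hta : S.rightHom (t.toMonoidHom a) = a := t.rightInverse_rightHom a
  obtain ⟨b, hb⟩ := hcomm (t.toMonoidHom a) (fun h => ha (by rw [← hta, h, map_one])) (fun h =>
    ha (by rw [← hta]; exact (S.rightHom_eq_one_iff _).2 (Or.inr h)))
  -- Every `b` equals a section value up to a central element, so it commutes with the section value
  -- of `a`; no conjugation could then produce the factor `z`.
  have h1 : S.rightHom (b * (t.toMonoidHom (S.rightHom b))⁻¹) = 1 := by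
    rw [map_mul, map_inv,
      show S.rightHom (t.toMonoidHom (S.rightHom b)) = S.rightHom b from
        t.rightInverse_rightHom _, mul_inv_cancel]
  have h2 : t.toMonoidHom (S.rightHom b) * t.toMonoidHom a =
      t.toMonoidHom a * t.toMonoidHom (S.rightHom b) := by rw [← map_mul, hA, map_mul]
  have h3 : b * t.toMonoidHom a = t.toMonoidHom a * b := by
    rcases (S.rightHom_eq_one_iff _).1 h1 with h | h
    · rw [mul_inv_eq_one.1 h, h2]
    · rw [mul_inv_eq_iff_eq_mul.1 h, mul_assoc, h2, ← mul_assoc, hz, mul_assoc]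
  rw [h3, mul_inv_cancel_right, right_eq_mul] at hb
  have h4 := S.inl_injective (hb.trans (map_one S.inl).symm)
  exact absurd h4 (by decide)

/-- The number of characters lifted from the quotient. -/
theorem ncard_lifted_characters {m : ℕ} (e : A ≃* Multiplicative (Fin m → ZMod 2)) :
    {χ : E →* ℂˣ | ∃ ψ : A →* ℂˣ, χ = ψ.comp S.rightHom}.ncard = 2 ^ m := by
  have h1 : {χ : E →* ℂˣ | ∃ ψ : A →* ℂˣ, χ = ψ.comp S.rightHom} =
      Set.range fun ψ : A →* ℂˣ => ψ.comp S.rightHom := by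
    ext χ
    exact ⟨fun ⟨ψ, h⟩ => ⟨ψ, h.symm⟩, fun ⟨ψ, h⟩ => ⟨ψ, h.symm⟩⟩
  have h2 : Function.Injective fun ψ : A →* ℂˣ => ψ.comp S.rightHom := fun ψ ψ' h =>
    (MonoidHom.cancel_right S.rightHom_surjective).1 h
  rw [h1, ← Set.image_univ, Set.ncard_image_of_injective _ h2, Set.ncard_univ,
    Nat.card_congr (e.monoidHomCongrLeft (N := ℂˣ)).toEquiv,
    CommGroup.card_monoidHom_of_hasEnoughRootsOfUnity _ ℂ]
  change Nat.card (Fin m → ZMod 2) = _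
  simp

end GroupExtension

/-! ### Columns, and the component group in SO -/

namespace SpinOrbit

open Classical in
-- This translates the condition on paired columns into multiplicities of odd rows.
theorem column_two_mul {s : ℕ} (rows : Fin s → ℕ) (j : ℕ) :
    column rows (2 * j) = column rows (2 * j + 1) +
      (Finset.univ.filter fun i => rows i = 2 * j + 1).card := by
  rw [column, column, ← Finset.card_union_of_disjoint]
  · congr 1
    ext i
    simp only [Finset.mem_filter, Finset.mem_union, Finset.mem_univ, true_and]
    omega
  · rw [Finset.disjoint_left]
    intro i
    simp only [Finset.mem_filter, Finset.mem_univ, true_and]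
    omega

theorem GenuineColumns.eq_of_odd {s : ℕ} {rows : Fin s → ℕ} {k : ℕ}
    (hk : GenuineColumns (column rows) k) (i i' : Fin s) (hi : Odd (rows i))
    (h : rows i = rows i') : i = i' := by
  classical
  obtain ⟨j, hj⟩ := hi
  have h1 := column_two_mul rows j
  have h2 : (Finset.univ.filter fun i => rows i = 2 * j + 1).card ≤ 1 := by
    rcases hk.pair j with h | h <;> omega
  exact Finset.card_le_one.1 h2 i (by simp [hj]) i' (by simp [← h, hj])

theorem GenuineColumns.card_odd {s : ℕ} {rows : Fin s → ℕ} {k : ℕ}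
    (hk : GenuineColumns (column rows) k) :
    (Finset.univ.filter fun i => Odd (rows i)).card = 2 * k + 1 := by
  classical
  rw [← hk.count]
  -- A pair with a drop corresponds to the unique odd row `2 * j + 1`, so `j` is recovered by
  -- halving.
  have h1 : {j | column rows (2 * j) = column rows (2 * j + 1) + 1} =
      ((Finset.univ.filter fun i => Odd (rows i)).image fun i => rows i / 2 : Finset ℕ) := by
    ext j
    have h2 := column_two_mul rows j
    simp only [Set.mem_ofPred_eq, Finset.coe_image, Set.mem_image, Finset.mem_coe,
      Finset.mem_filter, Finset.mem_univ, true_and]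
    constructor
    · intro h
      obtain ⟨i, hi⟩ := Finset.card_pos.1
        (show 0 < (Finset.univ.filter fun i => rows i = 2 * j + 1).card by omega)
      rw [Finset.mem_filter] at hi
      exact ⟨i, ⟨j, hi.2⟩, by omega⟩
    · rintro ⟨i, ⟨l, hl⟩, hi⟩
      have h3 : 0 < (Finset.univ.filter fun i => rows i = 2 * j + 1).card :=
        Finset.card_pos.2 ⟨i, by rw [Finset.mem_filter]; exact ⟨Finset.mem_univ i, by omega⟩⟩
      rcases hk.pair j with h | h <;> omega
  rw [h1, Set.ncard_coe_finset, Finset.card_image_of_injOn]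
  intro i hi i' hi' h
  simp only [Finset.coe_filter, Finset.mem_univ, true_and, Set.mem_ofPred_eq] at hi hi'
  refine hk.eq_of_odd i i' hi ?_
  obtain ⟨l, hl⟩ := hi
  obtain ⟨l', hl'⟩ := hi'
  simp only at h
  omega

section Component

open QuadraticMap JordanBasis

variable {V : Type*} [AddCommGroup V] [Module ℂ V] [FiniteDimensional ℂ V]
  {Q : QuadraticForm ℂ V} {hQ : (polarBilin Q).Nondegenerate}
  {e : so Q} {s : ℕ} {rows : Fin s → ℕ} {J : JordanBasis (e : Module.End ℂ V) rows}
  {p : Fin s → Module.End ℂ V} (hp : J.IsProjectionFamily hQ p)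
  (hinj : ∀ i i', Odd (rows i) → rows i = rows i' → i = i')

open Classical in
/-- The exponent of a sign. -/
noncomputable def signBit (c : ℂ) : ZMod 2 := if c = 1 then 0 else 1

theorem signBit_mul {c d : ℂ} (hc : c = 1 ∨ c = -1) (hd : d = 1 ∨ d = -1) :
    signBit (c * d) = signBit c + signBit d := by
  have h : (-1 : ℂ) ≠ 1 := by norm_num
  have h2 : (0 : ZMod 2) = 1 + 1 := by decide
  rcases hc with rfl | rfl <;> rcases hd with rfl | rfl <;> simp [signBit, h, ← h2]

include hp hinj in
/-- The component group of the centralizer in the special orthogonal group. -/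
theorem nonempty_ASO_mulEquiv {m : ℕ}
    (hcard : (Finset.univ.filter fun i => Odd (rows i)).card = m + 1) :
    Nonempty (ASO Q e ≃* Multiplicative (Fin m → ZMod 2)) := by
  classical
  -- The odd rows are enumerated so that the last can be left out: evenness of sign sets makes its
  -- sign a function of the others.
  let o := (Finset.univ.filter fun i => Odd (rows i)).orderEmbOfFin hcard
  have ho : ∀ l, Odd (rows (o l)) := fun l => by
    have := Finset.orderEmbOfFin_mem (Finset.univ.filter fun i => Odd (rows i)) hcard l
    exact (Finset.mem_filter.1 this).2
  have hsurj : ∀ i, Odd (rows i) → ∃ l, o l = i := fun i hi => by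
    have h := Finset.range_orderEmbOfFin (Finset.univ.filter fun i => Odd (rows i)) hcard
    have h2 : i ∈ Set.range o := by rw [h]; simpa using hi
    exact h2
  let φ : centralizerSO Q e →* Multiplicative (Fin m → ZMod 2) :=
    { toFun g := Multiplicative.ofAdd fun l => signBit (sign J (o l.castSucc) g)
      map_one' := by
        rw [← ofAdd_zero]
        congr 1
        funext l
        rw [sign_one]
        exact if_pos rfl
      map_mul' g h := by
        rw [← ofAdd_add]
        congr 1
        funext l
        rw [Pi.add_apply, sign_mul J hinj (ho _), signBit_mul (sign_eq_one_or hQ J hinj (ho _) g)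
          (sign_eq_one_or hQ J hinj (ho _) h)] }
  have hφ : ∀ g l, Multiplicative.toAdd (φ g) l = signBit (sign J (o l.castSucc) g) :=
    fun _ _ => rfl
  have hker : φ.ker = identityComponent (centralizerSO Q e) := by
    ext g
    rw [MonoidHom.mem_ker, mem_identityComponent_iff hQ J hinj]
    constructor
    · intro hg
      have h1 : ∀ l : Fin m, sign J (o l.castSucc) g = 1 := by
        intro l
        have h2 := hφ g l
        rw [hg] at h2
        by_contra h3
        rw [signBit, if_neg h3] at h2
        change (0 : ZMod 2) = 1 at h2
        exact absurd h2 (by decide)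
      -- Only the last row could carry -1, and a singleton is not an even set.
      have h2 : signSet J g ⊆ {o (Fin.last m)} := by
        intro i hi
        obtain ⟨hio, his⟩ := mem_signSet.1 hi
        obtain ⟨l, rfl⟩ := hsurj i hio
        rcases Fin.eq_castSucc_or_eq_last l with ⟨l, rfl⟩ | rfl
        · rw [h1] at his
          norm_num at his
        · exact Finset.mem_singleton_self _
      have h3 := Finset.card_le_card h2
      rw [Finset.card_singleton] at h3
      have h4 : signSet J g = ∅ := by
        rw [← Finset.card_eq_zero]
        obtain ⟨t, ht⟩ := even_card_signSet hp hinj g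
        omega
      intro i hi
      refine (sign_eq_one_or hQ J hinj hi g).resolve_right fun h => ?_
      have : i ∈ signSet J g := mem_signSet.2 ⟨hi, h⟩
      rw [h4] at this
      exact absurd this (Finset.notMem_empty i)
    · intro hg
      refine Multiplicative.toAdd.injective (funext fun l => ?_)
      rw [hφ, hg _ (ho _)]
      exact if_pos rfl
  have hφs : Function.Surjective φ := by
    intro f
    let S₀ : Finset (Fin s) := (Finset.univ.filter fun l : Fin m =>
      Multiplicative.toAdd f l = 1).image fun l => o l.castSucc
    have hS₀ : ∀ i ∈ S₀, Odd (rows i) := by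
      intro i hi
      obtain ⟨l, -, rfl⟩ := Finset.mem_image.1 hi
      exact ho _
    have hmem : ∀ l : Fin m, o l.castSucc ∈ S₀ ↔ Multiplicative.toAdd f l = 1 := by
      intro l
      simp only [S₀, Finset.mem_image, Finset.mem_filter, Finset.mem_univ, true_and]
      constructor
      · rintro ⟨l', h, h'⟩
        rwa [← Fin.castSucc_injective m (o.injective h')]
      · intro h
        exact ⟨l, h, rfl⟩
    have hlast : o (Fin.last m) ∉ S₀ := by
      intro h
      obtain ⟨l, -, hl⟩ := Finset.mem_image.1 h
      exact (Fin.castSucc_lt_last l).ne (o.injective hl)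
    -- The last row is added when needed to make the set even, which leaves the recorded signs
    -- unchanged.
    obtain ⟨S, hS, hSe, hSm⟩ : ∃ S : Finset (Fin s), (∀ i ∈ S, Odd (rows i)) ∧ Even S.card ∧
        ∀ l : Fin m, o l.castSucc ∈ S ↔ Multiplicative.toAdd f l = 1 := by
      rcases Nat.even_or_odd S₀.card with h | h
      · exact ⟨S₀, hS₀, h, hmem⟩
      · refine ⟨insert (o (Fin.last m)) S₀, fun i hi => ?_, ?_, fun l => ?_⟩
        · rcases Finset.mem_insert.1 hi with rfl | hi
          · exact ho _
          · exact hS₀ i hi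
        · rw [Finset.card_insert_of_notMem hlast]
          exact h.add_one
        · rw [Finset.mem_insert, hmem, or_iff_right]
          exact fun h => (Fin.castSucc_lt_last l).ne (o.injective h)
    obtain ⟨g, hg⟩ := exists_toEnd_eq_reflection hp hS hSe
    refine ⟨g, Multiplicative.toAdd.injective (funext fun l => ?_)⟩
    rw [hφ, sign, hg, hp.lead_reflection hS, signBit]
    have hz : ∀ t : ZMod 2, t ≠ 1 → 0 = t := by decide
    by_cases h : o l.castSucc ∈ S
    · rw [if_pos h, if_neg (by norm_num), (hSm l).1 h]
    · rw [if_neg h, if_pos rfl]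
      exact hz _ fun h' => h ((hSm l).2 h')
  exact ⟨(QuotientGroup.quotientMulEquivOfEq hker.symm).trans
    (QuotientGroup.quotientKerEquivOfSurjective φ hφs)⟩

end Component

end SpinOrbit

/-! ### The theorem -/

open QuadraticMap in
theorem propositionp {V : Type*} [AddCommGroup V] [Module ℂ V] [FiniteDimensional ℂ V]
    (Q : QuadraticForm ℂ V) (hQ : (QuadraticMap.polarBilin Q).Nondegenerate)
    (e : SpinOrbit.so Q) {s : ℕ} (rows : Fin s → ℕ)
    (he : SpinOrbit.HasJordanBlocks (e : Module.End ℂ V) rows)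
    (k : ℕ) (hk : SpinOrbit.GenuineColumns (SpinOrbit.column rows) k) :
    Nonempty (SpinOrbit.ASO Q e ≃* Multiplicative (Fin (2 * k) → ZMod 2)) ∧
    ∃ S : GroupExtension (Multiplicative (ZMod 2)) (SpinOrbit.ASpin Q e) (SpinOrbit.ASO Q e),
      (∀ x : SpinOrbit.centralizerSpin Q e,
        S.rightHom (SpinOrbit.toASpin Q e x) =
          SpinOrbit.toASO Q e (SpinOrbit.coverCentralizer Q e x)) ∧
      (∃ z : SpinOrbit.centralizerSpin Q e, ((z : spinGroup Q) : CliffordAlgebra Q) = -1 ∧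
        S.inl (Multiplicative.ofAdd 1) = SpinOrbit.toASpin Q e z) ∧
      S.inl.range ≤ Subgroup.center (SpinOrbit.ASpin Q e) ∧
      (1 ≤ k → IsEmpty S.Splitting) ∧
      {χ : SpinOrbit.ASpin Q e →* ℂˣ |
        ∃ ψ : SpinOrbit.ASO Q e →* ℂˣ, χ = ψ.comp S.rightHom}.ncard = 2 ^ (2 * k) ∧
      (∃ ρ : Representation ℂ (SpinOrbit.ASpin Q e) (Fin (2 ^ k) → ℂ),
        ρ.IsIrreducible ∧ SpinOrbit.IsGenuine Q e ρ ∧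
        ∀ {W : Type*} [AddCommGroup W] [Module ℂ W]
          (σ : Representation ℂ (SpinOrbit.ASpin Q e) W),
          σ.IsIrreducible → SpinOrbit.IsGenuine Q e σ → Nonempty (σ.Equiv ρ)) ∧
      (∀ {W : Type*} [AddCommGroup W] [Module ℂ W]
        (σ : Representation ℂ (SpinOrbit.ASpin Q e) W), σ.IsIrreducible →
        SpinOrbit.IsGenuine Q e σ ∨
          (Module.finrank ℂ W = 1 ∧ ∃ ψ : SpinOrbit.ASO Q e →* ℂˣ,
            ∀ a w, σ a w = (ψ (S.rightHom a) : ℂ) • w)) := by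
  obtain ⟨hpos, b, hb⟩ := he
  let J : SpinOrbit.JordanBasis (e : Module.End ℂ V) rows := ⟨hpos, b, hb⟩
  have hinj := hk.eq_of_odd
  have hodd := hk.card_odd
  -- There is at least one odd row, since 2k+1 is positive.
  have : Nontrivial V := by
    obtain ⟨i, -⟩ := Finset.card_pos.1 (hodd.symm ▸ Nat.succ_pos (2 * k) :
      0 < (Finset.univ.filter fun i => Odd (rows i)).card)
    exact ⟨b ⟨i, ⟨0, hpos i⟩⟩, 0, b.ne_zero _⟩
  have hskew := SpinOrbit.adj_eq_neg_of_mem_so hQ e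
  obtain ⟨p, hp⟩ := J.exists_projections hQ hskew hinj
  have hp : J.IsProjectionFamily hQ p := hp
  obtain ⟨iso⟩ := SpinOrbit.nonempty_ASO_mulEquiv hp hinj hodd
  set z := SpinOrbit.negOneClass hQ e with hzdef
  have hz1 : z ≠ 1 := SpinOrbit.negOneClass_ne_one hQ J hinj
  have hz2 : z * z = 1 := SpinOrbit.negOneClass_mul_self hQ
  have hz : ∀ a, z * a = a * z := SpinOrbit.negOneClass_mul hQ
  have hcomm : ∀ a, a ≠ 1 → a ≠ z → ∃ b, b * a * b⁻¹ = z * a :=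
    SpinOrbit.exists_conj_eq_negOneClass_mul hp hinj (hodd ▸ odd_two_mul_add_one k)
  let π : SpinOrbit.ASpin Q e →* SpinOrbit.ASO Q e :=
    QuotientGroup.map _ _ (SpinOrbit.coverCentralizer Q e) fun x hx =>
      ((SpinOrbit.mem_identityComponent_spin_iff hQ J hinj x).1 hx).1
  have hπ : ∀ x, π (SpinOrbit.toASpin Q e x) =
      SpinOrbit.toASO Q e (SpinOrbit.coverCentralizer Q e x) := fun _ => rfl
  have hπs : Function.Surjective π := by
    intro a
    obtain ⟨g, rfl⟩ := QuotientGroup.mk'_surjective _ a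
    obtain ⟨x, rfl⟩ := SpinOrbit.coverCentralizer_surjective hQ g
    exact ⟨_, hπ x⟩
  have hker : ∀ a, π a = 1 ↔ a = 1 ∨ a = z := by
    intro a
    constructor
    · intro h
      obtain ⟨x, rfl⟩ : ∃ x, SpinOrbit.toASpin Q e x = a := QuotientGroup.mk'_surjective _ a
      have h1 : SpinOrbit.toASO Q e (SpinOrbit.coverCentralizer Q e x) =
          SpinOrbit.toASO Q e (SpinOrbit.coverCentralizer Q e 1) := by
        rw [map_one, map_one, ← hπ, h]
      simpa using SpinOrbit.toASpin_eq_or hQ J hinj h1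
    · rintro (rfl | rfl)
      · exact map_one π
      · rw [hzdef, SpinOrbit.negOneClass, hπ, SpinOrbit.coverCentralizer_negOne, map_one]
  obtain ⟨S, hSπ, hSz⟩ := GroupExtension.exists_of_ker_eq_pair hπs hz1 hz2 hker
  have hcardA : Nat.card (SpinOrbit.ASO Q e) = 2 ^ (2 * k) := by
    rw [Nat.card_congr iso.toEquiv]
    change Nat.card (Fin (2 * k) → ZMod 2) = _
    simp
  have hcard : Nat.card (SpinOrbit.ASpin Q e) = 2 ^ (2 * k + 1) := by
    rw [S.card_eq_two_mul, hcardA, pow_succ']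
  have : Finite (SpinOrbit.ASpin Q e) :=
    Nat.finite_of_card_ne_zero (by rw [hcard]; positivity)
  have hA : ∀ a b : SpinOrbit.ASO Q e, a * b = b * a := fun a b =>
    iso.injective (by rw [map_mul, map_mul]; exact mul_comm (iso a) (iso b))
  have hA2 : ∀ a : SpinOrbit.ASO Q e, a * a = 1 := by
    intro a
    have h2 : ∀ t : ZMod 2, t + t = 0 := by decide
    refine iso.injective ?_
    rw [map_mul, map_one]
    exact Multiplicative.toAdd.injective (funext fun l => h2 _)
  have hgen : ∀ {W : Type _} [AddCommGroup W] [Module ℂ W]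
      (σ : Representation ℂ (SpinOrbit.ASpin Q e) W), SpinOrbit.IsGenuine Q e σ ↔ σ z = -1 := by
    intro W _ _ σ
    constructor
    · exact fun h => h (SpinOrbit.negOne hQ e) rfl
    · intro h x hx
      obtain rfl : x = SpinOrbit.negOne hQ e := Subtype.ext (Subtype.ext hx)
      exact h
  refine ⟨⟨iso⟩, S, fun x => by rw [hSπ, hπ], ⟨SpinOrbit.negOne hQ e, rfl, hSz⟩, ?_, ?_,
    S.ncard_lifted_characters iso, ?_, ?_⟩
  · rw [S.range_inl_eq_ker_rightHom, hSπ]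
    intro a ha
    rw [Subgroup.mem_center_iff]
    intro c
    rcases (hker a).1 ha with rfl | rfl
    · rw [one_mul, mul_one]
    · exact (hz c).symm
  · intro hk1
    have : Nontrivial (SpinOrbit.ASO Q e) := by
      have : Finite (SpinOrbit.ASO Q e) :=
        Nat.finite_of_card_ne_zero (by rw [hcardA]; positivity)
      rw [← Finite.one_lt_card_iff_nontrivial, hcardA]
      exact Nat.one_lt_two_pow (by omega)
    exact S.isEmpty_splitting (by rwa [hSz]) (by rwa [hSz]) hA
  · obtain ⟨ρ, hρ, hρz⟩ := Representation.exists_fin_genuine hz hz1 hz2 hcomm hcard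
    refine ⟨ρ, hρ, (hgen ρ).2 hρz, fun σ hσ hσz => ?_⟩
    have hσz' : σ z = -1 := hσz (SpinOrbit.negOne hQ e) rfl
    exact Representation.nonempty_equiv_of_genuine hz1 hz2 hcomm ρ hρz hρ σ hσz' hσ
  · intro W _ _ σ hσ
    rcases Representation.IsIrreducible.central_involution hz hz2 hσ with h | h
    · left
      intro x hx
      obtain rfl : x = SpinOrbit.negOne hQ e := Subtype.ext (Subtype.ext hx)
      exact h
    · right
      -- When the class of -1 acts trivially, `σ` depends only on images in the elementary abelian
      -- quotient: it consists of commuting involutions and is a character, which then descends.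
      have h1 : ∀ a, S.rightHom a = 1 → σ a = 1 := by
        intro a ha
        rcases (S.rightHom_eq_one_iff a).1 ha with rfl | rfl
        · exact map_one σ
        · rwa [hSz]
      have h2 : ∀ a c, S.rightHom a = S.rightHom c → σ a = σ c := by
        intro a c hac
        have h3 := h1 (a * c⁻¹) (by rw [map_mul, map_inv, hac, mul_inv_cancel])
        rw [← inv_mul_cancel_right a c, map_mul, h3, one_mul]
      obtain ⟨hfin, χ, hχ⟩ := hσ.exists_character
        (fun a => h1 _ (by rw [map_mul, hA2])) (fun a c => h2 _ _ (by rw [map_mul, hA, map_mul]))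
      have hnt := hσ.nontrivial_space
      obtain ⟨w, hw⟩ := exists_ne (0 : W)
      have hχker : S.rightHom.ker ≤ χ.ker := by
        intro a ha
        have h3 := hχ a w
        rw [h1 a ha, Module.End.one_apply] at h3
        refine Units.ext (smul_left_injective ℂ hw ?_)
        simp only [← h3, Units.val_one, one_smul]
      refine ⟨hfin, S.rightHom.liftOfSurjective S.rightHom_surjective ⟨χ, hχker⟩, fun a w => ?_⟩
      rw [hχ]
      have h3 := S.rightHom.liftOfRightInverse_comp_apply _
        (Function.rightInverse_surjInv S.rightHom_surjective) ⟨χ, hχker⟩ a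
      rw [MonoidHom.liftOfSurjective, h3]
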